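/- **Theorem.** Let $k$ be a positive integer. There is an algorithm (depending only on $k$) that solves the following problem. The input consists of - a finite simple graph $G$, - a finite family $\mathcal H=\{H_j\}_{j\in J}$ of connected nonnull subgraphs of $G$ (repetitions allowed) with nonnegative rational weights $w_j$, $j\in J$, and - a tree decomposition $\mathcal T=(T,\{X_t\}_{t\in V(T)})$ of $G$ with independence number at most $k$; that is, $T$ is a finite tree, $X_t\subseteq V(G)$ for each node $t$, every vertex of $G$ lies in some $X_t$, every edge of $G$ has both ends in some $X_t$, for every $v\in V(G)$ the set $\{t : v\in X_t\}$ induces a connected subgraph of $T$, and for every $t$ each independent set of the induced subgraph $G[X_t]$ has at most $k$ vertices. The output is a set $I\subseteq J$ that is an independent $\mathcal H$-packing (for all distinct $i,j\in I$, the graphs $H_i$ and $H_j$ are vertex-disjoint and no edge of $G$ joins them) and whose weight $\sum_{j\in I}w_j$ is maximum among all independent $\mathcal H$-packings; i.e., the Max Weight Independent Packing problem is solved. The running time is $$\mathcal O\Bigl(1+|J|\cdot\bigl((|J|+|V(T)|)\cdot|V(G)|+|E(G)|+|J|^{k}\cdot|V(T)|\bigr)\Bigr),$$ where the implied constant depends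 only on $k$. Here time is measured on a unit-cost random access machine whose integer words have $\mathcal O(\log N)$ bits, with $N=|V(G)|+|E(G)|+|J|+|V(T)|+2$ and the implied constant depending only on $k$, and on which copying, adding, subtracting and comparing rational weights takes one step each. The graphs $G$ and $T$ are given by adjacency lists, the subgraphs $H_j$ by vertex and edge lists, and the bags $X_t$ by vertex lists, each in arbitrary order. -/

import Mathlib

/-! ## Tree decompositions and independent packings -/

/-- `(T, X)` is a tree decomposition of `G`. -/
structure IsTreeDecomposition {V N : Type*} (G : SimpleGraph V) (T : SimpleGraph N)
    (X : N → Set V) : Prop where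
  isTree : T.IsTree
  exists_mem : ∀ v : V, ∃ t, v ∈ X t
  exists_edge : ∀ u v : V, G.Adj u v → ∃ t, u ∈ X t ∧ v ∈ X t
  connected : ∀ v : V, (T.induce {t | v ∈ X t}).Connected

/-- The independence number of a tree decomposition with bags `X t`: the maximum over all nodes
`t` of the independence number of the subgraph of `G` induced by the bag `X t`. -/
noncomputable def bagsIndepNum {V N : Type*} [Fintype N] (G : SimpleGraph V) (X : N → Set V) : ℕ :=
  Finset.univ.sup fun t => (G.induce (X t)).indepNum

/-- The subfamily of `H` indexed by `I` is an independent packing in `G`: any two of its members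
are vertex-disjoint and no edge of `G` joins them. -/
def IsIndepPacking {V J : Type*} (G : SimpleGraph V) (H : J → G.Subgraph) (I : Finset J) : Prop :=
  ∀ i ∈ I, ∀ j ∈ I, i ≠ j →
    Disjoint (H i).verts (H j).verts ∧ ∀ u ∈ (H i).verts, ∀ v ∈ (H j).verts, ¬ G.Adj u v

/-- `I` solves the instance `(G, H, w)` of Max Weight Independent Packing. -/
def IsMaxWeightIndepPacking {V J : Type*} (G : SimpleGraph V) (H : J → G.Subgraph) (w : J → NNRat)
    (I : Finset J) : Prop :=
  IsIndepPacking G H I ∧ ∀ I' : Finset J, IsIndepPacking G H I' → ∑ j ∈ I', w j ≤ ∑ j ∈ I, w j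

/-! ## Random access machine

A unit-cost word RAM, programmed in a structured language.  The memory consists of integer
variables, integer arrays and arrays of rationals.  A program is a fixed finite text, so it uses
finitely many variables and arrays.  Integers must stay below a word bound `W`: a program that
produces a larger integer (as a value, an intermediate result or an address) has no execution.
Rationals can only be copied, added, subtracted and compared. -/

namespace RAM

structure State where
  var : ℕ → ℕ
  arr : ℕ → ℕ → ℕ
  wt : ℕ → ℕ → ℚ

def State.setVar (s : State) (x v : ℕ) : State :=
  { s with var := Function.update s.var x v }

def State.setArr (s : State) (a i v : ℕ) : State :=
  { s with arr := Function.update s.arr a (Function.update (s.arr a) i v) }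

def State.setWt (s : State) (a i : ℕ) (v : ℚ) : State :=
  { s with wt := Function.update s.wt a (Function.update (s.wt a) i v) }

/-- Binary integer operations (`sub` is truncated subtraction). -/
inductive Op
  | add | sub | mul | div | mod

def Op.eval : Op → ℕ → ℕ → ℕ
  | .add, a, b => a + b
  | .sub, a, b => a - b
  | .mul, a, b => a * b
  | .div, a, b => a / b
  | .mod, a, b => a % b

/-- Integer expressions. -/
inductive Exp
  | lit (c : ℕ)
  | var (x : ℕ)
  | get (a : ℕ) (i : Exp)
  | op (o : Op) (e f : Exp)

def Exp.eval (s : State) : Exp → ℕ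
  | .lit c => c
  | .var x => s.var x
  | .get a i => s.arr a (i.eval s)
  | .op o e f => o.eval (e.eval s) (f.eval s)

/-- Every subexpression has a value below the word bound `W`. -/
def Exp.Fits (W : ℕ) (s : State) : Exp → Prop
  | .lit c => c < W
  | .var x => s.var x < W
  | .get a i => i.Fits W s ∧ s.arr a (i.eval s) < W
  | .op o e f => e.Fits W s ∧ f.Fits W s ∧ o.eval (e.eval s) (f.eval s) < W

/-- Each literal, memory access and operation takes one step. -/
def Exp.cost : Exp → ℕ
  | .lit _ => 1
  | .var _ => 1
  | .get _ i => i.cost + 1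
  | .op _ e f => e.cost + f.cost + 1

/-- Rational expressions. -/
inductive WExp
  | zero
  | get (a : ℕ) (i : Exp)
  | add (u v : WExp)
  | sub (u v : WExp)

def WExp.eval (s : State) : WExp → ℚ
  | .zero => 0
  | .get a i => s.wt a (i.eval s)
  | .add u v => u.eval s + v.eval s
  | .sub u v => u.eval s - v.eval s

def WExp.Fits (W : ℕ) (s : State) : WExp → Prop
  | .zero => True
  | .get _ i => i.Fits W s
  | .add u v => u.Fits W s ∧ v.Fits W s
  | .sub u v => u.Fits W s ∧ v.Fits W s

def WExp.cost : WExp → ℕ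
  | .zero => 1
  | .get _ i => i.cost + 1
  | .add u v => u.cost + v.cost + 1
  | .sub u v => u.cost + v.cost + 1

/-- Tests. -/
inductive Cond
  | le (e f : Exp)
  | eq (e f : Exp)
  | wle (u v : WExp)
  | not (c : Cond)
  | and (c d : Cond)

def Cond.Holds (s : State) : Cond → Prop
  | .le e f => e.eval s ≤ f.eval s
  | .eq e f => e.eval s = f.eval s
  | .wle u v => u.eval s ≤ v.eval s
  | .not c => ¬ c.Holds s
  | .and c d => c.Holds s ∧ d.Holds s

def Cond.Fits (W : ℕ) (s : State) : Cond → Prop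
  | .le e f => e.Fits W s ∧ f.Fits W s
  | .eq e f => e.Fits W s ∧ f.Fits W s
  | .wle u v => u.Fits W s ∧ v.Fits W s
  | .not c => c.Fits W s
  | .and c d => c.Fits W s ∧ d.Fits W s

def Cond.cost : Cond → ℕ
  | .le e f => e.cost + f.cost + 1
  | .eq e f => e.cost + f.cost + 1
  | .wle u v => u.cost + v.cost + 1
  | .not c => c.cost + 1
  | .and c d => c.cost + d.cost + 1

/-- Programs. -/
inductive Prog
  | skip
  | setVar (x : ℕ) (e : Exp)
  | setArr (a : ℕ) (i e : Exp)
  | setWt (a : ℕ) (i : Exp) (u : WExp)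
  | seq (p q : Prog)
  | cond (c : Cond) (p q : Prog)
  | loop (c : Cond) (p : Prog)

/-- `Exec W p s s' t`: with word bound `W`, the program `p` started in `s` halts in `s'` after
exactly `t` steps.  (`loop c p` repeats `p` while `c` holds.) -/
inductive Exec (W : ℕ) : Prog → State → State → ℕ → Prop
  | skip (s : State) : Exec W .skip s s 1
  | setVar (s : State) (x : ℕ) (e : Exp) (he : e.Fits W s) :
      Exec W (.setVar x e) s (s.setVar x (e.eval s)) (e.cost + 1)
  | setArr (s : State) (a : ℕ) (i e : Exp) (hi : i.Fits W s) (he : e.Fits W s) :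
      Exec W (.setArr a i e) s (s.setArr a (i.eval s) (e.eval s)) (i.cost + e.cost + 1)
  | setWt (s : State) (a : ℕ) (i : Exp) (u : WExp) (hi : i.Fits W s) (hu : u.Fits W s) :
      Exec W (.setWt a i u) s (s.setWt a (i.eval s) (u.eval s)) (i.cost + u.cost + 1)
  | seq (p q : Prog) (s₁ s₂ s₃ : State) (t₁ t₂ : ℕ) (h₁ : Exec W p s₁ s₂ t₁)
      (h₂ : Exec W q s₂ s₃ t₂) : Exec W (.seq p q) s₁ s₃ (t₁ + t₂)
  | cond_true (c : Cond) (p q : Prog) (s s' : State) (t : ℕ) (hf : c.Fits W s) (hc : c.Holds s)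
      (h : Exec W p s s' t) : Exec W (.cond c p q) s s' (c.cost + 1 + t)
  | cond_false (c : Cond) (p q : Prog) (s s' : State) (t : ℕ) (hf : c.Fits W s) (hc : ¬ c.Holds s)
      (h : Exec W q s s' t) : Exec W (.cond c p q) s s' (c.cost + 1 + t)
  | loop_true (c : Cond) (p : Prog) (s₁ s₂ s₃ : State) (t₁ t₂ : ℕ) (hf : c.Fits W s₁)
      (hc : c.Holds s₁) (h₁ : Exec W p s₁ s₂ t₁) (h₂ : Exec W (.loop c p) s₂ s₃ t₂) :
      Exec W (.loop c p) s₁ s₃ (c.cost + 1 + t₁ + t₂)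
  | loop_false (c : Cond) (p : Prog) (s : State) (hf : c.Fits W s) (hc : ¬ c.Holds s) :
      Exec W (.loop c p) s s (c.cost + 1)

end RAM

/-! ## Encoding of the input and output -/

/-- The list `l` enumerates the set `S` without repetition, in an arbitrary order. -/
def Enumerates {α : Type*} (l : List α) (S : Set α) : Prop :=
  l.Nodup ∧ ∀ x, x ∈ l ↔ x ∈ S

/-- Lists representing the graph `G`, the subgraphs `H j`, the tree `T` and the bags `X t`:
adjacency lists of `G` and `T`, vertex and edge lists of the subgraphs, and vertex lists of the
bags. All lists may be in any order. -/
structure PackingEncoding {n m q : ℕ} (G : SimpleGraph (Fin n)) (H : Fin m → G.Subgraph)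
    (T : SimpleGraph (Fin q)) (X : Fin q → Set (Fin n)) where
  adjG : Fin n → List (Fin n)
  adjG_spec : ∀ u, Enumerates (adjG u) (G.neighborSet u)
  vertsH : Fin m → List (Fin n)
  vertsH_spec : ∀ j, Enumerates (vertsH j) (H j).verts
  edgesH : Fin m → List (Fin n × Fin n)
  edgesH_spec : ∀ j, Enumerates ((edgesH j).map fun p => s(p.1, p.2)) (H j).edgeSet
  adjT : Fin q → List (Fin q)
  adjT_spec : ∀ t, Enumerates (adjT t) (T.neighborSet t)
  bag : Fin q → List (Fin n)
  bag_spec : ∀ t, Enumerates (bag t) (X t)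

/-- A finite sequence of lists is stored in two arrays: their concatenation, and the starting
position of each list in it. -/
def listStart (L : List (List ℕ)) (i : ℕ) : ℕ :=
  ((L.take i).map List.length).sum

/-- See `listStart`. -/
def listData (L : List (List ℕ)) (p : ℕ) : ℕ :=
  L.flatten.getD p 0

/-- The initial memory. Variables 0, 1, 2 hold the numbers of vertices, of subgraphs and of tree
nodes; arrays 0 to 9 hold the lists; weight array 0 holds the weights; everything else is 0. -/
def PackingEncoding.init {n m q : ℕ} {G : SimpleGraph (Fin n)} {H : Fin m → G.Subgraph}
    {T : SimpleGraph (Fin q)} {X : Fin q → Set (Fin n)} (E : PackingEncoding G H T X)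
    (w : Fin m → NNRat) : RAM.State where
  var
    | 0 => n
    | 1 => m
    | 2 => q
    | _ => 0
  arr
    | 0 => listStart (List.ofFn fun u => (E.adjG u).map Fin.val)
    | 1 => listData (List.ofFn fun u => (E.adjG u).map Fin.val)
    | 2 => listStart (List.ofFn fun j => (E.vertsH j).map Fin.val)
    | 3 => listData (List.ofFn fun j => (E.vertsH j).map Fin.val)
    | 4 => listStart (List.ofFn fun j => (E.edgesH j).flatMap fun p => [p.1.val, p.2.val])
    | 5 => listData (List.ofFn fun j => (E.edgesH j).flatMap fun p => [p.1.val, p.2.val])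
    | 6 => listStart (List.ofFn fun t => (E.adjT t).map Fin.val)
    | 7 => listData (List.ofFn fun t => (E.adjT t).map Fin.val)
    | 8 => listStart (List.ofFn fun t => (E.bag t).map Fin.val)
    | 9 => listData (List.ofFn fun t => (E.bag t).map Fin.val)
    | _ => fun _ => 0
  wt
    | 0 => fun p => if h : p < m then (w ⟨p, h⟩ : ℚ) else 0
    | _ => fun _ => 0

/-- The set of indices that array 10 of the final memory marks by a nonzero entry. -/
def packingOutput (m : ℕ) (s : RAM.State) : Finset (Fin m) :=
  Finset.univ.filter fun j => s.arr 10 j ≠ 0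

/-! ## Reasoning about programs -/

namespace RAM

/-! A packing has at most `k` members that meet a given bag: choosing from each of them a vertex in
the bag gives an independent set of the bag (`card_le_of_bag`). The trace of a packing on a node,
that is, the set of its members that meet the bag, therefore has at most `k` elements. It is coded
by a number below `M = (m + 1) ^ k`, whose base `m + 1` digits are the indices shifted by one.

Packings correspond to families of conflict-free traces, one for each node, such that the two traces
at the ends of every tree edge agree on the subgraphs that meet both bags. Indeed, a connected
subgraph meets the bags of a connected set of nodes, so agreement across edges makes membership
global (`meets_connected`). Two conflicting subgraphs meet a common bag, so conflicts are detected
locally (`conflict_meets`). In the rooted tree this connected set has exactly one top node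
(`existsUnique_top`). If each node pays only for the elements of its trace that miss the bag of its
parent, every weight is paid exactly once (`sum_wsum_sub`).

The dynamic program runs from the leaves to the root. For each possible projection to the parent, a
node stores the best value of its own payment plus the messages from its children. The parent looks
this value up under the projection of its own state to the child. Thus a node costs `O(M)` steps
rather than `O(M ^ 2)`. Summed over the tree, all messages cancel except the one received by a dummy
parent `q` of the root, a node that no subgraph meets. That message bounds the weight of every
packing (`IsDP.le`), and following the stored maximizers from the root downwards attains it
(`IsDP.eq`).

For the running time, the closed neighbourhoods of the subgraphs take `O(m (n + |E(G)|))` steps and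
the conflict and meeting tables `O((m + q) m n)`. Validity, weight and projection of a code each
come in constant time from smaller codes (`isCode_iff`, `wsum_eq`, `proj_eq_ite`), so the rest is
`O(q M)` for fixed `k`, and `M ≤ 2 ^ k * m ^ k`. The programs are verified with a Hoare-style
judgement `Run` that also bounds the number of steps; `Frame` records what a program leaves alone.
-/

instance : Add Exp := ⟨.op .add⟩
instance : Sub Exp := ⟨.op .sub⟩
instance : Mul Exp := ⟨.op .mul⟩
instance : Div Exp := ⟨.op .div⟩
instance : Mod Exp := ⟨.op .mod⟩

/-- All integers in memory are below the word bound. -/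
def Bounded (W : ℕ) (s : State) : Prop := (∀ x, s.var x < W) ∧ ∀ a i, s.arr a i < W

/-- The part of `Exp.Fits` that does not follow from `Bounded`. -/
def Exp.Ok (W : ℕ) (s : State) : Exp → Prop
  | .lit c => c < W
  | .var _ => True
  | .get _ i => i.Ok W s
  | .op .add e f => e.Ok W s ∧ f.Ok W s ∧ e.eval s + f.eval s < W
  | .op .mul e f => e.Ok W s ∧ f.Ok W s ∧ e.eval s * f.eval s < W
  | .op _ e f => e.Ok W s ∧ f.Ok W s

def WExp.Ok (W : ℕ) (s : State) : WExp → Prop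
  | .zero => True
  | .get _ i => i.Ok W s
  | .add u v => u.Ok W s ∧ v.Ok W s
  | .sub u v => u.Ok W s ∧ v.Ok W s

def Cond.Ok (W : ℕ) (s : State) : Cond → Prop
  | .le e f => e.Ok W s ∧ f.Ok W s
  | .eq e f => e.Ok W s ∧ f.Ok W s
  | .wle u v => u.Ok W s ∧ v.Ok W s
  | .not c => c.Ok W s
  | .and c d => c.Ok W s ∧ d.Ok W s

section simpLemmas

variable (W : ℕ) (s : State) (e f : Exp)

@[simp] theorem Exp.eval_lit (c : ℕ) : (Exp.lit c).eval s = c := rfl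
@[simp] theorem Exp.eval_var (x : ℕ) : (Exp.var x).eval s = s.var x := rfl
@[simp] theorem Exp.eval_get (a : ℕ) : (Exp.get a e).eval s = s.arr a (e.eval s) := rfl
@[simp] theorem Exp.eval_add : (e + f).eval s = e.eval s + f.eval s := rfl
@[simp] theorem Exp.eval_sub : (e - f).eval s = e.eval s - f.eval s := rfl
@[simp] theorem Exp.eval_mul : (e * f).eval s = e.eval s * f.eval s := rfl
@[simp] theorem Exp.eval_div : (e / f).eval s = e.eval s / f.eval s := rfl
@[simp] theorem Exp.eval_mod : (e % f).eval s = e.eval s % f.eval s := rfl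

@[simp] theorem Exp.ok_lit (c : ℕ) : (Exp.lit c).Ok W s ↔ c < W := Iff.rfl
@[simp] theorem Exp.ok_var (x : ℕ) : (Exp.var x).Ok W s := trivial
@[simp] theorem Exp.ok_get (a : ℕ) : (Exp.get a e).Ok W s ↔ e.Ok W s := Iff.rfl
@[simp] theorem Exp.ok_add :
    (e + f).Ok W s ↔ e.Ok W s ∧ f.Ok W s ∧ e.eval s + f.eval s < W := Iff.rfl
@[simp] theorem Exp.ok_mul :
    (e * f).Ok W s ↔ e.Ok W s ∧ f.Ok W s ∧ e.eval s * f.eval s < W := Iff.rfl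
@[simp] theorem Exp.ok_sub : (e - f).Ok W s ↔ e.Ok W s ∧ f.Ok W s := Iff.rfl
@[simp] theorem Exp.ok_div : (e / f).Ok W s ↔ e.Ok W s ∧ f.Ok W s := Iff.rfl
@[simp] theorem Exp.ok_mod : (e % f).Ok W s ↔ e.Ok W s ∧ f.Ok W s := Iff.rfl

@[simp] theorem Exp.cost_lit (c : ℕ) : (Exp.lit c).cost = 1 := rfl
@[simp] theorem Exp.cost_var (x : ℕ) : (Exp.var x).cost = 1 := rfl
@[simp] theorem Exp.cost_get (a : ℕ) : (Exp.get a e).cost = e.cost + 1 := rfl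
@[simp] theorem Exp.cost_add : (e + f).cost = e.cost + f.cost + 1 := rfl
@[simp] theorem Exp.cost_sub : (e - f).cost = e.cost + f.cost + 1 := rfl
@[simp] theorem Exp.cost_mul : (e * f).cost = e.cost + f.cost + 1 := rfl
@[simp] theorem Exp.cost_div : (e / f).cost = e.cost + f.cost + 1 := rfl
@[simp] theorem Exp.cost_mod : (e % f).cost = e.cost + f.cost + 1 := rfl

attribute [simp] WExp.eval WExp.Ok WExp.cost Cond.Holds Cond.Ok Cond.cost

@[simp] theorem State.var_setVar (x v y : ℕ) :
    (s.setVar x v).var y = if y = x then v else s.var y := Function.update_apply ..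
@[simp] theorem State.arr_setVar (x v : ℕ) : (s.setVar x v).arr = s.arr := rfl
@[simp] theorem State.wt_setVar (x v : ℕ) : (s.setVar x v).wt = s.wt := rfl
@[simp] theorem State.var_setArr (a i v : ℕ) : (s.setArr a i v).var = s.var := rfl
@[simp] theorem State.arr_setArr (a i v a' : ℕ) : (s.setArr a i v).arr a' =
    if a' = a then Function.update (s.arr a) i v else s.arr a' := Function.update_apply ..
@[simp] theorem State.wt_setArr (a i v : ℕ) : (s.setArr a i v).wt = s.wt := rfl
@[simp] theorem State.var_setWt (a i : ℕ) (v : ℚ) : (s.setWt a i v).var = s.var := rfl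
@[simp] theorem State.arr_setWt (a i : ℕ) (v : ℚ) : (s.setWt a i v).arr = s.arr := rfl
@[simp] theorem State.wt_setWt (a i : ℕ) (v : ℚ) (a' : ℕ) : (s.setWt a i v).wt a' =
    if a' = a then Function.update (s.wt a) i v else s.wt a' := Function.update_apply ..

end simpLemmas

theorem Exp.Fits.lt {W : ℕ} {s : State} {e : Exp} (h : e.Fits W s) : e.eval s < W := by
  cases e with
  | lit => exact h
  | var => exact h
  | get => exact h.2
  | op => exact h.2.2

/-- Memory reads are covered by boundedness, and truncated subtraction, division and remainder never
exceed their first operand. Only literals, sums and products can overflow, and these are what `Ok`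
controls. -/
theorem Exp.Ok.fits {W : ℕ} {s : State} (hb : Bounded W s) {e : Exp} (h : e.Ok W s) :
    e.Fits W s := by
  induction e with
  | lit => exact h
  | var x => exact hb.1 x
  | get a i ih => exact ⟨ih h, hb.2 _ _⟩
  | op o e f ihe ihf =>
    cases o with
    | add => exact ⟨ihe h.1, ihf h.2.1, h.2.2⟩
    | mul => exact ⟨ihe h.1, ihf h.2.1, h.2.2⟩
    | sub => exact ⟨ihe h.1, ihf h.2, (Nat.sub_le _ _).trans_lt (ihe h.1).lt⟩
    | div => exact ⟨ihe h.1, ihf h.2, (Nat.div_le_self _ _).trans_lt (ihe h.1).lt⟩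
    | mod => exact ⟨ihe h.1, ihf h.2, (Nat.mod_le _ _).trans_lt (ihe h.1).lt⟩

theorem WExp.Ok.fits {W : ℕ} {s : State} (hb : Bounded W s) {u : WExp} (h : u.Ok W s) :
    u.Fits W s := by
  induction u with
  | zero => exact h
  | get a i => exact Exp.Ok.fits hb h
  | add u v ihu ihv => exact ⟨ihu h.1, ihv h.2⟩
  | sub u v ihu ihv => exact ⟨ihu h.1, ihv h.2⟩

theorem Cond.Ok.fits {W : ℕ} {s : State} (hb : Bounded W s) {c : Cond} (h : c.Ok W s) :
    c.Fits W s := by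
  induction c with
  | le => exact ⟨h.1.fits hb, h.2.fits hb⟩
  | eq => exact ⟨h.1.fits hb, h.2.fits hb⟩
  | wle => exact ⟨h.1.fits hb, h.2.fits hb⟩
  | not c ih => exact ih h
  | and c d ihc ihd => exact ⟨ihc h.1, ihd h.2⟩

/-- The integer variables that a program assigns to. -/
def Prog.vars : Prog → List ℕ
  | .setVar x _ => [x]
  | .seq p q => p.vars ++ q.vars
  | .cond _ p q => p.vars ++ q.vars
  | .loop _ p => p.vars
  | _ => []

/-- The integer arrays that a program assigns to. -/
def Prog.arrs : Prog → List ℕ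
  | .setArr a _ _ => [a]
  | .seq p q => p.arrs ++ q.arrs
  | .cond _ p q => p.arrs ++ q.arrs
  | .loop _ p => p.arrs
  | _ => []

/-- The arrays of rationals that a program assigns to. -/
def Prog.wts : Prog → List ℕ
  | .setWt a _ _ => [a]
  | .seq p q => p.wts ++ q.wts
  | .cond _ p q => p.wts ++ q.wts
  | .loop _ p => p.wts
  | _ => []

attribute [simp] Prog.vars Prog.arrs Prog.wts

/-- `s` and `s'` agree on everything that `p` does not assign to. -/
structure Frame (p : Prog) (s s' : State) : Prop where
  var : ∀ x, x ∉ p.vars → s'.var x = s.var x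
  arr : ∀ a, a ∉ p.arrs → s'.arr a = s.arr a
  wt : ∀ a, a ∉ p.wts → s'.wt a = s.wt a

theorem Frame.refl (p : Prog) (s : State) : Frame p s s :=
  ⟨fun _ _ => rfl, fun _ _ => rfl, fun _ _ => rfl⟩

theorem Frame.trans {p : Prog} {s₁ s₂ s₃ : State} (h : Frame p s₁ s₂) (h' : Frame p s₂ s₃) :
    Frame p s₁ s₃ :=
  ⟨fun x hx => (h'.var x hx).trans (h.var x hx), fun x hx => (h'.arr x hx).trans (h.arr x hx),
    fun x hx => (h'.wt x hx).trans (h.wt x hx)⟩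

theorem Frame.mono {p q : Prog} {s s' : State} (h : Frame p s s') (hv : p.vars ⊆ q.vars)
    (ha : p.arrs ⊆ q.arrs) (hw : p.wts ⊆ q.wts) : Frame q s s' :=
  ⟨fun x hx => h.var x fun hx' => hx (hv hx'), fun x hx => h.arr x fun hx' => hx (ha hx'),
    fun x hx => h.wt x fun hx' => hx (hw hx')⟩

/-- The assigned names are read off the program text, so noninterference of program parts can be
decided, and a specification only has to describe what changes. -/
theorem Exec.frame {W : ℕ} {p : Prog} {s s' : State} {t : ℕ} (h : Exec W p s s' t) :
    Frame p s s' := by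
  induction h with
  | skip s => exact .refl _ _
  | setVar s x e _ =>
    exact ⟨fun y hy => by simp_all, fun _ _ => rfl, fun _ _ => rfl⟩
  | setArr s a i e _ _ =>
    exact ⟨fun _ _ => rfl, fun y hy => by simp_all, fun _ _ => rfl⟩
  | setWt s a i u _ _ =>
    exact ⟨fun _ _ => rfl, fun _ _ => rfl, fun y hy => by simp_all⟩
  | seq p q s₁ s₂ s₃ t₁ t₂ _ _ h₁ h₂ =>
    exact (h₁.mono (by simp) (by simp) (by simp)).trans (h₂.mono (by simp) (by simp) (by simp))
  | cond_true c p q s s' t _ _ _ h => exact h.mono (by simp) (by simp) (by simp)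
  | cond_false c p q s s' t _ _ _ h => exact h.mono (by simp) (by simp) (by simp)
  | loop_true c p s₁ s₂ s₃ t₁ t₂ _ _ _ _ h₁ h₂ =>
    exact (h₁.mono (by simp) (by simp) (by simp)).trans h₂
  | loop_false c p s _ _ => exact .refl _ _

/-- Every stored integer is the value of an expression that fits, so boundedness has to be checked
for the initial memory only. -/
theorem Exec.bounded {W : ℕ} {p : Prog} {s s' : State} {t : ℕ} (h : Exec W p s s' t)
    (hb : Bounded W s) : Bounded W s' := by
  induction h with
  | skip s => exact hb
  | setVar s x e he =>
    refine ⟨fun y => ?_, hb.2⟩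
    rw [State.var_setVar]
    split_ifs
    exacts [he.lt, hb.1 y]
  | setArr s a i e hi he =>
    refine ⟨hb.1, fun a' j => ?_⟩
    rw [State.arr_setArr]
    split_ifs
    · rw [Function.update_apply]
      split_ifs
      exacts [he.lt, hb.2 _ _]
    · exact hb.2 _ _
  | setWt => exact hb
  | seq p q s₁ s₂ s₃ t₁ t₂ _ _ h₁ h₂ => exact h₂ (h₁ hb)
  | cond_true c p q s s' t _ _ _ h => exact h hb
  | cond_false c p q s s' t _ _ _ h => exact h hb
  | loop_true c p s₁ s₂ s₃ t₁ t₂ _ _ _ _ h₁ h₂ => exact h₂ (h₁ hb)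
  | loop_false c p s _ _ => exact hb

/-- Started in a bounded state `s`, the program `p` halts within `B` steps in a state with
property `Q`. -/
def Run (W : ℕ) (p : Prog) (s : State) (B : ℕ) (Q : State → Prop) : Prop :=
  Bounded W s → ∃ s' t, Exec W p s s' t ∧ t ≤ B ∧ Q s'

/-! ### Hoare-style rules with time bounds -/

variable {W B B' B₁ B₂ : ℕ} {p q : Prog} {s : State} {Q R : State → Prop}

theorem Run.mono (h : Run W p s B Q) (hB : B ≤ B') (hQ : ∀ s', Frame p s s' → Q s' → R s') :
    Run W p s B' R := fun hb =>
  let ⟨s', t, he, ht, hq⟩ := h hb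
  ⟨s', t, he, ht.trans hB, hQ s' he.frame hq⟩

theorem Run.le (h : Run W p s B Q) (hB : B ≤ B') : Run W p s B' Q :=
  h.mono hB fun _ _ h => h

theorem Run.skip (h : Q s) : Run W .skip s 1 Q := fun _ => ⟨s, 1, .skip s, le_rfl, h⟩

theorem Run.setVar {x : ℕ} {e : Exp} (he : e.Ok W s) (h : Q (s.setVar x (e.eval s))) :
    Run W (.setVar x e) s (e.cost + 1) Q := fun hb =>
  ⟨_, _, .setVar s x e (he.fits hb), le_rfl, h⟩

theorem Run.setArr {a : ℕ} {i e : Exp} (hi : i.Ok W s) (he : e.Ok W s)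
    (h : Q (s.setArr a (i.eval s) (e.eval s))) :
    Run W (.setArr a i e) s (i.cost + e.cost + 1) Q := fun hb =>
  ⟨_, _, .setArr s a i e (hi.fits hb) (he.fits hb), le_rfl, h⟩

theorem Run.setWt {a : ℕ} {i : Exp} {u : WExp} (hi : i.Ok W s) (hu : u.Ok W s)
    (h : Q (s.setWt a (i.eval s) (u.eval s))) :
    Run W (.setWt a i u) s (i.cost + u.cost + 1) Q := fun hb =>
  ⟨_, _, .setWt s a i u (hi.fits hb) (hu.fits hb), le_rfl, h⟩

theorem Run.seq (h₁ : Run W p s B₁ R) (h₂ : ∀ s', Frame p s s' → R s' → Run W q s' B₂ Q) :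
    Run W (.seq p q) s (B₁ + B₂) Q := fun hb => by
  obtain ⟨s₁, t₁, e₁, ht₁, hr⟩ := h₁ hb
  obtain ⟨s₂, t₂, e₂, ht₂, hq⟩ := h₂ s₁ e₁.frame hr (e₁.bounded hb)
  exact ⟨s₂, _, .seq _ _ _ _ _ _ _ e₁ e₂, by omega, hq⟩

/-- The rule for a sequence that begins with an assignment. -/
theorem Run.step (h : Run W p s B₁ fun s' => Run W q s' B₂ Q) :
    Run W (.seq p q) s (B₁ + B₂) Q := h.seq fun _ _ h => h

theorem Run.cond {c : Cond} (hc : c.Ok W s) (h₁ : c.Holds s → Run W p s B₁ Q)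
    (h₂ : ¬ c.Holds s → Run W q s B₂ Q) :
    Run W (.cond c p q) s (c.cost + 1 + max B₁ B₂) Q := fun hb => by
  by_cases h : c.Holds s
  · obtain ⟨s', t, e, ht, hq⟩ := h₁ h hb
    exact ⟨s', _, .cond_true _ _ _ _ _ _ (hc.fits hb) h e, by grind, hq⟩
  · obtain ⟨s', t, e, ht, hq⟩ := h₂ h hb
    exact ⟨s', _, .cond_false _ _ _ _ _ _ (hc.fits hb) h e, by grind, hq⟩

/-- The rule for loops: the potential `φ` pays for the iterations. -/
theorem Run.loop {c : Cond} (Inv : State → Prop) (φ : State → ℕ)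
    (hc : ∀ s', Frame p s s' → Inv s' → c.Ok W s')
    (hstep : ∀ s', Frame p s s' → Inv s' → c.Holds s' →
      ∃ B', Run W p s' B' fun s'' => Inv s'' ∧ φ s'' + (c.cost + 1 + B') ≤ φ s')
    (hφ : ∀ s', Frame p s s' → Inv s' → c.cost + 1 ≤ φ s')
    (h0 : Inv s) :
    Run W (.loop c p) s (φ s) fun s' => Inv s' ∧ ¬ c.Holds s' := by
  -- Induction on a bound for the potential, which strictly decreases since every iteration pays at
  -- least for its test.
  suffices H : ∀ f s', φ s' ≤ f → Frame p s s' → Inv s' →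
      Run W (.loop c p) s' (φ s') fun s' => Inv s' ∧ ¬ c.Holds s' from
    H _ s le_rfl (.refl _ _) h0
  intro f
  induction f with
  | zero =>
    intro s' hf hfr hi
    have := hφ s' hfr hi
    omega
  | succ f ih =>
    intro s' hf hfr hi hb
    by_cases h : c.Holds s'
    · obtain ⟨B', hr⟩ := hstep s' hfr hi h
      obtain ⟨s₁, t₁, e₁, ht₁, hi₁, hφ₁⟩ := hr hb
      obtain ⟨s₂, t₂, e₂, ht₂, hq⟩ :=
        ih s₁ (by omega) (hfr.trans e₁.frame) hi₁ (e₁.bounded hb)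
      exact ⟨s₂, _, .loop_true _ _ _ _ _ _ _ ((hc s' hfr hi).fits hb) h e₁ e₂, by omega, hq⟩
    · exact ⟨s', _, .loop_false _ _ _ ((hc s' hfr hi).fits hb) h, hφ s' hfr hi, hi, h⟩

/-- `for x = lo, …, hi - 1 do body`. -/
def Prog.for (x : ℕ) (lo hi : Exp) (body : Prog) : Prog :=
  .seq (.setVar x lo) (.loop (.not (.le hi (.var x))) (.seq body (.setVar x (.var x + .lit 1))))

@[simp] theorem Prog.vars_for (x : ℕ) (lo hi : Exp) (body : Prog) :
    (Prog.for x lo hi body).vars = x :: (body.vars ++ [x]) := rfl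
@[simp] theorem Prog.arrs_for (x : ℕ) (lo hi : Exp) (body : Prog) :
    (Prog.for x lo hi body).arrs = body.arrs := by simp [Prog.for]
@[simp] theorem Prog.wts_for (x : ℕ) (lo hi : Exp) (body : Prog) :
    (Prog.for x lo hi body).wts = body.wts := by simp [Prog.for]

/-- The rule for counting loops. -/
theorem Run.for {x : ℕ} {lo hi : Exp} {body : Prog} {L U : ℕ} {c : ℕ → ℕ}
    (Inv : ℕ → State → Prop) (hlo : lo.Ok W s) (hL : lo.eval s = L) (hLU : L ≤ U)
    (hx : x ∉ body.vars)
    (hhi : ∀ s', Frame (Prog.for x lo hi body) s s' → hi.Ok W s' ∧ hi.eval s' = U)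
    (hInv : ∀ i s' v, Inv i s' → Inv i (s'.setVar x v))
    (h0 : Inv L s)
    (hstep : ∀ i s', L ≤ i → i < U → s'.var x = i → Frame (Prog.for x lo hi body) s s' →
      Inv i s' → Run W body s' (c i) (Inv (i + 1))) :
    Run W (Prog.for x lo hi body) s
      (lo.cost + hi.cost + 5 + ∑ i ∈ Finset.Ico L U, (c i + (hi.cost + 8))) (Inv U) := by
  intro hb
  -- The upper limit is the value of an expression that fits, so incrementing the counter up to `U`
  -- cannot overflow.
  have hU : U < W := by
    obtain ⟨h1, h2⟩ := hhi s (.refl _ _)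
    exact h2 ▸ (h1.fits hb).lt
  revert hb
  change Run _ _ _ _ _
  have hfr0 : Frame (Prog.for x lo hi body) s (s.setVar x (lo.eval s)) :=
    ⟨fun y hy => by simp_all, fun _ _ => rfl, fun _ _ => rfl⟩
  -- The potential holds one final test, at cost `hi.cost + 4`, and for each remaining iteration the
  -- body, a test and the increment, which costs 4 more.
  have key : Run W (.loop (.not (.le hi (.var x))) (.seq body (.setVar x (.var x + .lit 1))))
      (s.setVar x (lo.eval s))
      (hi.cost + 4 + ∑ i ∈ Finset.Ico ((s.setVar x (lo.eval s)).var x) U, (c i + (hi.cost + 8)))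
      fun s' => (L ≤ s'.var x ∧ s'.var x ≤ U ∧ Inv (s'.var x) s') ∧
        ¬ (Cond.not (.le hi (.var x))).Holds s' := by
    refine Run.loop (fun s' => L ≤ s'.var x ∧ s'.var x ≤ U ∧ Inv (s'.var x) s')
      (fun s' => hi.cost + 4 + ∑ i ∈ Finset.Ico (s'.var x) U, (c i + (hi.cost + 8)))
      ?_ ?_ ?_ ?_
    · intro s' hfr _
      exact ⟨(hhi s' (hfr0.trans (hfr.mono (by simp) (by simp) (by simp)))).1, trivial⟩
    · rintro s' hfr ⟨h1, -, h2⟩ hc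
      have hfr' := hfr0.trans (hfr.mono (q := Prog.for x lo hi body) (by simp) (by simp) (by simp))
      have hlt : s'.var x < U := by simpa [(hhi s' hfr').2] using hc
      refine ⟨c (s'.var x) + ((Exp.var x + .lit 1).cost + 1),
        (hstep _ s' h1 hlt rfl hfr' h2).seq fun s₁ hf₁ hi₁ => ?_⟩
      have hx₁ : s₁.var x = s'.var x := hf₁.var x hx
      refine Run.setVar ?_ ⟨⟨?_, ?_, ?_⟩, ?_⟩
      · simp [hx₁]
        omega
      · simp [hx₁]; omega
      · simp [hx₁]; omega
      · simpa [hx₁] using hInv _ _ _ hi₁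
      · rw [Finset.sum_eq_sum_Ico_succ_bot hlt]
        simp [hx₁]
        omega
    · intro s' _ _
      simp
    · simpa [hL] using ⟨hLU, hInv _ _ _ h0⟩
  refine (Run.step (Run.setVar hlo key)).mono ?_ ?_
  · simp [hL]; omega
  · rintro s' hfr ⟨⟨-, h1, h2⟩, h3⟩
    simp only [Cond.Holds, not_not, Exp.eval_var, (hhi s' hfr).2] at h3
    rwa [le_antisymm h1 h3] at h2

/-- The entries of array `o` that satisfy `P` have become nonzero. -/
def Marks (o : ℕ) (P : ℕ → Prop) (s s' : State) : Prop :=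
  ∀ a, s'.arr o a ≠ 0 ↔ s.arr o a ≠ 0 ∨ P a

theorem Marks.congr {o : ℕ} {P P' : ℕ → Prop} {s s' : State} (h : Marks o P s s')
    (hP : ∀ a, P a ↔ P' a) : Marks o P' s s' := fun a => by rw [h a, hP a]

theorem Marks.trans {o : ℕ} {P P' : ℕ → Prop} {s s' s'' : State} (h : Marks o P s s')
    (h' : Marks o P' s' s'') : Marks o (fun a => P a ∨ P' a) s s'' := fun a => by
  rw [h' a, h a, or_assoc]

theorem Marks.refl {o : ℕ} {P : ℕ → Prop} {s : State} (hP : ∀ a, ¬ P a) : Marks o P s s :=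
  fun a => by simp [hP a]

theorem Marks.setArr (o i : ℕ) (s : State) : Marks o (· = i) s (s.setArr o i 1) := fun a => by
  simp only [State.arr_setArr, if_true, Function.update_apply]
  split_ifs with h <;> simp [h]

/-- A loop whose iterations mark entries of an array. -/
theorem Run.for_marks {x : ℕ} {lo hi : Exp} {body : Prog} {L U : ℕ} {c : ℕ → ℕ} {o : ℕ}
    {P : ℕ → ℕ → Prop} (hlo : lo.Ok W s) (hL : lo.eval s = L) (hLU : L ≤ U)
    (hx : x ∉ body.vars)
    (hhi : ∀ s', Frame (Prog.for x lo hi body) s s' → hi.Ok W s' ∧ hi.eval s' = U)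
    (hstep : ∀ i s', L ≤ i → i < U → s'.var x = i → Frame (Prog.for x lo hi body) s s' →
      Run W body s' (c i) (Marks o (P i) s')) :
    Run W (Prog.for x lo hi body) s
      (lo.cost + hi.cost + 5 + ∑ i ∈ Finset.Ico L U, (c i + (hi.cost + 8)))
      (Marks o (fun a => ∃ i, L ≤ i ∧ i < U ∧ P i a) s) := by
  refine Run.for
    (fun j s' => Marks o (fun a => ∃ i, L ≤ i ∧ i < j ∧ P i a) s s')
    hlo hL hLU hx hhi (fun _ _ _ h => h) (Marks.refl fun a => ?_) fun i s' h1 h2 h3 h4 h5 => ?_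
  · rintro ⟨i, h1, h2, _⟩
    omega
  · refine (hstep i s' h1 h2 h3 h4).mono le_rfl fun s'' _ h => (h5.trans h).congr fun a => ?_
    constructor
    · rintro (⟨i', h⟩ | h)
      · exact ⟨i', h.1, by omega, h.2.2⟩
      · exact ⟨i, h1, by omega, h⟩
    · rintro ⟨i', h6, h7, h8⟩
      obtain h9 | rfl : i' < i ∨ i' = i := by omega
      · exact .inl ⟨i', h6, h9, h8⟩
      · exact .inr h8

end RAM

/-! ## The incidence tables -/

namespace RAM

variable {W : ℕ} {s : State}

theorem mul_add_lt {i j R n : ℕ} (hi : i < R) (hj : j < n) : i * n + j < R * n := by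
  nlinarith

/-- A row-major address determines its row and column, so marks made for different rows do not
interfere. -/
theorem mul_add_inj {i j i' j' n : ℕ} (hj : j < n) (hj' : j' < n) :
    i * n + j = i' * n + j' ↔ i = i' ∧ j = j' := by
  refine ⟨fun h => ?_, by rintro ⟨rfl, rfl⟩; rfl⟩
  have hn : 0 < n := by omega
  have h1 : (i * n + j) / n = (i' * n + j') / n := by rw [h]
  rw [Nat.add_div_of_dvd_right (Dvd.intro_left _ rfl), Nat.add_div_of_dvd_right (Dvd.intro_left _ rfl),
    Nat.mul_div_cancel _ hn, Nat.mul_div_cancel _ hn, Nat.div_eq_of_lt hj, Nat.div_eq_of_lt hj'] at h1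
  have h2 : i = i' := by simpa using h1
  subst h2
  exact ⟨rfl, by omega⟩

/-- With starting positions `f`, the differences are list lengths. Scanning all lists costs their
total length plus a constant for each list, not the number of lists times the largest length. -/
theorem sum_telescope_le (f : ℕ → ℕ) (A B R : ℕ) (hf : ∀ i < R, f i ≤ f (i + 1)) :
    ∑ i ∈ Finset.Ico 0 R, (A * (f (i + 1) - f i) + B) ≤ A * f R + B * R := by
  induction R with
  | zero => simp
  | succ R ih =>
    rw [Finset.sum_Ico_succ_top (Nat.zero_le _)]
    have h1 := ih fun i hi => hf i (by omega)
    have h2 := hf R (by omega)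
    have h3 : A * f (R + 1) = A * (f (R + 1) - f R) + A * f R := by
      rw [← Nat.mul_add]; congr 1; omega
    rw [h3]
    linarith

/-- The entry `v` occurs in list number `i` of the sequence of lists stored in `sa` and `da`. -/
def Listed (s : State) (sa da i v : ℕ) : Prop :=
  ∃ p, s.arr sa i ≤ p ∧ p < s.arr sa (i + 1) ∧ s.arr da p = v

/-- `sa` and `da` store `R` lists of numbers below `n`. -/
def IsListStore (s : State) (sa da R n : ℕ) : Prop :=
  (∀ i < R, s.arr sa i ≤ s.arr sa (i + 1)) ∧ ∀ i < R, ∀ v, Listed s sa da i v → v < n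

/-- Mark the entries of list number `var 5` in row number `var y` of a table with `var 0` columns. -/
def markList (x y r sa da oa : ℕ) : Prog :=
  .for x (.get sa (.var r)) (.get sa (.var r + .lit 1))
    (.setArr oa (.var y * .var 0 + .get da (.var x)) (.lit 1))

theorem run_markList {x y r sa da oa R m n i j : ℕ} (hxy : x ≠ y) (hxr : x ≠ r) (hx0 : x ≠ 0)
    (hsa : sa ≠ oa) (hda : da ≠ oa) (hn : s.var 0 = n) (hi : s.var y = i) (him : i < m)
    (hj : s.var r = j) (hjR : j < R) (hl : IsListStore s sa da R n) (hW : m * n ≤ W)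
    (hRW : R < W) :
    Run W (markList x y r sa da oa) s (20 * (s.arr sa (j + 1) - s.arr sa j) + 20)
      (Marks oa (fun a => ∃ v, Listed s sa da j v ∧ a = i * n + v) s) := by
  refine (Run.for_marks (o := oa) (P := fun p a => a = i * n + s.arr da p) (by simp) (by simp; rfl)
    ?_ (by simp) (U := s.arr sa (j + 1)) (c := fun _ => 8) ?_ ?_).mono ?_ ?_
  · rw [hj]; exact hl.1 j hjR
  · intro s' hf
    have h1 : s'.var r = j := by rw [hf.var r (by simp [hxr.symm]), hj]
    have h2 : s'.arr sa = s.arr sa := hf.arr sa (by simp [hsa])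
    simp [h1, h2]
    omega
  · intro p s' h1 h2 h3 hf
    have h4 : s'.var y = i := by rw [hf.var y (by simp [hxy.symm]), hi]
    have h5 : s'.var 0 = n := by rw [hf.var 0 (by simp [hx0.symm]), hn]
    have h6 : s'.arr da = s.arr da := hf.arr da (by simp [hda])
    rw [hj] at h1
    have h7 : s.arr da p < n := hl.2 j hjR _ ⟨p, h1, h2, rfl⟩
    have h8 := mul_add_lt him h7
    refine Run.setArr (i := .var y * .var 0 + .get da (.var x)) (e := .lit 1) ?_ ?_ ?_
    · simp [h3, h4, h5, h6]; omega
    · simp; omega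
    · simpa [h3, h4, h5, h6] using Marks.setArr oa _ s'
  · simp [hj]; omega
  · refine fun s' _ h => h.congr fun a => ?_
    rw [hj]
    exact ⟨fun ⟨p, h1, h2, h3⟩ => ⟨_, ⟨p, h1, h2, rfl⟩, h3⟩,
      fun ⟨_, ⟨p, h1, h2, h4⟩, h3⟩ => ⟨p, h1, h2, h4 ▸ h3⟩⟩

/-- Turn `var r` lists into rows of a table with `var 0` columns. -/
def listTable (r sa da oa : ℕ) : Prog :=
  .for 5 (.lit 0) (.var r) (markList 6 5 5 sa da oa)

theorem run_listTable {r sa da oa R n : ℕ} (hr5 : r ≠ 5) (hr6 : r ≠ 6)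
    (hsa : sa ≠ oa) (hda : da ≠ oa) (hn : s.var 0 = n) (hR : s.var r = R)
    (hl : IsListStore s sa da R n) (h0 : ∀ a, s.arr oa a = 0) (hW : R * n ≤ W) (hRW : R < W) :
    Run W (listTable r sa da oa) s (20 * s.arr sa R + 29 * R + 7)
      fun s' => ∀ i < R, ∀ v < n, s'.arr oa (i * n + v) ≠ 0 ↔ Listed s sa da i v := by
  have hL : ∀ s', Frame (listTable r sa da oa) s s' →
      IsListStore s' sa da R n ∧ ∀ i v, Listed s' sa da i v ↔ Listed s sa da i v := by
    intro s' hf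
    have h2 : s'.arr sa = s.arr sa := hf.arr sa (by simp [listTable, markList, hsa])
    have h3 : s'.arr da = s.arr da := hf.arr da (by simp [listTable, markList, hda])
    have h4 : ∀ i v, Listed s' sa da i v ↔ Listed s sa da i v := by simp [Listed, h2, h3]
    exact ⟨by simpa only [IsListStore, h2, h4] using hl, h4⟩
  refine (Run.for_marks (P := fun i a => ∃ v, Listed s sa da i v ∧ a = i * n + v) (L := 0) (U := R)
    (o := oa) (c := fun i => 20 * (s.arr sa (i + 1) - s.arr sa i) + 20) (by simp; omega) (by simp)
    (Nat.zero_le _) (by simp [markList]) ?_ ?_).mono ?_ ?_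
  · intro s' hf
    simp [hf.var r (by simp [markList, *]), hR]
  · intro i s' _ h1 h2 hf
    refine (run_markList (m := R) (R := R) (n := n) (j := i) (by simp) (by simp) (by simp) hsa hda
      ?_ h2 h1 h2 h1 (hL s' hf).1 hW hRW).mono ?_ ?_
    · rw [hf.var 0 (by simp [markList]), hn]
    · simp [hf.arr sa (by simp [markList, hsa])]
    · exact fun s'' _ h => h.congr fun a => by simp only [(hL s' hf).2]
  · have := sum_telescope_le (s.arr sa) 20 29 R hl.1
    simp [add_assoc] at this ⊢
    omega
  · intro s' _ h i hi v hv
    rw [h]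
    simp only [h0]
    constructor
    · rintro (h | ⟨i', -, h1, v', h2, h3⟩)
      · exact absurd rfl h
      · obtain ⟨rfl, rfl⟩ := (mul_add_inj hv (hl.2 i' h1 v' h2)).1 h3
        exact h2
    · exact fun h => .inr ⟨i, Nat.zero_le _, hi, v, h, rfl⟩

/-- Close the vertex sets in the rows of table 11 under adding neighbours; the result is table
13. -/
def nbhdTable : Prog :=
  .for 5 (.lit 0) (.var 1) <| .for 6 (.lit 0) (.var 0) <|
    .cond (.eq (.get 11 (.var 5 * .var 0 + .var 6)) (.lit 0)) .skip
      (.seq (.setArr 13 (.var 5 * .var 0 + .var 6) (.lit 1)) (markList 7 5 6 0 1 13))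

/-- Each vertex of a row triggers a single scan of its adjacency list, so a row costs the total
length of all adjacency lists plus `O(n)`. -/
theorem run_nbhdTable {m n : ℕ} (hn : s.var 0 = n) (hm : s.var 1 = m)
    (hl : IsListStore s 0 1 n n) (h0 : ∀ a, s.arr 13 a = 0) (hW : m * n ≤ W) (hnW : n < W)
    (hmW : m < W) :
    Run W nbhdTable s (m * (20 * s.arr 0 n + 60 * n + 20) + 10)
      fun s' => ∀ i < m, ∀ v < n, s'.arr 13 (i * n + v) ≠ 0 ↔
        ∃ u < n, s.arr 11 (i * n + u) ≠ 0 ∧ (v = u ∨ Listed s 0 1 u v) := by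
  refine (Run.for_marks (o := 13) (P := fun i a => ∃ u, 0 ≤ u ∧ u < n ∧ s.arr 11 (i * n + u) ≠ 0 ∧
      ∃ v, (v = u ∨ Listed s 0 1 u v) ∧ a = i * n + v) (L := 0) (U := m)
    (c := fun i => 20 * s.arr 0 n + 60 * n + 7) (by simp; omega) (by simp)
    (Nat.zero_le _) (by simp [markList]) ?_ ?_).mono ?_ ?_
  · intro s' hf
    simp [hf.var 1 (by simp [markList]), hm]
  · intro i s₁ _ hi h5 hf
    have hn₁ : s₁.var 0 = n := by rw [hf.var 0 (by simp [markList]), hn]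
    have ha₁ : s₁.arr 0 = s.arr 0 := hf.arr 0 (by simp [markList])
    have hb₁ : s₁.arr 1 = s.arr 1 := hf.arr 1 (by simp [markList])
    have hc₁ : s₁.arr 11 = s.arr 11 := hf.arr 11 (by simp [markList])
    clear hf
    refine (Run.for_marks (P := fun u a => s.arr 11 (i * n + u) ≠ 0 ∧
        ∃ v, (v = u ∨ Listed s 0 1 u v) ∧ a = i * n + v) (L := 0) (U := n) (o := 13)
      (c := fun u => 20 * (s.arr 0 (u + 1) - s.arr 0 u) + 38) (by simp; omega) (by simp)
      (Nat.zero_le _) (by simp [markList]) ?_ ?_).le ?_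
    · intro s' hf
      simp [hf.var 0 (by simp [markList]), hn₁]
    · intro u s₂ _ hu h6 hf
      have hn₂ : s₂.var 0 = n := by rw [hf.var 0 (by simp [markList]), hn₁]
      have h5₂ : s₂.var 5 = i := by rw [hf.var 5 (by simp [markList]), h5]
      have ha₂ : s₂.arr 0 = s.arr 0 := (hf.arr 0 (by simp [markList])).trans ha₁
      have hb₂ : s₂.arr 1 = s.arr 1 := (hf.arr 1 (by simp [markList])).trans hb₁
      have hc₂ : s₂.arr 11 = s.arr 11 := (hf.arr 11 (by simp [markList])).trans hc₁
      have hiu := mul_add_lt hi hu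
      have hok : (Exp.var 5 * .var 0 + .var 6).Ok W s₂ := by
        simp [h5₂, hn₂, h6]; omega
      have hev : (Exp.var 5 * .var 0 + .var 6).eval s₂ = i * n + u := by simp [h5₂, hn₂, h6]
      refine (Run.cond (by simp at hok ⊢; omega) (fun hc => Run.skip (Marks.refl ?_)) fun hc =>
        Run.seq (B₂ := 20 * (s.arr 0 (u + 1) - s.arr 0 u) + 20)
          (Run.setArr hok (by simp; omega) rfl) fun s' hf hs' => ?_).le ?_
      · rw [Cond.Holds, Exp.eval_get, hev, hc₂] at hc
        exact fun a h => h.1 hc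
      · rw [Cond.Holds, Exp.eval_get, hev, hc₂] at hc
        rw [hev] at hs'
        subst hs'
        refine (run_markList (x := 7) (y := 5) (r := 6) (sa := 0) (da := 1) (oa := 13) (s := s₂.setArr 13 (i * n + u) 1)
          (m := m) (R := n) (n := n) (i := i) (j := u)
          (by simp) (by simp) (by simp) (by simp) (by simp) hn₂ h5₂ hi h6 hu ?_ hW hnW).mono ?_
          fun s' _ h => ((Marks.setArr _ _ _).trans h).congr fun a => ?_
        · simpa [IsListStore, Listed, ha₂, hb₂] using hl
        · simp [ha₂]
        · simp [Listed, ha₂, hb₂]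
          simp only [Exp.eval_lit] at hc
          simp [hc]
      · simp
        omega
    · have := sum_telescope_le (s.arr 0) 20 47 n hl.1
      simp [add_assoc] at this ⊢
      omega
  · simp
    ring_nf; omega
  · intro s' _ h i hi v hv
    rw [h]
    simp only [h0]
    constructor
    · rintro (h | ⟨i', -, h1, u, -, hu, h2, w, h3, h4⟩)
      · exact absurd rfl h
      · have hw : w < n := by
          rcases h3 with rfl | h3
          exacts [hu, hl.2 _ hu _ h3]
        obtain ⟨rfl, rfl⟩ := (mul_add_inj hv hw).1 h4
        exact ⟨u, hu, h2, h3⟩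
    · exact fun ⟨u, hu, h1, h2⟩ =>
        .inr ⟨i, Nat.zero_le _, hi, u, Nat.zero_le _, hu, h1, v, h2, rfl⟩

/-- Row `i` of table `ra` (with `var r` rows) against row `j` of table 11: entry `j + 1` of row `i`
of table `o`, which has `var 3` columns, tells whether the rows have a common mark. -/
def meetTable (r ra o : ℕ) : Prog :=
  .for 5 (.lit 0) (.var r) <| .for 6 (.lit 0) (.var 1) <| .for 7 (.lit 0) (.var 0) <|
    .cond (.and (.not (.eq (.get ra (.var 5 * .var 0 + .var 7)) (.lit 0)))
        (.not (.eq (.get 11 (.var 6 * .var 0 + .var 7)) (.lit 0))))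
      (.setArr o (.var 5 * .var 3 + (.var 6 + .lit 1)) (.lit 1)) .skip

/-- Used twice: with closed neighbourhoods in `ra` a common mark is a conflict, with bags in `ra` it
says that a subgraph meets a bag. Columns are shifted by one because the digit 0 is not an element.
The condition `i < R` is part of the equivalence, so that the row of the dummy node is known to be
empty. -/
theorem run_meetTable {r ra o R m n : ℕ} (hr : r < 5) (hra : ra ≠ o) (ho : o ≠ 11)
    (hR : s.var r = R) (hn : s.var 0 = n) (hm : s.var 1 = m) (hb : s.var 3 = m + 1)
    (h0 : ∀ a, s.arr o a = 0) (hW : R * n ≤ W) (hW' : m * n ≤ W) (hW'' : R * (m + 1) < W)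
    (h1W : 1 < W) :
    Run W (meetTable r ra o) s (R * (m * (60 * n + 20) + 20) + 10)
      fun s' => ∀ i d, d ≤ m → (s'.arr o (i * (m + 1) + d) ≠ 0 ↔
        i < R ∧ ∃ j < m, d = j + 1 ∧ ∃ v < n, s.arr ra (i * n + v) ≠ 0 ∧ s.arr 11 (j * n + v) ≠ 0) := by
  refine (Run.for_marks (o := o) (P := fun i a => ∃ j, 0 ≤ j ∧ j < m ∧ ∃ v, 0 ≤ v ∧ v < n ∧
      (s.arr ra (i * n + v) ≠ 0 ∧ s.arr 11 (j * n + v) ≠ 0) ∧ a = i * (m + 1) + (j + 1))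
      (L := 0) (U := R)
    (c := fun i => m * (60 * n + 20) + 10) (by simp; omega) (by simp)
    (Nat.zero_le _) (by simp) ?_ ?_).mono ?_ ?_
  · intro s' hf
    simp [hf.var r (by simp; omega), hR]
  · intro i s₁ _ hi h5 hf
    have hn₁ : s₁.var 0 = n := by rw [hf.var 0 (by simp), hn]
    have hm₁ : s₁.var 1 = m := by rw [hf.var 1 (by simp), hm]
    have hb₁ : s₁.var 3 = m + 1 := by rw [hf.var 3 (by simp), hb]
    have ha₁ : s₁.arr ra = s.arr ra := hf.arr _ (by simp [hra])
    have hc₁ : s₁.arr 11 = s.arr 11 := hf.arr 11 (by simp [ho.symm])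
    clear hf
    refine (Run.for_marks (o := o) (P := fun j a => ∃ v, 0 ≤ v ∧ v < n ∧
        (s.arr ra (i * n + v) ≠ 0 ∧ s.arr 11 (j * n + v) ≠ 0) ∧ a = i * (m + 1) + (j + 1))
        (L := 0) (U := m)
      (c := fun i => 60 * n + 10) (by simp; omega) (by simp)
      (Nat.zero_le _) (by simp) ?_ ?_).le ?_
    · intro s' hf
      simp [hf.var 1 (by simp), hm₁]
    · intro j s₂ _ hj h6 hf
      have hn₂ : s₂.var 0 = n := by rw [hf.var 0 (by simp), hn₁]
      have hb₂ : s₂.var 3 = m + 1 := by rw [hf.var 3 (by simp), hb₁]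
      have h5₂ : s₂.var 5 = i := by rw [hf.var 5 (by simp), h5]
      have ha₂ : s₂.arr ra = s.arr ra := (hf.arr _ (by simp [hra])).trans ha₁
      have hc₂ : s₂.arr 11 = s.arr 11 := (hf.arr 11 (by simp [ho.symm])).trans hc₁
      clear hf
      refine (Run.for_marks (o := o) (P := fun v a =>
          (s.arr ra (i * n + v) ≠ 0 ∧ s.arr 11 (j * n + v) ≠ 0) ∧ a = i * (m + 1) + (j + 1))
          (L := 0) (U := n)
        (c := fun i => 40) (by simp; omega) (by simp)
        (Nat.zero_le _) (by simp) ?_ ?_).le ?_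
      · intro s' hf
        simp [hf.var 0 (by simp), hn₂]
      · intro v s₃ _ hv h7 hf
        have hn₃ : s₃.var 0 = n := by rw [hf.var 0 (by simp), hn₂]
        have hb₃ : s₃.var 3 = m + 1 := by rw [hf.var 3 (by simp), hb₂]
        have h5₃ : s₃.var 5 = i := by rw [hf.var 5 (by simp), h5₂]
        have h6₃ : s₃.var 6 = j := by rw [hf.var 6 (by simp), h6]
        have ha₃ : s₃.arr ra = s.arr ra := (hf.arr _ (by simp [hra])).trans ha₂
        have hc₃ : s₃.arr 11 = s.arr 11 := (hf.arr 11 (by simp [ho.symm])).trans hc₂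
        clear hf
        have h8 := mul_add_lt hi hv
        have h9 := mul_add_lt hj hv
        have h10 := mul_add_lt hi (show j + 1 < m + 1 by omega)
        have hc : (Cond.and (.not (.eq (.get ra (.var 5 * .var 0 + .var 7)) (.lit 0)))
            (.not (.eq (.get 11 (.var 6 * .var 0 + .var 7)) (.lit 0)))).Holds s₃ ↔
            (s.arr ra (i * n + v) ≠ 0 ∧ s.arr 11 (j * n + v) ≠ 0) := by
          simp [h7, h6₃, h5₃, hn₃, ha₃, hc₃]
        refine (Run.cond ?_ (fun hc' => Run.setArr ?_ ?_ ?_) fun hc' => Run.skip ?_).le ?_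
        · simp [h7, h6₃, h5₃, hn₃]; omega
        · simp [hb₃, h6₃, h5₃]; omega
        · simpa using h1W
        · refine (Marks.setArr _ _ _).congr fun a => ?_
          rw [hc] at hc'
          simp [hb₃, h6₃, h5₃, hc']
        · refine Marks.refl fun a => ?_
          rw [hc] at hc'
          tauto
        · simp
      · simp; omega
    · simp
      ring_nf; omega
  · simp
    ring_nf; omega
  · intro s' _ h i d hd
    rw [h]
    simp only [h0]
    constructor
    · rintro (h | ⟨i', -, h1, j, -, hj, v, -, hv, h2, h3⟩)
      · exact absurd rfl h
      · obtain ⟨rfl, rfl⟩ := (mul_add_inj (by omega) (by omega)).1 h3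
        exact ⟨h1, j, hj, rfl, v, hv, h2⟩
    · exact fun ⟨hi, j, hj, hd, v, hv, h⟩ =>
        .inr ⟨i, Nat.zero_le _, hi, j, Nat.zero_le _, hj, v, Nat.zero_le _, hv, h, by rw [hd]⟩

end RAM

/-! ## Sets as numbers

A set of numbers in `[1, b)` is coded by the number whose base `b` digits are its elements, the
largest one being the least significant digit. -/

namespace RAM

/-- `x` codes a set no two elements of which conflict. -/
def IsCode (b : ℕ) (cf : ℕ → ℕ → Prop) (x : ℕ) : Prop :=
  (Nat.digits b x).Pairwise fun d e => e < d ∧ ¬ cf e d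

/-- The code of the set of those elements of the set coded by `x` that satisfy `A`. -/
def proj (b : ℕ) (A : ℕ → Bool) (x : ℕ) : ℕ := Nat.ofDigits b ((Nat.digits b x).filter A)

/-- The weight of the set coded by `x`. -/
def wsum (b : ℕ) (w : ℕ → ℚ) (x : ℕ) : ℚ := ((Nat.digits b x).map w).sum

variable {b : ℕ} {cf : ℕ → ℕ → Prop} {A A' : ℕ → Bool} {w : ℕ → ℚ} {x : ℕ}

/-- Every pair of digits except the two least significant ones survives the deletion of one of these
two. So validity follows from that of two shorter numbers and one direct test of the remaining pair.
-/
theorem isCode_iff (hb : 1 < b) : IsCode b cf x ↔ x / b = 0 ∨ IsCode b cf (x / b) ∧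
    IsCode b cf (b * (x / b / b) + x % b) ∧ x / b % b < x % b ∧ ¬ cf (x / b % b) (x % b) := by
  rcases Nat.eq_zero_or_pos x with rfl | hx
  · simp [IsCode]
  rcases Nat.eq_zero_or_pos (x / b) with hy | hy
  · simp [IsCode, Nat.digits_def' hb hx, hy]
  have h1 : Nat.digits b x = x % b :: x / b % b :: Nat.digits b (x / b / b) := by
    rw [Nat.digits_def' hb hx, Nat.digits_def' hb hy]
  -- Positivity matters when no further digits remain: a lone digit 0 has an empty digit list.
  have h2 : 0 < x % b → Nat.digits b (b * (x / b / b) + x % b) =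
      x % b :: Nat.digits b (x / b / b) := by
    intro h
    rw [Nat.digits_def' hb (by omega), Nat.mul_add_mod, Nat.mod_mod,
      Nat.mul_add_div (by omega), Nat.div_eq_of_lt (Nat.mod_lt x (by omega)), Nat.add_zero]
  simp only [hy.ne', false_or, IsCode, h1, Nat.digits_def' hb hy, List.pairwise_cons]
  constructor
  · rintro ⟨h3, h4⟩
    have h5 := h3 (x / b % b) (by simp)
    rw [h2 (by omega), List.pairwise_cons]
    exact ⟨h4, ⟨fun e he => h3 e (by simp [he]), h4.2⟩, h5⟩
  · rintro ⟨h3, h4, h5, h6⟩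
    rw [h2 (by omega), List.pairwise_cons] at h4
    refine ⟨fun e he => ?_, h3⟩
    rcases List.mem_cons.1 he with rfl | he
    exacts [⟨h5, h6⟩, h4.1 e he]

theorem IsCode.nodup (h : IsCode b cf x) : (Nat.digits b x).Nodup :=
  h.imp fun h => h.1.ne'

theorem isCode_zero : IsCode b cf 0 := by simp [IsCode]

theorem proj_zero : proj b A 0 = 0 := by simp [proj]

/-- The recursion that fills the projection table in constant time per entry. The hypothesis on `A
0` also covers `x = 0`, whose remainder 0 is not one of its digits. -/
theorem proj_eq_ite (hb : 1 < b) (hA : A 0 = false) : proj b A x =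
    if A (x % b) then b * proj b A (x / b) + x % b else proj b A (x / b) := by
  rcases Nat.eq_zero_or_pos x with rfl | hx
  · simp [proj_zero, hA]
  rw [proj, Nat.digits_def' hb hx, List.filter_cons]
  split_ifs
  · rw [Nat.ofDigits_cons, add_comm, proj]
  · rfl

/-- The filter discards zeros, so the filtered list has a nonzero leading digit and is the digit
list of its value. -/
theorem digits_proj (hb : 1 < b) (hA : A 0 = false) :
    Nat.digits b (proj b A x) = (Nat.digits b x).filter A := by
  refine Nat.digits_ofDigits b hb _ (fun d hd => Nat.digits_lt_base hb (List.mem_filter.1 hd).1) ?_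
  intro h h0
  have := (List.mem_filter.1 (List.getLast_mem h)).2
  rw [h0, hA] at this
  simp at this

theorem mem_digits_proj (hb : 1 < b) (hA : A 0 = false) {d : ℕ} :
    d ∈ Nat.digits b (proj b A x) ↔ d ∈ Nat.digits b x ∧ A d := by
  rw [digits_proj hb hA, List.mem_filter]

theorem proj_comm (hb : 1 < b) (hA : A 0 = false) (hA' : A' 0 = false) :
    proj b A (proj b A' x) = proj b A' (proj b A x) := by
  rw [proj, digits_proj hb hA', proj, digits_proj hb hA, List.filter_comm]

theorem proj_proj_self (hb : 1 < b) (hA : A 0 = false) : proj b A (proj b A x) = proj b A x := by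
  rw [proj, digits_proj hb hA, List.filter_filter]
  simp [proj]

theorem proj_eq_self_iff (hb : 1 < b) (hA : A 0 = false) :
    proj b A x = x ↔ ∀ d ∈ Nat.digits b x, A d := by
  rw [← List.filter_eq_self, ← digits_proj hb hA]
  exact ⟨fun h => by rw [h], fun h => by
    rw [← Nat.ofDigits_digits b (proj b A x), h, Nat.ofDigits_digits]⟩

/-- Deleting digits moves the remaining ones to lower places. Hence projections of numbers below `M`
stay below `M`. -/
theorem proj_le (hb : 1 < b) (hA : A 0 = false) : proj b A x ≤ x := by
  induction x using Nat.strong_induction_on with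
  | _ x ih =>
    rcases Nat.eq_zero_or_pos x with rfl | hx
    · rw [proj_zero]
    have h1 := ih (x / b) (Nat.div_lt_self hx hb)
    have h2 := Nat.div_add_mod x b
    rw [proj_eq_ite hb hA]
    split_ifs
    · nlinarith
    · exact h1.trans (Nat.div_le_self _ _)

theorem IsCode.proj (hb : 1 < b) (hA : A 0 = false) (h : IsCode b cf x) :
    IsCode b cf (proj b A x) := by
  rw [IsCode, digits_proj hb hA]
  exact h.filter A

theorem wsum_zero : wsum b w 0 = 0 := by simp [wsum]

theorem wsum_eq (hb : 1 < b) (hx : 0 < x) : wsum b w x = wsum b w (x / b) + w (x % b) := by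
  rw [wsum, Nat.digits_def' hb hx, List.map_cons, List.sum_cons, add_comm, wsum]

/-- The difference is the weight of the deleted elements. With `A` the trace condition of the
parent, this is what a node pays. -/
theorem wsum_sub_wsum_proj (hb : 1 < b) (hA : A 0 = false) :
    wsum b w x - wsum b w (proj b A x) = ((Nat.digits b x).map fun d => if A d then 0 else w d).sum := by
  rw [wsum, wsum, digits_proj hb hA]
  induction Nat.digits b x with
  | nil => simp
  | cons d l ih =>
    cases h : A d <;> simp [h, ← ih]
    ring

theorem wsum_proj_le (hb : 1 < b) (hA : A 0 = false) (hw : ∀ d, 0 ≤ w d) :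
    0 ≤ wsum b w x - wsum b w (proj b A x) := by
  rw [wsum_sub_wsum_proj hb hA]
  refine List.sum_nonneg ?_
  simp only [List.mem_map]
  rintro _ ⟨d, -, rfl⟩
  split_ifs
  exacts [le_rfl, hw d]

/-- Every set without conflicts has a code. -/
theorem exists_isCode (hb : 1 < b) (I : Finset ℕ) (hI : ∀ d ∈ I, 0 < d ∧ d < b)
    (hcf : ∀ e ∈ I, ∀ d ∈ I, e < d → ¬ cf e d) :
    ∃ x, IsCode b cf x ∧ ∀ d, d ∈ Nat.digits b x ↔ d ∈ I := by
  -- The leading digit of the descending list is an element of `I`, hence positive, so the list is a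
  -- genuine digit list.
  have h : Nat.digits b (Nat.ofDigits b (I.sort (· ≥ ·))) = I.sort (· ≥ ·) := by
    refine Nat.digits_ofDigits b hb _ (fun d hd => (hI d (by simpa using hd)).2) fun h => ?_
    exact (hI _ ((Finset.mem_sort _).1 (List.getLast_mem h))).1.ne'
  refine ⟨_, ?_, fun d => by rw [h]; simp⟩
  rw [IsCode, h]
  refine List.Pairwise.imp_of_mem ?_ I.sortedGT_sort.pairwise
  intro d e hd he hde
  exact ⟨hde, hcf e (by simpa using he) d (by simpa using hd) hde⟩

end RAM

/-! ## The tables of codes, weights and projections -/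

namespace RAM

variable {W : ℕ} {s : State}

/-- Table 16: which numbers below `var 4` are codes of sets without conflicts, as given by
table 14. -/
def codeTable : Prog :=
  .for 5 (.lit 0) (.var 4) <|
    .cond (.eq (.var 5 / .var 3) (.lit 0)) (.setArr 16 (.var 5) (.lit 1)) <|
    .cond (.and (.not (.eq (.get 16 (.var 5 / .var 3)) (.lit 0))) <|
        .and (.not (.eq (.get 16 (.var 3 * (.var 5 / .var 3 / .var 3) + .var 5 % .var 3)) (.lit 0)))
        <| .and (.not (.le (.var 5 % .var 3) (.var 5 / .var 3 % .var 3)))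
          (.eq (.get 14 ((.var 5 / .var 3 % .var 3 - .lit 1) * .var 3 + .var 5 % .var 3)) (.lit 0)))
      (.setArr 16 (.var 5) (.lit 1)) .skip

theorem run_codeTable {b M : ℕ} (hb1 : 1 < b) (hb : s.var 3 = b) (hM : s.var 4 = M)
    (h0 : ∀ a, s.arr 16 a = 0) (hbW : b * b ≤ W) (hMW : M < W) :
    Run W codeTable s (80 * M + 10) fun s' => ∀ x, s'.arr 16 x ≠ 0 ↔
      x < M ∧ IsCode b (fun e d => s.arr 14 ((e - 1) * b + d) ≠ 0) x := by
  set cf : ℕ → ℕ → Prop := fun e d => s.arr 14 ((e - 1) * b + d) ≠ 0 with hcf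
  refine (Run.for (fun i s' => ∀ x, s'.arr 16 x ≠ 0 ↔ x < i ∧ IsCode b cf x) (L := 0) (U := M)
    (c := fun _ => 70) (by simp; omega) (by simp) (Nat.zero_le _) (by simp) ?_
    (fun _ _ _ h => h) (by simp [h0]) ?_).le (by simp; omega)
  · intro s' hf
    simp [hf.var 4 (by simp), hM]
  · intro x s₁ _ hx h5 hf hinv
    have hb₁ : s₁.var 3 = b := by rw [hf.var 3 (by simp), hb]
    have h14 : s₁.arr 14 = s.arr 14 := hf.arr 14 (by simp)
    clear hf
    have hbpos : 0 < b := by omega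
    have hm1 : x % b < b := Nat.mod_lt _ hbpos
    have hm2 : x / b % b < b := Nat.mod_lt _ hbpos
    have h1 : b * (x / b) ≤ x := Nat.mul_div_le x b
    have h2 : b * (x / b / b) ≤ x / b := Nat.mul_div_le _ b
    have h3 := Nat.div_add_mod x b
    -- Every conjunct of a test is evaluated, so this address must fit even when the second digit is
    -- 0 and the subtraction truncates.
    have h4 : (x / b % b - 1) * b + x % b < b * b := mul_add_lt (by omega) hm1
    have hle : x / b ≤ b * (x / b) := Nat.le_mul_of_pos_left _ hbpos
    have hset : IsCode b cf x → Run W (.setArr 16 (.var 5) (.lit 1)) s₁ 3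
        fun s' => ∀ y, s'.arr 16 y ≠ 0 ↔ y < x + 1 ∧ IsCode b cf y := by
      refine fun hc => Run.setArr (by simp) (by simp; omega) fun y => ?_
      simp only [Exp.eval_lit, Exp.eval_var, h5]
      rw [Marks.setArr, hinv]
      constructor
      · rintro (h | rfl)
        exacts [⟨by omega, h.2⟩, ⟨by omega, hc⟩]
      · rintro ⟨h, h'⟩
        obtain h6 | h6 : y < x ∨ y = x := by omega
        exacts [.inl ⟨h6, h'⟩, .inr h6]
    refine (Run.cond (by simp; omega) (fun hc => hset ?_) fun hc => Run.cond ?_ (fun hc' => hset ?_)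
      fun hc' => Run.skip ?_).le (by simp)
    · rw [isCode_iff hb1]
      exact .inl (by simpa [h5, hb₁] using hc)
    · simp [h5, hb₁]
      omega
    all_goals
      simp only [Cond.Holds, Exp.eval_get, Exp.eval_lit, Exp.eval_div, Exp.eval_mod, Exp.eval_add,
        Exp.eval_mul, Exp.eval_sub, Exp.eval_var, h5, hb₁, h14] at hc hc'
      -- Deleting the second digit gives a smaller number, whose entry has already been computed.
      have h6 : b * (x / b / b) + x % b < x := by
        have : 0 < x / b := Nat.pos_of_ne_zero hc
        have : x / b < b * (x / b) := by nlinarith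
        omega
      rw [← ne_eq, ← ne_eq, hinv, hinv] at hc'
    · rw [isCode_iff hb1]
      refine .inr ⟨hc'.1.2, hc'.2.1.2, by simpa using hc'.2.2.1, by simpa [hcf] using hc'.2.2.2⟩
    · have : ¬ IsCode b cf x := by
        rw [isCode_iff hb1]
        rintro (h | h)
        · exact hc h
        · exact hc' ⟨⟨by omega, h.1⟩, ⟨h6, h.2.1⟩, by simpa using h.2.2.1,
            by simpa [hcf] using h.2.2.2⟩
      intro y
      rw [hinv]
      constructor
      · exact fun h => ⟨by omega, h.2⟩
      · rintro ⟨h, h'⟩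
        obtain h6 | rfl : y < x ∨ y = x := by omega
        exacts [⟨h6, h'⟩, absurd h' this]

/-- Weight table 1: the weights of the sets coded by the numbers below `var 4`. -/
def weightTable : Prog :=
  .for 5 (.lit 1) (.var 4) <|
    .setWt 1 (.var 5) (.add (.get 1 (.var 5 / .var 3)) (.get 0 (.var 5 % .var 3 - .lit 1)))

theorem run_weightTable {b M : ℕ} (hb1 : 1 < b) (hb : s.var 3 = b) (hM : s.var 4 = M)
    (hM1 : 1 ≤ M) (h0 : ∀ a, s.wt 1 a = 0) (h1W : 1 < W) :
    Run W weightTable s (30 * M + 10) fun s' => ∀ x < M, s'.wt 1 x =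
      wsum b (fun d => s.wt 0 (d - 1)) x := by
  refine (Run.for (fun i s' => ∀ x < i, s'.wt 1 x = wsum b (fun d => s.wt 0 (d - 1)) x)
    (L := 1) (U := M)
    (c := fun _ => 15) (by simpa using h1W) (by simp) hM1 (by simp) ?_
    (fun _ _ _ h => h) (by simp [h0, wsum_zero]) ?_).le (by simp; omega)
  · intro s' hf
    simp [hf.var 4 (by simp), hM]
  · intro x s₁ hx1 hx h5 hf hinv
    have hb₁ : s₁.var 3 = b := by rw [hf.var 3 (by simp), hb]
    have h14 : s₁.wt 0 = s.wt 0 := hf.wt 0 (by simp)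
    refine (Run.setWt (by simp) (by simpa using h1W) fun y hy => ?_).le (by simp)
    simp only [State.wt_setWt, if_true, Exp.eval_var, h5]
    obtain h6 | rfl : y < x ∨ y = x := by omega
    · rw [Function.update_of_ne h6.ne, hinv y h6]
    · rw [Function.update_self, wsum_eq hb1 hx1]
      simp only [WExp.eval, Exp.eval_div, Exp.eval_var, h5, hb₁, h14, Exp.eval_sub, Exp.eval_mod,
        Exp.eval_lit]
      rw [hinv _ (Nat.div_lt_self hx1 hb1)]

/-- Table 17: the projections of the numbers below `var 4` to the rows of table 15. -/
def projTable : Prog :=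
  .for 5 (.lit 0) (.var 2 + .lit 1) <| .for 6 (.lit 0) (.var 4) <|
    .cond (.eq (.get 15 (.var 5 * .var 3 + .var 6 % .var 3)) (.lit 0))
      (.setArr 17 (.var 5 * .var 4 + .var 6) (.get 17 (.var 5 * .var 4 + .var 6 / .var 3)))
      (.setArr 17 (.var 5 * .var 4 + .var 6)
        (.var 3 * .get 17 (.var 5 * .var 4 + .var 6 / .var 3) + .var 6 % .var 3))

theorem run_projTable {b M q : ℕ} (A : ℕ → ℕ → Bool) (hb1 : 1 < b) (hb : s.var 3 = b)
    (hM : s.var 4 = M) (hq : s.var 2 = q)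
    (h0 : ∀ a, s.arr 17 a = 0) (hA0 : ∀ t, A t 0 = false)
    (hA : ∀ t ≤ q, ∀ d < b, s.arr 15 (t * b + d) ≠ 0 ↔ A t d)
    (hbW : (q + 1) * b ≤ W) (hMW : (q + 1) * M < W) (hqW : q + 1 < W) (hM0 : 0 < M) :
    Run W projTable s ((q + 1) * (60 * M + 30) + 10) fun s' => ∀ t ≤ q, ∀ x < M,
      s'.arr 17 (t * M + x) = proj b (A t) x := by
  refine (Run.for (fun i s' => (∀ t < i, ∀ x < M, s'.arr 17 (t * M + x) = proj b (A t) x) ∧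
      ∀ a, i * M ≤ a → s'.arr 17 a = 0)
    (L := 0) (U := q + 1) (c := fun _ => 60 * M + 10) (by simp; omega) (by simp) (by simp)
    (by simp) ?_ (fun _ _ _ h => h) (by simp [h0]) ?_).mono (by simp; ring_nf; omega)
    fun s' _ h t ht => h.1 t (by omega)
  · intro s' hf
    simp [hf.var 2 (by simp), hq]
    omega
  · intro t s₁ _ ht h5 hf hinv
    have hb₁ : s₁.var 3 = b := by rw [hf.var 3 (by simp), hb]
    have hM₁ : s₁.var 4 = M := by rw [hf.var 4 (by simp), hM]
    have h15 : s₁.arr 15 = s.arr 15 := hf.arr 15 (by simp)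
    clear hf
    refine (Run.for (fun i s' => (∀ a < t * M, s'.arr 17 a = s₁.arr 17 a) ∧
        (∀ x < i, s'.arr 17 (t * M + x) = proj b (A t) x) ∧
        ∀ a, t * M + i ≤ a → s'.arr 17 a = 0)
      (L := 0) (U := M) (c := fun _ => 50) (by simp; omega) (by simp) (by simp)
      (by simp) ?_ (fun _ _ _ h => h) (by simpa using hinv.2) ?_).mono (by simp; omega) ?_
    · intro s' hf
      simp [hf.var 4 (by simp), hM₁]
    · intro x s₂ _ hx h6 hf hinv'
      have hb₂ : s₂.var 3 = b := by rw [hf.var 3 (by simp), hb₁]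
      have hM₂ : s₂.var 4 = M := by rw [hf.var 4 (by simp), hM₁]
      have h5₂ : s₂.var 5 = t := by rw [hf.var 5 (by simp), h5]
      have h15₂ : s₂.arr 15 = s.arr 15 := (hf.arr 15 (by simp)).trans h15
      clear hf
      have hm : x % b < b := Nat.mod_lt _ (by omega)
      have hd : x / b ≤ x := Nat.div_le_self _ _
      have h7 := mul_add_lt ht hm
      have h8 := mul_add_lt ht hx
      -- For `x = 0` the program reads the very entry that it is about to write. It is still 0, the
      -- projection of 0; this is why the invariant says that untouched entries vanish.
      have hold : s₂.arr 17 (t * M + x / b) = proj b (A t) (x / b) := by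
        rcases Nat.eq_zero_or_pos x with rfl | hx0
        · rw [Nat.zero_div, hinv'.2.2 _ le_rfl, proj_zero]
        · exact hinv'.2.1 _ (Nat.div_lt_self hx0 hb1)
      have hp := proj_le (x := x / b) hb1 (hA0 t)
      have hp' := Nat.mul_le_mul_left b hp
      have h9 := Nat.div_add_mod x b
      have hxq : x < (q + 1) * M := by nlinarith
      have hok1 : (Exp.var 5 * .var 4 + .var 6).Ok W s₂ := by
        simp [h5₂, hM₂, h6]; omega
      have hok2 : (Exp.get 17 (.var 5 * .var 4 + .var 6 / .var 3)).Ok W s₂ := by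
        simp [h5₂, hM₂, h6, hb₂]; omega
      have hok3 : (Exp.var 3 * .get 17 (.var 5 * .var 4 + .var 6 / .var 3) +
          .var 6 % .var 3).Ok W s₂ := by
        simp [h5₂, hM₂, h6, hb₂, hold]; omega
      have key : ∀ v, v = proj b (A t) x →
          (∀ a < t * M, (s₂.setArr 17 (t * M + x) v).arr 17 a = s₁.arr 17 a) ∧
          (∀ x' < x + 1, (s₂.setArr 17 (t * M + x) v).arr 17 (t * M + x') = proj b (A t) x') ∧
          ∀ a, t * M + (x + 1) ≤ a → (s₂.setArr 17 (t * M + x) v).arr 17 a = 0 := by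
        intro v hv
        simp only [State.arr_setArr, if_true]
        refine ⟨fun a ha => ?_, fun x' hx' => ?_, fun a ha => ?_⟩
        · rw [Function.update_of_ne (by omega), hinv'.1 a ha]
        · obtain h | rfl : x' < x ∨ x' = x := by omega
          · rw [Function.update_of_ne (by omega), hinv'.2.1 _ h]
          · rw [Function.update_self, hv]
        · rw [Function.update_of_ne (by omega), hinv'.2.2 a (by omega)]
      have hev1 : (Exp.var 5 * .var 4 + .var 6).eval s₂ = t * M + x := by simp [h5₂, hM₂, h6]
      refine (Run.cond ?_ (fun hc => Run.setArr hok1 hok2 ?_)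
        fun hc => Run.setArr hok1 hok3 ?_).le (by simp)
      · simp [h5₂, hb₂, h6]; omega
      · rw [hev1]
        apply key
        simp [h5₂, hM₂, h6, hb₂, h15₂] at hc ⊢
        rw [hold, proj_eq_ite (x := x) hb1 (hA0 t), if_neg]
        rw [← hA t (by omega) _ hm]
        simpa using hc
      · rw [hev1]
        apply key
        simp [h5₂, hM₂, h6, hb₂, h15₂] at hc ⊢
        rw [hold, proj_eq_ite (x := x) hb1 (hA0 t), if_pos]
        rw [← hA t (by omega) _ hm]
        simpa using hc
    · intro s' _ h
      refine ⟨fun t' ht' x hx => ?_, fun a ha => h.2.2 a (by linarith)⟩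
      obtain h1 | rfl : t' < t ∨ t' = t := by omega
      · rw [h.1 _ (mul_add_lt h1 hx), hinv.1 t' h1 x hx]
      · exact h.2.1 x hx

end RAM

/-! ## Breadth first search -/

namespace RAM

variable {W : ℕ} {s : State}

/-- `ord 1, …, ord q` are the nodes of a rooted tree, every node coming after its parent; the
parent of the root `0` is the dummy node `ord 0 = q`. Other nodes are `R`-related to their
parents. -/
structure IsTreeOrder (q : ℕ) (R : ℕ → ℕ → Prop) (ord par : ℕ → ℕ) : Prop where
  ord_zero : ord 0 = q
  ord_one : ord 1 = 0
  ord_lt : ∀ i, 1 ≤ i → i ≤ q → ord i < q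
  inj : ∀ i j, 1 ≤ i → i ≤ q → 1 ≤ j → j ≤ q → ord i = ord j → i = j
  surj : ∀ v < q, ∃ i, 1 ≤ i ∧ i ≤ q ∧ ord i = v
  par_zero : par 0 = q
  par_spec : ∀ i, 2 ≤ i → i ≤ q →
    ∃ i', 1 ≤ i' ∧ i' < i ∧ par (ord i) = ord i' ∧ R (ord i') (ord i)

/-- The state of a breadth first search. -/
structure IsSearch (q : ℕ) (R : ℕ → ℕ → Prop) (h tl : ℕ) (ord par vis : ℕ → ℕ) : Prop where
  head_pos : 1 ≤ h
  head_le : h ≤ tl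
  two_le : 2 ≤ tl
  ord_zero : ord 0 = q
  ord_one : ord 1 = 0
  ord_lt : ∀ i, 1 ≤ i → i < tl → ord i < q
  inj : ∀ i j, 1 ≤ i → i < tl → 1 ≤ j → j < tl → ord i = ord j → i = j
  vis_iff : ∀ v, vis v ≠ 0 ↔ ∃ i, 1 ≤ i ∧ i < tl ∧ ord i = v
  par_zero : par 0 = q
  par_spec : ∀ i, 2 ≤ i → i < tl →
    ∃ i', 1 ≤ i' ∧ i' < i ∧ i' < h ∧ par (ord i) = ord i' ∧ R (ord i') (ord i)

variable {q h tl : ℕ} {R : ℕ → ℕ → Prop} {ord par vis : ℕ → ℕ}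

/-- The enqueued nodes are distinct numbers below `q`. -/
theorem IsSearch.tail_le (hs : IsSearch q R h tl ord par vis) : tl ≤ q + 1 := by
  have := Finset.card_le_card_of_injOn (s := Finset.Ico 1 tl) (t := Finset.range q) ord
    (fun i hi => by
      simp only [Finset.coe_Ico, Set.mem_Ico] at hi
      simpa using hs.ord_lt i hi.1 hi.2)
    (fun i hi j hj hij => by
      simp only [Finset.coe_Ico, Set.mem_Ico] at hi hj
      exact hs.inj i j hi.1 hi.2 hj.1 hj.2 hij)
  simp only [Nat.card_Ico, Finset.card_range] at this
  omega

/-- Position 0 receives the dummy node; the queue itself starts at position 1, where zeroed memory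
already contains the root 0. -/
theorem IsSearch.init (hq : 1 ≤ q) (ho : ∀ a, ord a = 0) (hv : ∀ a, vis a = 0) :
    IsSearch q R 1 2 (Function.update ord 0 q) (Function.update par 0 q)
      (Function.update vis 0 1) := by
  have hi1 : ∀ i, 1 ≤ i → i < 2 → i = 1 := by omega
  have h1 : Function.update ord 0 q 1 = 0 := by rw [Function.update_of_ne one_ne_zero, ho]
  refine ⟨le_rfl, by omega, le_rfl, Function.update_self .., h1, fun i h2 h3 => ?_,
    fun i j h1 h2 h3 h4 _ => by omega, fun v => ?_, Function.update_self .., fun i h1 h2 => by omega⟩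
  · rw [hi1 i h2 h3, h1]
    omega
  · rw [Function.update_apply, hv]
    constructor
    · intro h
      exact ⟨1, le_rfl, by omega, by rw [h1]; by_contra h2; exact h (if_neg (Ne.symm h2))⟩
    · rintro ⟨i, h2, h3, h4⟩
      rw [hi1 i h2 h3, h1] at h4
      simp [← h4]

/-- The head is `h + 1` because the node `ord h` under inspection has already left the queue; it
becomes the parent of `v`. -/
theorem IsSearch.push (hs : IsSearch q R (h + 1) tl ord par vis) (hh : 1 ≤ h) {v : ℕ}
    (hv : v < q) (hvis : vis v = 0) (hR : R (ord h) v) :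
    IsSearch q R (h + 1) (tl + 1) (Function.update ord tl v) (Function.update par v (ord h))
      (Function.update vis v 1) := by
  have h1 := hs.head_le
  have h2 := hs.two_le
  have hne : ∀ i, 1 ≤ i → i < tl → ord i ≠ v := fun i h1 h2 h3 =>
    (hs.vis_iff v).2 ⟨i, h1, h2, h3⟩ hvis
  have hold : ∀ i, i < tl → Function.update ord tl v i = ord i := fun i hi =>
    Function.update_of_ne hi.ne _ _
  have hnew : Function.update ord tl v tl = v := Function.update_self ..
  refine ⟨hs.head_pos, by omega, by omega, ?_, ?_, ?_, ?_, ?_, ?_, ?_⟩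
  · rw [hold _ (by omega), hs.ord_zero]
  · rw [hold _ (by omega), hs.ord_one]
  · intro i hi1 hi2
    obtain h3 | rfl : i < tl ∨ i = tl := by omega
    · rw [hold _ h3]; exact hs.ord_lt i hi1 h3
    · rwa [hnew]
  · intro i j hi1 hi2 hj1 hj2
    obtain h3 | rfl : i < tl ∨ i = tl := by omega
    · obtain h4 | rfl : j < tl ∨ j = tl := by omega
      · rw [hold _ h3, hold _ h4]; exact hs.inj i j hi1 h3 hj1 h4
      · rw [hold _ h3, hnew]; exact fun h => absurd h (hne i hi1 h3)
    · obtain h4 | rfl : j < i ∨ j = i := by omega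
      · rw [hold _ h4, hnew]; exact fun h => absurd h.symm (hne j hj1 h4)
      · exact fun _ => rfl
  · intro w
    rw [Function.update_apply]
    constructor
    · intro h
      split_ifs at h with h5
      · exact ⟨tl, by omega, by omega, by rw [hnew, h5]⟩
      · obtain ⟨i, hi1, hi2, hi3⟩ := (hs.vis_iff w).1 h
        exact ⟨i, hi1, by omega, by rw [hold i hi2, hi3]⟩
    · rintro ⟨i, hi1, hi2, hi3⟩
      split_ifs with h5
      · simp
      · obtain h3 | rfl : i < tl ∨ i = tl := by omega
        · exact (hs.vis_iff w).2 ⟨i, hi1, h3, by rw [← hi3, hold i h3]⟩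
        · exact absurd (hi3.symm.trans hnew) h5
  -- The root has been visited, so it differs from `v` and keeps its dummy parent.
  · rw [Function.update_of_ne, hs.par_zero]
    rw [← hs.ord_one]
    exact hne 1 le_rfl (by omega)
  · intro i hi1 hi2
    obtain h3 | rfl : i < tl ∨ i = tl := by omega
    · obtain ⟨i', a1, a2, a3, a4, a5⟩ := hs.par_spec i hi1 h3
      refine ⟨i', a1, a2, a3, ?_, ?_⟩
      · rw [hold i h3, hold i' (by omega), Function.update_of_ne (hne i (by omega) h3), a4]
      · rwa [hold i h3, hold i' (by omega)]
    · refine ⟨h, hh, by omega, by omega, ?_, ?_⟩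
      · rw [hnew, hold h (by omega), Function.update_self]
      · rwa [hnew, hold h (by omega)]

/-- Once the queue is empty, the enqueued nodes contain the root and are closed under `R`, so they
are all the nodes. Counting then gives `tl = q + 1`. -/
theorem IsSearch.isTreeOrder (hs : IsSearch q R tl tl ord par vis)
    (hclosed : ∀ i, 1 ≤ i → i < tl → ∀ v, R (ord i) v → vis v ≠ 0)
    (hconn : ∀ Z : ℕ → Prop, Z 0 → (∀ u < q, Z u → ∀ v, R u v → Z v) → ∀ v < q, Z v) :
    IsTreeOrder q R ord par := by
  have hall : ∀ v < q, ∃ i, 1 ≤ i ∧ i < tl ∧ ord i = v := by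
    refine hconn _ ⟨1, le_rfl, hs.two_le, hs.ord_one⟩ ?_
    rintro u hu ⟨i, h1, h2, rfl⟩ v hv
    exact (hs.vis_iff v).1 (hclosed i h1 h2 v hv)
  have h1 : q ≤ tl - 1 := by
    have := Finset.card_le_card (s := Finset.range q) (t := (Finset.Ico 1 tl).image ord)
      fun v hv => by
        obtain ⟨i, h1, h2, h3⟩ := hall v (by simpa using hv)
        exact Finset.mem_image.2 ⟨i, by simp [h1, h2], h3⟩
    rw [Finset.card_range] at this
    exact this.trans (Finset.card_image_le.trans (by simp))
  have h2 := hs.tail_le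
  have h3 := hs.two_le
  obtain rfl : tl = q + 1 := by omega
  exact ⟨hs.ord_zero, hs.ord_one, fun i hi hi' => hs.ord_lt i hi (by omega),
    fun i j hi hi' hj hj' => hs.inj i j hi (by omega) hj (by omega),
    fun v hv => (hall v hv).imp fun i hi => ⟨hi.1, by omega, hi.2.2⟩, hs.par_zero,
    fun i hi hi' => (hs.par_spec i hi (by omega)).imp fun i' hi' =>
      ⟨hi'.1, hi'.2.1, hi'.2.2.2.1, hi'.2.2.2.2⟩⟩

/-- Array 18 is the queue with tail `var 6`, array 19 holds the parents and array 20 the visited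
flags; `var 7` is the node whose neighbours are scanned. -/
def bfsVisit : Prog :=
  .for 8 (.get 6 (.var 7)) (.get 6 (.var 7 + .lit 1)) <|
    .cond (.eq (.get 20 (.get 7 (.var 8))) (.lit 0))
      (.seq (.setArr 20 (.get 7 (.var 8)) (.lit 1)) <|
        .seq (.setArr 19 (.get 7 (.var 8)) (.var 7)) <|
        .seq (.setArr 18 (.var 6) (.get 7 (.var 8))) (.setVar 6 (.var 6 + .lit 1))) .skip

/-- Compute the order of the nodes of the tree (array 18) and the parents (array 19). -/
def bfs : Prog :=
  .seq (.setArr 18 (.lit 0) (.var 2)) <| .seq (.setArr 19 (.lit 0) (.var 2)) <|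
  .seq (.setArr 20 (.lit 0) (.lit 1)) <| .seq (.setVar 5 (.lit 1)) <| .seq (.setVar 6 (.lit 2)) <|
  .loop (.not (.le (.var 6) (.var 5))) <|
    .seq (.setVar 7 (.get 18 (.var 5))) <| .seq (.setVar 5 (.var 5 + .lit 1)) bfsVisit

theorem run_bfsVisit {u : ℕ} (hh : 1 ≤ h) (h7 : s.var 7 = u) (hu : s.arr 18 h = u) (huq : u < q)
    (hl : IsListStore s 6 7 q q) (hqW : q + 2 < W)
    (hs : IsSearch q (Listed s 6 7) (h + 1) (s.var 6) (s.arr 18) (s.arr 19) (s.arr 20)) :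
    Run W bfsVisit s (40 * (s.arr 6 (u + 1) - s.arr 6 u) + 20) fun s' =>
      IsSearch q (Listed s 6 7) (h + 1) (s'.var 6) (s'.arr 18) (s'.arr 19) (s'.arr 20) ∧
      (∀ i ≤ h, s'.arr 18 i = s.arr 18 i) ∧ (∀ v, s.arr 20 v ≠ 0 → s'.arr 20 v ≠ 0) ∧
      ∀ v, Listed s 6 7 u v → s'.arr 20 v ≠ 0 := by
  refine (Run.for (fun p s' =>
      IsSearch q (Listed s 6 7) (h + 1) (s'.var 6) (s'.arr 18) (s'.arr 19) (s'.arr 20) ∧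
      (∀ i ≤ h, s'.arr 18 i = s.arr 18 i) ∧ (∀ v, s.arr 20 v ≠ 0 → s'.arr 20 v ≠ 0) ∧
      ∀ p', s.arr 6 u ≤ p' → p' < p → s'.arr 20 (s.arr 7 p') ≠ 0)
      (L := s.arr 6 u) (U := s.arr 6 (u + 1)) (c := fun _ => 26)
      (by simp) (by simp [h7]) (hl.1 u huq) (by simp) ?_ ?_ ?_ ?_).mono ?_ ?_
  · intro s' hf
    have h1 : s'.var 7 = u := by rw [hf.var 7 (by simp), h7]
    simp [h1, hf.arr 6 (by simp)]
    omega
  · intro i s' v hi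
    simpa using hi
  · exact ⟨hs, fun _ _ => rfl, fun _ h => h, fun p' h1 h2 => by omega⟩
  · intro p s' hp1 hp2 h8 hf ⟨i1, i2, i3, i4⟩
    have h7' : s'.var 7 = u := by rw [hf.var 7 (by simp), h7]
    have hd' : s'.arr 7 = s.arr 7 := hf.arr 7 (by simp)
    clear hf
    have hL : Listed s 6 7 u (s.arr 7 p) := ⟨p, hp1, hp2, rfl⟩
    have hv := hl.2 u huq _ hL
    have htl := i1.tail_le
    have htl2 := i1.two_le
    have hhd := i1.head_le
    set v := s.arr 7 p with hv'
    refine (Run.cond (by simp; omega) (fun hc => Run.step (Run.setArr (by simp) (by simp; omega)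
      (Run.step (Run.setArr (by simp) (by simp) (Run.step (Run.setArr (by simp) (by simp)
      (Run.setVar (by simp; omega) ?_))))))) fun hc => Run.skip ?_).le (by simp)
    · simp only [Cond.Holds, Exp.eval_get, Exp.eval_var, h8, hd', Exp.eval_lit, ← hv'] at hc
      have := i1.push hh hv hc (by rw [i2 h le_rfl, hu]; exact hL)
      rw [i2 h le_rfl, hu] at this
      simp only [Exp.eval_get, Exp.eval_add, Exp.eval_var, h8, hd', Exp.eval_lit, ← hv', State.var_setVar,
        State.var_setArr, State.arr_setVar, State.arr_setArr, h7']
      refine ⟨by simpa [h8, ← hv'] using this, fun i hi => ?_, fun w hw => ?_, fun p' hp1' hp2' => ?_⟩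
      · simp only [Nat.reduceEqDiff, if_false, if_true]
        rw [Function.update_of_ne (by omega), i2 i hi]
      · have := i3 w hw
        simp only [Nat.reduceEqDiff, if_false, if_true, Function.update_apply]
        split_ifs <;> simp_all
      · obtain h9 | rfl : p' < p ∨ p' = p := by omega
        · have := i4 p' hp1' h9
          simp only [Nat.reduceEqDiff, if_false, if_true, Function.update_apply]
          split_ifs <;> simp_all
        · simp [← hv']
    · simp only [Cond.Holds, Exp.eval_get, Exp.eval_var, h8, hd', Exp.eval_lit, ← hv'] at hc
      refine ⟨i1, i2, i3, fun p' hp1' hp2' => ?_⟩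
      obtain h9 | rfl : p' < p ∨ p' = p := by omega
      · exact i4 p' hp1' h9
      · exact hc
  · simp
    omega
  · rintro s' - ⟨i1, i2, i3, i4⟩
    refine ⟨i1, i2, i3, ?_⟩
    rintro v ⟨p, h1, h2, rfl⟩
    exact i4 p h1 h2

theorem run_bfs (hq : s.var 2 = q) (hq1 : 1 ≤ q) (hl : IsListStore s 6 7 q q)
    (h18 : ∀ a, s.arr 18 a = 0) (h20 : ∀ a, s.arr 20 a = 0) (hqW : q + 2 < W)
    (hconn : ∀ Z : ℕ → Prop, Z 0 → (∀ u < q, Z u → ∀ v, Listed s 6 7 u v → Z v) → ∀ v < q, Z v) :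
    Run W bfs s (40 * s.arr 6 q + 40 * q + 40) fun s' =>
      IsTreeOrder q (Listed s 6 7) (s'.arr 18) (s'.arr 19) := by
  set R := Listed s 6 7 with hR
  let deg : ℕ → ℕ := fun u => s.arr 6 (u + 1) - s.arr 6 u
  -- The nodes not yet taken from the queue. Each of them carries a potential proportional to its
  -- degree plus one, so the whole search is linear in the adjacency lists.
  let rest : State → Finset ℕ := fun s' =>
    Finset.range q \ (Finset.Ico 1 (s'.var 5)).image (s'.arr 18)
  let Inv : State → Prop := fun s' =>
    IsSearch q R (s'.var 5) (s'.var 6) (s'.arr 18) (s'.arr 19) (s'.arr 20) ∧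
      ∀ i, 1 ≤ i → i < s'.var 5 → ∀ v, R (s'.arr 18 i) v → s'.arr 20 v ≠ 0
  have h1 : ∀ s', ∑ u ∈ rest s', (40 * deg u + 40) ≤ 40 * s.arr 6 q + 40 * q := by
    intro s'
    refine (Finset.sum_le_sum_of_subset (Finset.sdiff_subset)).trans ?_
    rw [Finset.range_eq_Ico]
    exact sum_telescope_le _ _ _ _ hl.1
  have hloop : ∀ s₁, s₁.arr 6 = s.arr 6 → s₁.arr 7 = s.arr 7 → Inv s₁ →
      Run W (.loop (.not (.le (.var 6) (.var 5))) <|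
        .seq (.setVar 7 (.get 18 (.var 5))) <| .seq (.setVar 5 (.var 5 + .lit 1)) bfsVisit) s₁
        (5 + (40 * s.arr 6 q + 40 * q))
        fun s' => Inv s' ∧ ¬ (Cond.not (.le (.var 6) (.var 5))).Holds s' := by
    intro s₁ h6 h7 hinv
    refine (Run.loop Inv (fun s' => 5 + ∑ u ∈ rest s', (40 * deg u + 40)) ?_ ?_ ?_ hinv).le
      (Nat.add_le_add_left (h1 s₁) 5)
    · intros; simp
    · intro s₂ hf ⟨i1, i2⟩ hc
      have h6₂ : s₂.arr 6 = s.arr 6 := (hf.arr 6 (by simp [bfsVisit])).trans h6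
      have h7₂ : s₂.arr 7 = s.arr 7 := (hf.arr 7 (by simp [bfsVisit])).trans h7
      clear hf
      have htl := i1.tail_le
      have hlt : s₂.var 5 < s₂.var 6 := by simpa using hc
      have hpos := i1.head_pos
      have hu := i1.ord_lt _ hpos hlt
      refine ⟨_, Run.step (Run.setVar (by simp) (Run.step (Run.setVar (by simp; omega)
        ((run_bfsVisit (h := s₂.var 5) (u := s₂.arr 18 (s₂.var 5)) (q := q) hpos (by simp) (by simp)
          hu ?_ hqW ?_).mono le_rfl ?_))))⟩
      · simpa [IsListStore, Listed, h6₂, h7₂] using hl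
      · have : Listed s₂ 6 7 = R := by
          funext u v
          simp [hR, Listed, h6₂, h7₂]
        change IsSearch q (Listed s₂ 6 7) _ _ _ _ _
        rw [this]
        simp only [State.arr_setVar, State.var_setVar]
        exact ⟨by omega, by simpa using hlt, i1.two_le, i1.ord_zero, i1.ord_one, i1.ord_lt, i1.inj, i1.vis_iff,
          i1.par_zero, fun i hi hi' => (i1.par_spec i hi hi').imp fun i' h =>
            ⟨h.1, h.2.1, by omega, h.2.2.2⟩⟩
      · rintro s₃ hf ⟨j1, j2, j3, j4⟩
        have h5₃ : s₃.var 5 = s₂.var 5 + 1 := by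
          rw [hf.var 5 (by simp [bfsVisit])]
          simp
        have : (Listed ((s₂.setVar 7 (Exp.eval s₂ (Exp.get 18 (Exp.var 5)))).setVar 5
            (Exp.eval (s₂.setVar 7 (Exp.eval s₂ (Exp.get 18 (Exp.var 5)))) (Exp.var 5 + Exp.lit 1)))
            6 7) = R := by
          funext u v
          simp [hR, Listed, h6₂, h7₂]
        rw [this] at j1 j4
        simp only [State.arr_setVar] at j2 j3
        refine ⟨⟨h5₃ ▸ j1, fun i hi hi' v hv => ?_⟩, ?_⟩
        · rw [h5₃] at hi'
          rw [j2 i (by omega)] at hv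
          obtain h | rfl : i < s₂.var 5 ∨ i = s₂.var 5 := by omega
          · exact j3 v (i2 i hi h v hv)
          · exact j4 v hv
        · have hrest : rest s₃ = (rest s₂).erase (s₂.arr 18 (s₂.var 5)) := by
            simp only [rest, h5₃]
            rw [← Finset.sdiff_insert, ← Finset.image_insert]
            congr 1
            have : Finset.Ico 1 (s₂.var 5 + 1) = insert (s₂.var 5) (Finset.Ico 1 (s₂.var 5)) := by
              ext i; simp; omega
            rw [this]
            refine Finset.image_congr fun i hi => j2 i ?_
            simp at hi
            omega
          have hmem : s₂.arr 18 (s₂.var 5) ∈ rest s₂ := by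
            simp only [rest, Finset.mem_sdiff, Finset.mem_range, Finset.mem_image, Finset.mem_Ico,
              not_exists, not_and, and_imp]
            exact ⟨hu, fun i hi hi' h => hi'.ne (i1.inj _ _ hi (by omega) hpos hlt h)⟩
          have hsum := Finset.sum_erase_add (rest s₂) (fun u => 40 * deg u + 40) hmem
          simp only [hrest, ← hsum]
          simp [deg, h6₂]
          omega
    · intro s' _ _
      simp
  refine (Run.step (Run.setArr (by simp; omega) (by simp) <| Run.step <|
    Run.setArr (by simp; omega) (by simp) <| Run.step <|
    Run.setArr (by simp; omega) (by simp; omega) <| Run.step <|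
    Run.setVar (by simp; omega) <| Run.step <|
    Run.setVar (by simp; omega) <| hloop _ (by simp) (by simp) ⟨?_, ?_⟩)).mono ?_ ?_
  · simpa [hq] using IsSearch.init hq1 h18 h20
  · simp only [State.var_setVar]
    intro i h1 h2
    simp at h2
    omega
  · simp
    omega
  · rintro s' - ⟨⟨h1, h2⟩, h3⟩
    have h4 : s'.var 6 ≤ s'.var 5 := by simpa using h3
    have h5 := h1.head_le
    rw [show s'.var 5 = s'.var 6 by omega] at h1 h2
    exact h1.isTreeOrder h2 hconn

end RAM

/-! ## Dynamic programming -/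

namespace RAM

variable {W : ℕ} {s : State}

/-- `best` and `arg` give maximum and maximizer of `f` on each class `{x | S x, κ x = key}`. -/
def IsMaxTable (M : ℕ) (S : ℕ → Prop) (κ : ℕ → ℕ) (f best : ℕ → ℚ) (arg : ℕ → ℕ) : Prop :=
  ∀ key < M, (best key = 0 ∧ ∀ x, S x → κ x ≠ key) ∨
    S (arg key) ∧ κ (arg key) = key ∧ f (arg key) = best key ∧
      ∀ x, S x → κ x = key → f x ≤ best key

theorem IsMaxTable.congr {M : ℕ} {S S' : ℕ → Prop} {κ : ℕ → ℕ} {f f' best best' : ℕ → ℚ}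
    {arg arg' : ℕ → ℕ} (h : IsMaxTable M S κ f best arg) (hS : ∀ x, S x ↔ S' x)
    (hf : ∀ x, S x → f x = f' x) (hb : ∀ x < M, best x = best' x) (ha : ∀ x < M, arg x = arg' x) :
    IsMaxTable M S' κ f' best' arg' := by
  intro key hk
  rw [← hb key hk, ← ha key hk]
  simp only [← hS]
  rcases h key hk with h | ⟨h1, h2, h3, h4⟩
  · exact .inl h
  · exact .inr ⟨h1, h2, by rw [← hf _ h1, h3], fun x hx hκ => by rw [← hf x hx]; exact h4 x hx hκ⟩

/-- A tie replaces the maximizer too. This makes a first element of value 0 enter a class whose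
entry is still the default 0. -/
theorem IsMaxTable.insert_le {M x : ℕ} {S S' : ℕ → Prop} {κ : ℕ → ℕ} {f best best' : ℕ → ℚ}
    {arg arg' : ℕ → ℕ} (h : IsMaxTable M S κ f best arg) (hS : ∀ y, S' y ↔ S y ∨ y = x)
    (hx : best (κ x) ≤ f x)
    (hb : ∀ key < M, best' key = if key = κ x then f x else best key)
    (ha : ∀ key < M, arg' key = if key = κ x then x else arg key) :
    IsMaxTable M S' κ f best' arg' := by
  intro key hk
  rw [hb key hk, ha key hk]
  split_ifs with hkey
  · subst hkey
    refine .inr ⟨by simp [hS], rfl, rfl, fun y hy hyx => ?_⟩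
    rcases (hS y).1 hy with hy | rfl
    · rcases h _ hk with h | h
      · exact absurd hyx (h.2 y hy)
      · exact (h.2.2.2 y hy hyx).trans hx
    · exact le_rfl
  · rcases h key hk with ⟨h1, h2⟩ | ⟨h1, h2, h3, h4⟩
    · refine .inl ⟨h1, fun y hy => ?_⟩
      rcases (hS y).1 hy with hy | rfl
      exacts [h2 y hy, Ne.symm hkey]
    · refine .inr ⟨(hS _).2 (.inl h1), h2, h3, fun y hy hyx => ?_⟩
      rcases (hS y).1 hy with hy | rfl
      exacts [h4 y hy hyx, absurd hyx.symm hkey]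

/-- An empty class has the default entry 0, and a nonnegative value cannot lie below it.
Nonnegativity thus replaces a sentinel for minus infinity. -/
theorem IsMaxTable.insert_lt {M x : ℕ} {S S' : ℕ → Prop} {κ : ℕ → ℕ} {f best : ℕ → ℚ}
    {arg : ℕ → ℕ} (h : IsMaxTable M S κ f best arg) (hS : ∀ y, S' y ↔ S y ∨ y = x)
    (hf : 0 ≤ f x) (hx : f x < best (κ x)) : IsMaxTable M S' κ f best arg := by
  intro key hk
  rcases h key hk with ⟨h1, h2⟩ | ⟨h1, h2, h3, h4⟩
  · refine .inl ⟨h1, fun y hy => ?_⟩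
    rcases (hS y).1 hy with hy | rfl
    · exact h2 y hy
    · rintro rfl
      linarith
  · refine .inr ⟨(hS _).2 (.inl h1), h2, h3, fun y hy hyx => ?_⟩
    rcases (hS y).1 hy with hy | rfl
    · exact h4 y hy hyx
    · rw [← hyx]
      exact hx.le

/-- The tables that the dynamic program uses: valid codes, projections and weights. -/
structure IsTables (s : State) (M q : ℕ) (V : ℕ → Prop) (pr : ℕ → ℕ → ℕ) (ws : ℕ → ℚ) : Prop where
  var_two : s.var 2 = q
  var_four : s.var 4 = M
  valid : ∀ x < M, s.arr 16 x ≠ 0 ↔ V x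
  proj : ∀ t ≤ q, ∀ x < M, s.arr 17 (t * M + x) = pr t x
  weight : ∀ x < M, s.wt 1 x = ws x
  proj_lt : ∀ t ≤ q, ∀ x < M, pr t x < M

variable {M q t p : ℕ} {V : ℕ → Prop} {pr : ℕ → ℕ → ℕ} {ws : ℕ → ℚ} {ord par : ℕ → ℕ}

theorem IsTables.congr {s' : State} (h : IsTables s M q V pr ws) (h2 : s'.var 2 = s.var 2)
    (h4 : s'.var 4 = s.var 4) (h16 : s'.arr 16 = s.arr 16) (h17 : s'.arr 17 = s.arr 17)
    (h1 : s'.wt 1 = s.wt 1) : IsTables s' M q V pr ws :=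
  ⟨h2.trans h.1, h4.trans h.2, by simpa only [h16] using h.3, by simpa only [h17] using h.4,
    by simpa only [h1] using h.5, h.6⟩

/-- The codes of the subsets of bag `t` without conflicts. -/
def Allowed (M : ℕ) (V : ℕ → Prop) (pr : ℕ → ℕ → ℕ) (t x : ℕ) : Prop :=
  x < M ∧ V x ∧ pr t x = x

/-- The message from the node `var 7` to its parent `var 8`. -/
def maxLoop : Prog :=
  .for 9 (.lit 0) (.var 4) <|
    .cond (.and (.not (.eq (.get 16 (.var 9)) (.lit 0)))
        (.eq (.get 17 (.var 7 * .var 4 + .var 9)) (.var 9)))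
      (.seq (.setVar 10 (.get 17 (.var 8 * .var 4 + .var 9))) <|
        .cond (.wle (.get 3 (.var 7 * .var 4 + .var 10))
            (.add (.sub (.get 1 (.var 9)) (.get 1 (.var 10))) (.get 2 (.var 7 * .var 4 + .var 9))))
          (.seq (.setWt 3 (.var 7 * .var 4 + .var 10)
            (.add (.sub (.get 1 (.var 9)) (.get 1 (.var 10))) (.get 2 (.var 7 * .var 4 + .var 9))))
            (.setArr 21 (.var 7 * .var 4 + .var 10) (.var 9))) .skip) .skip

/-- The weight of the projection to `p` is subtracted because subgraphs that also meet the parent's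
bag are paid for at the parent or above it. -/
theorem run_maxLoop (hT : IsTables s M q V pr ws) (h7 : s.var 7 = t) (h8 : s.var 8 = p)
    (ht : t ≤ q) (hp : p ≤ q) (hW : (q + 1) * M < W)
    (hv : ∀ x < M, 0 ≤ ws x - ws (pr p x)) (h2 : ∀ a, 0 ≤ s.wt 2 a) (h3 : ∀ a, 0 ≤ s.wt 3 a)
    (h0 : ∀ x < M, s.wt 3 (t * M + x) = 0) :
    Run W maxLoop s (100 * M + 10) fun s' =>
      IsMaxTable M (Allowed M V pr t) (pr p) (fun x => ws x - ws (pr p x) + s.wt 2 (t * M + x))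
        (fun x => s'.wt 3 (t * M + x)) (fun x => s'.arr 21 (t * M + x)) ∧
      (∀ a, 0 ≤ s'.wt 3 a) ∧
      ∀ t' ≠ t, ∀ x < M, s'.wt 3 (t' * M + x) = s.wt 3 (t' * M + x) ∧
        s'.arr 21 (t' * M + x) = s.arr 21 (t' * M + x) := by
  have hMW : M < W := by nlinarith
  refine (Run.for (fun i s' =>
      IsMaxTable M (fun x => x < i ∧ Allowed M V pr t x) (pr p)
        (fun x => ws x - ws (pr p x) + s.wt 2 (t * M + x))
        (fun x => s'.wt 3 (t * M + x)) (fun x => s'.arr 21 (t * M + x)) ∧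
      (∀ a, 0 ≤ s'.wt 3 a) ∧
      ∀ t' ≠ t, ∀ x < M, s'.wt 3 (t' * M + x) = s.wt 3 (t' * M + x) ∧
        s'.arr 21 (t' * M + x) = s.arr 21 (t' * M + x))
      (L := 0) (U := M) (c := fun _ => 90) (by simp; omega) (by simp) (Nat.zero_le _)
      (by simp) ?_ (fun _ _ _ h => h) ?_ ?_).mono (by simp; omega) ?_
  · intro s' hf
    simp [hf.var 4 (by simp), hT.var_four]
  · exact ⟨fun key hk => .inl ⟨h0 key hk, by simp⟩, h3, fun _ _ _ _ => ⟨rfl, rfl⟩⟩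
  · intro x s₁ _ hx h9 hf ⟨i1, i2, i3⟩
    have hT₁ : IsTables s₁ M q V pr ws := hT.congr (hf.var 2 (by simp)) (hf.var 4 (by simp))
      (hf.arr 16 (by simp)) (hf.arr 17 (by simp)) (hf.wt 1 (by simp))
    have h7₁ : s₁.var 7 = t := by rw [hf.var 7 (by simp), h7]
    have h8₁ : s₁.var 8 = p := by rw [hf.var 8 (by simp), h8]
    have h2₁ : s₁.wt 2 = s.wt 2 := hf.wt 2 (by simp)
    clear hf
    have hM := hT₁.var_four
    have a1 := mul_add_lt (Nat.lt_succ_of_le ht) hx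
    have a2 := mul_add_lt (Nat.lt_succ_of_le hp) hx
    have hkey := hT.proj_lt p hp x hx
    have a3 := mul_add_lt (Nat.lt_succ_of_le ht) hkey
    simp only [Nat.succ_eq_add_one] at a1 a2 a3
    set f : ℕ → ℚ := fun x => ws x - ws (pr p x) + s.wt 2 (t * M + x) with hf
    have hfx : 0 ≤ f x := add_nonneg (hv x hx) (h2 _)
    refine (Run.cond (by simp [h7₁, hM, h9]; omega) (fun hc => Run.step (Run.setVar
      (by simp [h8₁, hM, h9]; omega) (Run.cond ?_ (fun hc' => Run.step (Run.setWt ?_ ?_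
      (Run.setArr ?_ ?_ ?_))) fun hc' => Run.skip ?_))) fun hc => Run.skip ?_).le (by simp)
    any_goals
      (simp [h7₁, h8₁, hM, h9, hT₁.proj p hp x hx] <;> omega)
    · have hcur : Allowed M V pr t x := by
        simp only [Cond.Holds, Exp.eval_get, Exp.eval_var, Exp.eval_lit, Exp.eval_add,
          Exp.eval_mul, h7₁, hM, h9, hT₁.proj t ht x hx] at hc
        exact ⟨hx, (hT₁.valid x hx).1 hc.1, hc.2⟩
      simp [h7₁, h8₁, hM, h9, hT₁.proj p hp x hx, hT₁.weight x hx, hT₁.weight _ hkey, h2₁] at hc' ⊢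
      refine ⟨i1.insert_le (x := x) (fun y => ?_) hc' (fun key hk => ?_) (fun key hk => ?_),
        fun a => ?_, fun t' ht' y hy => ?_⟩
      · constructor
        · rintro ⟨h1, h2⟩
          obtain h | rfl : y < x ∨ y = x := by omega
          exacts [.inl ⟨h, h2⟩, .inr rfl]
        · rintro (⟨h1, h2⟩ | rfl)
          exacts [⟨by omega, h2⟩, ⟨by omega, hcur⟩]
      · simp [Function.update_apply, hf]
      · simp [Function.update_apply]
      · rw [Function.update_apply]
        split_ifs
        exacts [hfx, i2 a]
      · rw [Function.update_of_ne, Function.update_of_ne]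
        · exact i3 t' ht' y hy
        all_goals exact fun h => ht' ((mul_add_inj hy hkey).1 h).1
    · have hcur : Allowed M V pr t x := by
        simp only [Cond.Holds, Exp.eval_get, Exp.eval_var, Exp.eval_lit, Exp.eval_add,
          Exp.eval_mul, h7₁, hM, h9, hT₁.proj t ht x hx] at hc
        exact ⟨hx, (hT₁.valid x hx).1 hc.1, hc.2⟩
      simp [h7₁, h8₁, hM, h9, hT₁.proj p hp x hx, hT₁.weight x hx, hT₁.weight _ hkey, h2₁] at hc' ⊢
      refine ⟨i1.insert_lt (x := x) (fun y => ?_) hfx hc', i2, i3⟩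
      constructor
      · rintro ⟨h1, h2⟩
        obtain h | rfl : y < x ∨ y = x := by omega
        exacts [.inl ⟨h, h2⟩, .inr rfl]
      · rintro (⟨h1, h2⟩ | rfl)
        exacts [⟨by omega, h2⟩, ⟨by omega, hcur⟩]
    · have hcur : ¬ Allowed M V pr t x := by
        simp only [Cond.Holds, Exp.eval_get, Exp.eval_var, Exp.eval_lit, Exp.eval_add,
          Exp.eval_mul, h7₁, hM, h9, hT₁.proj t ht x hx] at hc
        rintro ⟨-, h1, h2⟩
        exact hc ⟨(hT₁.valid x hx).2 h1, h2⟩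
      refine ⟨i1.congr (fun y => ?_) (fun _ _ => rfl) (fun _ _ => rfl) (fun _ _ => rfl), i2, i3⟩
      constructor
      · exact fun h => ⟨by omega, h.2⟩
      · rintro ⟨h1, h2⟩
        obtain h | rfl : y < x ∨ y = x := by omega
        exacts [⟨h, h2⟩, absurd h2 hcur]
  · rintro s' - ⟨i1, i2, i3⟩
    exact ⟨i1.congr (fun x => ⟨fun h => h.2, fun h => ⟨h.1, h⟩⟩) (fun _ _ => rfl) (fun _ _ => rfl)
      (fun _ _ => rfl), i2, i3⟩

/-- Add the message from the node `var 7` to the table of its parent `var 8`. -/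
def addLoop : Prog :=
  .for 9 (.lit 0) (.var 4) <|
    .setWt 2 (.var 8 * .var 4 + .var 9) (.add (.get 2 (.var 8 * .var 4 + .var 9))
      (.get 3 (.var 7 * .var 4 + .get 17 (.var 7 * .var 4 + .var 9))))

/-- A state `x` of the parent restricts the child only through the projection `pr t x`, which is the
key in the child's table. No search over pairs of states is needed. -/
theorem run_addLoop (hT : IsTables s M q V pr ws) (h7 : s.var 7 = t) (h8 : s.var 8 = p)
    (ht : t ≤ q) (hp : p ≤ q) (hW : (q + 1) * M < W)
    (h2 : ∀ a, 0 ≤ s.wt 2 a) (h3 : ∀ a, 0 ≤ s.wt 3 a) :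
    Run W addLoop s (50 * M + 10) fun s' =>
      (∀ a, 0 ≤ s'.wt 2 a) ∧ ∀ t', ∀ x < M, s'.wt 2 (t' * M + x) =
        s.wt 2 (t' * M + x) + if t' = p then s.wt 3 (t * M + pr t x) else 0 := by
  have hMW : M < W := by nlinarith
  refine (Run.for (fun i s' => (∀ a, 0 ≤ s'.wt 2 a) ∧ ∀ t', ∀ x < M, s'.wt 2 (t' * M + x) =
        s.wt 2 (t' * M + x) + if t' = p ∧ x < i then s.wt 3 (t * M + pr t x) else 0)
      (L := 0) (U := M) (c := fun _ => 40) (by simp; omega) (by simp) (Nat.zero_le _)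
      (by simp) ?_ (fun _ _ _ h => h) (by simpa using h2) ?_).mono (by simp; omega) ?_
  · intro s' hf
    simp [hf.var 4 (by simp), hT.var_four]
  · intro x s₁ _ hx h9 hf ⟨i1, i2⟩
    have hT₁ : IsTables s₁ M q V pr ws := hT.congr (hf.var 2 (by simp)) (hf.var 4 (by simp))
      (hf.arr 16 (by simp)) (hf.arr 17 (by simp)) (hf.wt 1 (by simp))
    have h7₁ : s₁.var 7 = t := by rw [hf.var 7 (by simp), h7]
    have h8₁ : s₁.var 8 = p := by rw [hf.var 8 (by simp), h8]
    have h3₁ : s₁.wt 3 = s.wt 3 := hf.wt 3 (by simp)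
    clear hf
    have hM := hT₁.var_four
    have a1 := mul_add_lt (Nat.lt_succ_of_le ht) hx
    have a2 := mul_add_lt (Nat.lt_succ_of_le hp) hx
    have hkey := hT.proj_lt t ht x hx
    have a3 := mul_add_lt (Nat.lt_succ_of_le ht) hkey
    simp only [Nat.succ_eq_add_one] at a1 a2 a3
    refine (Run.setWt ?_ ?_ ?_).le (by simp)
    any_goals
      (simp [h7₁, h8₁, hM, h9, hT₁.proj t ht x hx]; omega)
    simp [h7₁, h8₁, hM, h9, hT₁.proj t ht x hx, h3₁]
    constructor
    · intro a
      rw [Function.update_apply]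
      split_ifs
      exacts [add_nonneg (i1 _) (h3 _), i1 a]
    · intro t' y hy
      simp only [Function.update_apply, mul_add_inj hy hx, i2 t' y hy, i2 p x hx]
      by_cases h : t' = p
      · subst h
        rcases lt_trichotomy y x with h | rfl | h
        · simp [h.ne, h, h.le]
        · simp
        · simp [h.ne', h.not_gt, h.not_ge]
      · simp [h]
  · rintro s' - ⟨i1, i2⟩
    refine ⟨i1, fun t' x hx => ?_⟩
    simp [i2 t' x hx, hx]

/-- Process all nodes of the tree, every node before its parent. -/
def dp : Prog :=
  .for 5 (.lit 0) (.var 2) <| .seq (.setVar 7 (.get 18 (.var 2 - .var 5))) <|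
    .seq (.setVar 8 (.get 19 (.var 7))) <| .seq maxLoop addLoop

/-- Position 0 stands for the dummy node, so the root also has a parent that precedes it and needs
no separate treatment. -/
theorem IsTreeOrder.par_eq {R : ℕ → ℕ → Prop} (hO : IsTreeOrder q R ord par) {l : ℕ} (h1 : 1 ≤ l)
    (h2 : l ≤ q) : ∃ l' < l, par (ord l) = ord l' := by
  obtain rfl | h : l = 1 ∨ 2 ≤ l := by omega
  · exact ⟨0, one_pos, by rw [hO.ord_one, hO.par_zero, hO.ord_zero]⟩
  · obtain ⟨l', -, h3, h4, -⟩ := hO.par_spec l h h2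
    exact ⟨l', h3, h4⟩

theorem IsTreeOrder.inj' {R : ℕ → ℕ → Prop} (hO : IsTreeOrder q R ord par) {l l' : ℕ}
    (h : l ≤ q) (h' : l' ≤ q) (h1 : ord l = ord l') : l = l' := by
  rcases Nat.eq_zero_or_pos l with rfl | hl <;> rcases Nat.eq_zero_or_pos l' with rfl | hl'
  · rfl
  · exact absurd (h1 ▸ hO.ord_lt l' hl' h') (by simp [hO.ord_zero])
  · exact absurd (h1 ▸ hO.ord_lt l hl h) (by simp [hO.ord_zero])
  · exact hO.inj l l' hl h hl' h' h1

theorem IsTreeOrder.ord_le {R : ℕ → ℕ → Prop} (hO : IsTreeOrder q R ord par) {l : ℕ}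
    (h : l ≤ q) : ord l ≤ q := by
  rcases Nat.eq_zero_or_pos l with rfl | hl
  · exact hO.ord_zero.le
  · exact (hO.ord_lt l hl h).le

/-- The result of the dynamic program for the nodes `ord l`, `i < l ≤ q`. -/
structure IsDP (i M q : ℕ) (V : ℕ → Prop) (pr : ℕ → ℕ → ℕ) (ws : ℕ → ℚ) (ord par : ℕ → ℕ)
    (D best : ℕ → ℕ → ℚ) (arg : ℕ → ℕ → ℕ) : Prop where
  max : ∀ l, i < l → l ≤ q → IsMaxTable M (Allowed M V pr (ord l)) (pr (par (ord l)))
    (fun x => ws x - ws (pr (par (ord l)) x) + D (ord l) x) (best (ord l)) (arg (ord l))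
  sum : ∀ t, ∀ x < M, D t x =
    ∑ l ∈ Finset.Ioc i q, if par (ord l) = t then best (ord l) (pr (ord l) x) else 0

/-- The message of `ord (i + 1)` goes to an earlier node. Hence the incoming sums of this node and
of all nodes processed before it are final. -/
theorem IsDP.step {R : ℕ → ℕ → Prop} (hO : IsTreeOrder q R ord par) {i : ℕ}
    {D best D' best' : ℕ → ℕ → ℚ} {arg arg' : ℕ → ℕ → ℕ}
    (h : IsDP (i + 1) M q V pr ws ord par D best arg) (hi : i < q)
    (hpr : ∀ t ≤ q, ∀ x < M, pr t x < M)
    (hmax : IsMaxTable M (Allowed M V pr (ord (i + 1))) (pr (par (ord (i + 1))))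
      (fun x => ws x - ws (pr (par (ord (i + 1))) x) + D (ord (i + 1)) x) (best' (ord (i + 1)))
      (arg' (ord (i + 1))))
    (hold : ∀ t ≠ ord (i + 1), ∀ x < M, best' t x = best t x ∧ arg' t x = arg t x)
    (hadd : ∀ t, ∀ x < M, D' t x =
      D t x + if t = par (ord (i + 1)) then best' (ord (i + 1)) (pr (ord (i + 1)) x) else 0) :
    IsDP i M q V pr ws ord par D' best' arg' := by
  obtain ⟨l₀, hl₀, hpar⟩ := hO.par_eq (l := i + 1) (by omega) (by omega)
  have hD : ∀ l, i < l → l ≤ q → ∀ x < M, D' (ord l) x = D (ord l) x := by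
    intro l h1 h2 x hx
    rw [hadd _ x hx, if_neg, add_zero]
    intro h3
    rw [hpar] at h3
    have := hO.inj' h2 (by omega) h3
    omega
  have hne : ∀ l, i + 1 < l → l ≤ q → ord l ≠ ord (i + 1) := fun l h1 h2 h3 => by
    have := hO.inj' h2 (by omega) h3
    omega
  refine ⟨fun l h1 h2 => ?_, fun t x hx => ?_⟩
  · obtain rfl | h3 : l = i + 1 ∨ i + 1 < l := by omega
    · exact hmax.congr (fun _ => Iff.rfl) (fun x hx => by rw [hD _ h1 h2 x hx.1]) (fun _ _ => rfl)
        fun _ _ => rfl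
    · exact (h.max l h3 h2).congr (fun _ => Iff.rfl) (fun x hx => by rw [hD _ h1 h2 x hx.1])
        (fun x hx => (hold _ (hne l h3 h2) x hx).1.symm)
        fun x hx => (hold _ (hne l h3 h2) x hx).2.symm
  · rw [hadd t x hx, h.sum t x hx, add_comm, show Finset.Ioc i q = insert (i + 1) (Finset.Ioc (i + 1) q) by
      ext; simp; omega, Finset.sum_insert (by simp)]
    congr 1
    · simp only [eq_comm]
    · refine Finset.sum_congr rfl fun l hl => ?_
      rw [Finset.mem_Ioc] at hl
      rw [(hold _ (hne l hl.1 hl.2) _ (hpr _ (hO.ord_le hl.2) x hx)).1]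

theorem run_dp {R : ℕ → ℕ → Prop} (hT : IsTables s M q V pr ws)
    (hO : IsTreeOrder q R (s.arr 18) (s.arr 19)) (hW : (q + 1) * M < W)
    (hv : ∀ t ≤ q, ∀ x < M, 0 ≤ ws x - ws (pr t x)) (h2 : ∀ a, s.wt 2 a = 0)
    (h3 : ∀ a, s.wt 3 a = 0) :
    Run W dp s (q * (150 * M + 50) + 10) fun s' =>
      IsDP 0 M q V pr ws (s.arr 18) (s.arr 19) (fun t x => s'.wt 2 (t * M + x))
        (fun t x => s'.wt 3 (t * M + x)) (fun t x => s'.arr 21 (t * M + x)) := by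
  set ord := s.arr 18 with hord
  set par := s.arr 19 with hpar
  -- After `i` iterations the last `i` nodes of the order are done. The final clause keeps the rows
  -- of the remaining nodes at their default 0, as `run_maxLoop` requires.
  let Inv : ℕ → State → Prop := fun i s' =>
    IsDP (q - i) M q V pr ws ord par (fun t x => s'.wt 2 (t * M + x))
      (fun t x => s'.wt 3 (t * M + x)) (fun t x => s'.arr 21 (t * M + x)) ∧
      (∀ a, 0 ≤ s'.wt 2 a) ∧ (∀ a, 0 ≤ s'.wt 3 a) ∧
      ∀ l ≤ q - i, ∀ x < M, s'.wt 3 (ord l * M + x) = 0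
  refine (Run.for Inv
      (L := 0) (U := q) (c := fun _ => 150 * M + 30) (by simp; omega) (by simp) (Nat.zero_le _)
      (by simp [maxLoop, addLoop]) ?_ (fun _ _ _ h => h) ?_ ?_).mono (by simp; ring_nf; omega) ?_
  · intro s' hf
    simp [hf.var 2 (by simp [maxLoop, addLoop]), hT.var_two]
  · simp only [Inv, h2, h3, Nat.sub_zero]
    exact ⟨⟨fun l h1 h2 => by omega, by simp⟩, by simp⟩
  · intro i s₁ _ hi h5 hf ⟨i1, i2, i3, i4⟩
    have hT₁ : IsTables s₁ M q V pr ws := hT.congr (hf.var 2 (by simp [maxLoop, addLoop]))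
      (hf.var 4 (by simp [maxLoop, addLoop])) (hf.arr 16 (by simp [maxLoop, addLoop]))
      (hf.arr 17 (by simp [maxLoop, addLoop])) (hf.wt 1 (by simp [maxLoop, addLoop]))
    have h18 : s₁.arr 18 = ord := hf.arr 18 (by simp [maxLoop, addLoop])
    have h19 : s₁.arr 19 = par := hf.arr 19 (by simp [maxLoop, addLoop])
    clear hf
    obtain ⟨l₀, hl₀, hpeq⟩ := hO.par_eq (l := q - i) (by omega) (by omega)
    have ht : ord (q - i) ≤ q := hO.ord_le (by omega)
    have hp : par (ord (q - i)) ≤ q := by rw [hpeq]; exact hO.ord_le (by omega)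
    have hT₂ : IsTables ((s₁.setVar 7 (ord (q - i))).setVar 8 (par (ord (q - i)))) M q V pr ws :=
      hT₁.congr (by simp) (by simp) rfl rfl rfl
    have key : Run W (.seq maxLoop addLoop)
        ((s₁.setVar 7 (ord (q - i))).setVar 8 (par (ord (q - i)))) (150 * M + 20)
        (Inv (i + 1)) :=
      ((run_maxLoop hT₂ (t := ord (q - i)) (p := par (ord (q - i))) (by simp) (by simp) ht hp hW
      (hv _ hp) i2 i3 (i4 _ le_rfl)).seq (B₂ := 50 * M + 10) fun s₂ hf ⟨j1, j2, j3⟩ => ?_).le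
        (by omega)
    · refine (Run.step (Run.setVar (by simp) (Run.step (B₂ := 150 * M + 20)
        (Run.setVar (by simp) ?_)))).le ?_
      · simp only [Exp.eval_get, Exp.eval_sub, Exp.eval_var, State.arr_setVar, State.var_setVar,
          if_true, hT₁.var_two, h5, h18, h19]
        exact key
      · simp; omega
    · have hT₃ : IsTables s₂ M q V pr ws := hT₂.congr (hf.var 2 (by simp [maxLoop]))
        (hf.var 4 (by simp [maxLoop])) (hf.arr 16 (by simp [maxLoop]))
        (hf.arr 17 (by simp [maxLoop])) (hf.wt 1 (by simp [maxLoop]))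
      have h2₂ : s₂.wt 2 = s₁.wt 2 := hf.wt 2 (by simp [maxLoop])
      refine (run_addLoop hT₃ (t := ord (q - i)) (p := par (ord (q - i)))
        (by rw [hf.var 7 (by simp [maxLoop])]; simp)
        (by rw [hf.var 8 (by simp [maxLoop])]; simp) ht hp hW (by rwa [h2₂]) j2).mono le_rfl ?_
      rintro s₃ hf' ⟨k1, k2⟩
      have h3₃ : s₃.wt 3 = s₂.wt 3 := hf'.wt 3 (by simp [addLoop])
      have h21₃ : s₃.arr 21 = s₂.arr 21 := hf'.arr 21 (by simp [addLoop])
      obtain ⟨i', hi'⟩ : ∃ i', q - i = i' + 1 := ⟨q - i - 1, by omega⟩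
      have hi'' : q - (i + 1) = i' := by omega
      simp only [Inv, hi'']
      rw [hi'] at i1 i4 j1 j3 k2
      refine ⟨i1.step hO (by omega) hT.proj_lt ?_ ?_ ?_, k1, by rwa [h3₃], ?_⟩
      · simpa only [h3₃, h21₃, State.wt_setVar] using j1
      · simpa only [h3₃, h21₃, State.wt_setVar, State.arr_setVar] using j3
      · simpa only [h3₃, h2₂] using k2
      · intro l hl x hx
        rw [h3₃, (j3 (ord l) (fun h => ?_) x hx).1]
        · exact i4 l (by omega) x hx
        · have := hO.inj' (by omega) (by omega) h
          omega
  · rintro s' - ⟨h, -⟩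
    rwa [Nat.sub_self] at h

/-- Mark the elements of the set coded by `var 8` in the output. -/
def readSet : Prog :=
  .loop (.not (.eq (.var 8) (.lit 0))) <|
    .seq (.setArr 10 (.var 8 % .var 3 - .lit 1) (.lit 1)) (.setVar 8 (.var 8 / .var 3))

theorem run_readSet {b k x : ℕ} (hb1 : 1 < b) (hb : s.var 3 = b) (h8 : s.var 8 = x) (hx : x < b ^ k)
    (h1W : 1 < W) :
    Run W readSet s (20 * k + 5) (Marks 10 (fun a => ∃ d ∈ Nat.digits b x, a = d - 1) s) := by
  -- The marks already made together with the digits still to be read stay constant. The potential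
  -- counts these digits, at most `k` at the start.
  refine (Run.loop (fun s' => ∀ a, (s'.arr 10 a ≠ 0 ∨ ∃ d ∈ Nat.digits b (s'.var 8), a = d - 1) ↔
      (s.arr 10 a ≠ 0 ∨ ∃ d ∈ Nat.digits b x, a = d - 1))
    (fun s' => 20 * (Nat.digits b (s'.var 8)).length + 5) ?_ ?_ ?_ ?_).mono ?_ ?_
  · intros
    simp
    omega
  · intro s' hf hinv hc
    have hb' : s'.var 3 = b := by rw [hf.var 3 (by simp), hb]
    have h0 : 0 < s'.var 8 := Nat.pos_of_ne_zero (by simpa using hc)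
    refine ⟨_, Run.step (Run.setArr (by simpa using h1W) (by simpa using h1W)
      (Run.setVar (by simp) ⟨fun a => ?_, ?_⟩))⟩
    · simp only [Exp.eval_div, Exp.eval_var, Exp.eval_sub, Exp.eval_mod, Exp.eval_lit,
        State.var_setVar, State.arr_setVar, if_true, hb', State.var_setArr]
      rw [Marks.setArr, ← hinv, Nat.digits_def' hb1 h0]
      simp [or_assoc]
    · simp only [Exp.eval_div, Exp.eval_var, State.var_setVar, if_true, hb', State.var_setArr]
      rw [Nat.digits_def' hb1 h0]
      simp
      omega
  · intros
    simp
  · intro a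
    rw [h8]
  · have := (Nat.digits_length_le_iff hb1 x).2 hx
    rw [h8]
    omega
  · rintro s' - ⟨h1, h2⟩ a
    rw [← h1]
    simp only [Cond.Holds, not_not, Exp.eval_var, Exp.eval_lit] at h2
    simp [h2]

/-- Read off a solution from the tables of the dynamic program, from the root to the leaves. -/
def collect : Prog :=
  .for 5 (.lit 1) (.var 2 + .lit 1) <| .seq (.setVar 7 (.get 18 (.var 5))) <|
    .seq (.setArr 22 (.var 7) (.get 21 (.var 7 * .var 4 +
      .get 17 (.var 7 * .var 4 + .get 22 (.get 19 (.var 7)))))) <|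
    .seq (.setVar 8 (.get 22 (.var 7))) readSet

/-- Parents come first, so the choice `y` at the parent is known when `t` is reached, and the
maximizer stored under the key `pr t y` is consistent with it. By `hext` the class of this key is
nonempty, so the stored entry is a true maximizer and not a default. -/
theorem run_collect {R : ℕ → ℕ → Prop} {b k : ℕ} {f best : ℕ → ℕ → ℚ}
    (hT : IsTables s M q V pr ws) (hb1 : 1 < b) (hb : s.var 3 = b) (hMb : M ≤ b ^ k)
    (hO : IsTreeOrder q R (s.arr 18) (s.arr 19)) (hW : (q + 1) * M < W) (hqW : q + 1 < W)
    (hmax : ∀ l, 1 ≤ l → l ≤ q → IsMaxTable M (Allowed M V pr (s.arr 18 l))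
      (pr (s.arr 19 (s.arr 18 l))) (f (s.arr 18 l)) (best (s.arr 18 l))
      fun x => s.arr 21 (s.arr 18 l * M + x))
    (hext : ∀ t ≤ q, ∀ p ≤ q, ∀ y, Allowed M V pr p y → ∃ x, Allowed M V pr t x ∧ pr p x = pr t y)
    (h0 : Allowed M V pr q 0) (h22 : ∀ a, s.arr 22 a = 0) :
    Run W collect s (q * (20 * k + 60) + 20) fun s' =>
      ∃ ch : ℕ → ℕ, ch q = 0 ∧ (∀ t < q, Allowed M V pr t (ch t) ∧
        pr (s.arr 19 t) (ch t) = pr t (ch (s.arr 19 t)) ∧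
        f t (ch t) = best t (pr t (ch (s.arr 19 t)))) ∧
      Marks 10 (fun a => ∃ t < q, ∃ d ∈ Nat.digits b (ch t), a = d - 1) s s' := by
  set ord := s.arr 18 with hord
  set par := s.arr 19 with hpar
  have hM0 : 0 < M := by have := h0.1; omega
  let Inv : ℕ → State → Prop := fun i s' => s'.arr 22 q = 0 ∧
    (∀ l, 1 ≤ l → l < i → Allowed M V pr (ord l) (s'.arr 22 (ord l)) ∧
        pr (par (ord l)) (s'.arr 22 (ord l)) = pr (ord l) (s'.arr 22 (par (ord l))) ∧
        f (ord l) (s'.arr 22 (ord l)) = best (ord l) (pr (ord l) (s'.arr 22 (par (ord l))))) ∧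
    Marks 10 (fun a => ∃ l, 1 ≤ l ∧ l < i ∧ ∃ d ∈ Nat.digits b (s'.arr 22 (ord l)), a = d - 1) s s'
  refine (Run.for Inv (L := 1) (U := q + 1) (c := fun _ => 20 * k + 40) (by simp; omega) (by simp)
      (by simp) (by simp [readSet]) ?_ (fun _ _ _ h => h) ?_ ?_).mono ?_ ?_
  · intro s' hf
    simp [hf.var 2 (by simp [readSet]), hT.var_two]
    omega
  · refine ⟨h22 q, fun l h1 h2 => by omega, Marks.refl fun a => ?_⟩
    rintro ⟨l, h1, h2, -⟩
    omega
  · intro i s₁ hi1 hi h5 hf ⟨i1, i2, i3⟩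
    have hT₁ : IsTables s₁ M q V pr ws := hT.congr (hf.var 2 (by simp [readSet]))
      (hf.var 4 (by simp [readSet])) (hf.arr 16 (by simp [readSet]))
      (hf.arr 17 (by simp [readSet])) (hf.wt 1 (by simp [readSet]))
    have h18 : s₁.arr 18 = ord := hf.arr 18 (by simp [readSet])
    have h19 : s₁.arr 19 = par := hf.arr 19 (by simp [readSet])
    have h21 : s₁.arr 21 = s.arr 21 := hf.arr 21 (by simp [readSet])
    have hb₁ : s₁.var 3 = b := by rw [hf.var 3 (by simp [readSet]), hb]
    clear hf
    obtain ⟨l₀, hl₀, hpeq⟩ := hO.par_eq hi1 (by omega)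
    have ht : ord i ≤ q := hO.ord_le (by omega)
    have hp : par (ord i) ≤ q := by rw [hpeq]; exact hO.ord_le (by omega)
    have hchp : Allowed M V pr (par (ord i)) (s₁.arr 22 (par (ord i))) := by
      rw [hpeq]
      rcases Nat.eq_zero_or_pos l₀ with rfl | h
      · rwa [hO.ord_zero, i1]
      · exact (i2 l₀ h hl₀).1
    set y := s₁.arr 22 (par (ord i)) with hy
    have hkey := hT.proj_lt _ ht y hchp.1
    set x := s.arr 21 (ord i * M + pr (ord i) y) with hx
    obtain ⟨m1, m2, m3⟩ : Allowed M V pr (ord i) x ∧ pr (par (ord i)) x = pr (ord i) y ∧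
        f (ord i) x = best (ord i) (pr (ord i) y) := by
      rcases hmax i hi1 (by omega) _ hkey with ⟨-, h⟩ | ⟨h1, h2, h3, -⟩
      · obtain ⟨z, hz1, hz2⟩ := hext _ ht _ hp y hchp
        exact absurd hz2 (h z hz1)
      · exact ⟨h1, h2, h3⟩
    have a1 := mul_add_lt (Nat.lt_succ_of_le ht) hchp.1
    have a2 := mul_add_lt (Nat.lt_succ_of_le ht) hkey
    simp only [Nat.succ_eq_add_one] at a1 a2
    have hM := hT₁.var_four
    have hne : ∀ l, l < i → ord l ≠ ord i := fun l h1 h2 => by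
      have := hO.inj' (by omega) (by omega) h2
      omega
    have hevx : s₁.arr 21 (ord i * M + s₁.arr 17 (ord i * M + s₁.arr 22 (par (ord i)))) = x := by
      rw [← hy, hT₁.proj _ ht y hchp.1, h21]
    have key : Run W readSet ((((s₁.setVar 7 (ord i)).setArr 22 (ord i) x)).setVar 8 x) (20 * k + 5)
        (Inv (i + 1)) := by
      refine (run_readSet hb1 (by simpa using hb₁) (by simp) (m1.1.trans_le hMb) (by omega)).mono
        le_rfl fun s₂ hf hmk => ?_
      have h22₂ : s₂.arr 22 = Function.update (s₁.arr 22) (ord i) x := by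
        rw [hf.arr 22 (by simp [readSet])]
        simp
      have hold : ∀ l, l < i → s₂.arr 22 (ord l) = s₁.arr 22 (ord l) := fun l hl => by
        rw [h22₂, Function.update_of_ne (hne l hl)]
      have hnew : s₂.arr 22 (ord i) = x := by rw [h22₂, Function.update_self]
      refine ⟨?_, fun l hl1 hl2 => ?_, (Marks.trans i3 hmk).congr fun a => ?_⟩
      · rw [← hO.ord_zero, hold 0 (by omega), hO.ord_zero, i1]
      · obtain h | rfl : l < i ∨ l = i := by omega
        · obtain ⟨l', hl', hpl⟩ := hO.par_eq hl1 (by omega)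
          have := i2 l hl1 h
          rw [hpl] at this ⊢
          rwa [hold l h, hold l' (by omega)]
        · rw [hnew, hpeq, hold l₀ hl₀, ← hpeq]
          exact ⟨m1, m2, m3⟩
      · constructor
        · rintro (⟨l, h1, h2, h3⟩ | h)
          · exact ⟨l, h1, by omega, by rwa [hold l h2]⟩
          · exact ⟨i, hi1, by omega, by rwa [hnew]⟩
        · rintro ⟨l, h1, h2, h3⟩
          obtain h | rfl : l < i ∨ l = i := by omega
          · exact .inl ⟨l, h1, h, by rwa [hold l h] at h3⟩
          · exact .inr (by rwa [hnew] at h3)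
    refine (Run.step (Run.setVar (by simp) (Run.step (Run.setArr (by simp) ?_ (Run.step
      (B₂ := 20 * k + 5) (Run.setVar (by simp) ?_)))))).le ?_
    · simp [h5, h18, h19, hM, ← hy, hT₁.proj _ ht y hchp.1]
      omega
    · simpa [h5, h18, h19, hM, hevx] using key
    · simp; omega
  · simp
    ring_nf; omega
  · rintro s' - ⟨i1, i2, i3⟩
    refine ⟨s'.arr 22, i1, fun t ht => ?_, i3.congr fun a => ?_⟩
    · obtain ⟨l, h1, h2, rfl⟩ := hO.surj t ht
      exact i2 l h1 (by omega)
    · constructor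
      · rintro ⟨l, h1, h2, h3⟩
        exact ⟨ord l, hO.ord_lt l h1 (by omega), h3⟩
      · rintro ⟨t, ht, h3⟩
        obtain ⟨l, h1, h2, rfl⟩ := hO.surj t ht
        exact ⟨l, h1, by omega, h3⟩

end RAM

/-! ## Packings and tree decompositions -/

namespace RAM

/-! ### Cancellation of messages, and payment at top nodes -/

section duality

variable {M q : ℕ} {V : ℕ → Prop} {pr : ℕ → ℕ → ℕ} {ws : ℕ → ℚ} {ord par : ℕ → ℕ}
  {R : ℕ → ℕ → Prop} {D best : ℕ → ℕ → ℚ} {arg : ℕ → ℕ → ℕ}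

theorem IsTreeOrder.sum_ord (hO : IsTreeOrder q R ord par) (g : ℕ → ℚ) :
    ∑ l ∈ Finset.Ioc 0 q, g (ord l) = ∑ t ∈ Finset.range q, g t := by
  refine Finset.sum_nbij ord ?_ ?_ ?_ fun _ _ => rfl
  · intro l hl
    rw [Finset.mem_Ioc] at hl
    exact Finset.mem_range.2 (hO.ord_lt l hl.1 hl.2)
  · intro l hl l' hl' h
    simp only [Finset.coe_Ioc, Set.mem_Ioc] at hl hl'
    exact hO.inj l l' hl.1 hl.2 hl'.1 hl'.2 h
  · intro t ht
    simp only [Finset.coe_range, Set.mem_Iio] at ht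
    obtain ⟨l, h1, h2, h3⟩ := hO.surj t ht
    exact ⟨l, by simp; omega, h3⟩

theorem IsTreeOrder.par_le (hO : IsTreeOrder q R ord par) {t : ℕ} (ht : t < q) : par t ≤ q := by
  obtain ⟨l, h1, h2, rfl⟩ := hO.surj t ht
  obtain ⟨l', h3, h4⟩ := hO.par_eq h1 h2
  rw [h4]
  exact hO.ord_le (by omega)

/-- The messages telescope. -/
theorem IsDP.sum_eq (hO : IsTreeOrder q R ord par) (h : IsDP 0 M q V pr ws ord par D best arg)
    (z : ℕ → ℕ) (hz : ∀ t ≤ q, z t < M) :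
    ∑ t ∈ Finset.range q, best t (pr t (z (par t))) =
      D q (z q) + ∑ t ∈ Finset.range q, D t (z t) := by
  have h1 : ∑ t ∈ Finset.range (q + 1), D t (z t) =
      ∑ t ∈ Finset.range q, best t (pr t (z (par t))) := by
    -- After exchanging the sums, each message is received at exactly one node, the parent of its
    -- sender. The range includes `q`, the parent of the root.
    rw [← hO.sum_ord, Finset.sum_congr rfl fun t ht =>
      h.sum t (z t) (hz t (Nat.lt_succ_iff.1 (Finset.mem_range.1 ht))), Finset.sum_comm]
    refine Finset.sum_congr rfl fun l hl => ?_
    rw [Finset.mem_Ioc] at hl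
    have := hO.par_le (hO.ord_lt l hl.1 hl.2)
    rw [Finset.sum_ite_eq, if_pos (Finset.mem_range.2 (by omega))]
  rw [← h1, Finset.sum_range_succ, add_comm]

/-- At every node, payment plus incoming messages is at most the outgoing message. Summed over the
tree, the messages cancel except what the dummy node receives. -/
theorem IsDP.le (hO : IsTreeOrder q R ord par) (h : IsDP 0 M q V pr ws ord par D best arg)
    (hpr : ∀ t ≤ q, ∀ x < M, pr t x < M) (z : ℕ → ℕ) (hz : ∀ t ≤ q, Allowed M V pr t (z t))
    (hcons : ∀ t < q, pr (par t) (z t) = pr t (z (par t))) :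
    ∑ t ∈ Finset.range q, (ws (z t) - ws (pr (par t) (z t))) ≤ D q (z q) := by
  have h1 := h.sum_eq hO z fun t ht => (hz t ht).1
  have h2 : ∀ t ∈ Finset.range q, ws (z t) - ws (pr (par t) (z t)) + D t (z t) ≤
      best t (pr t (z (par t))) := by
    intro t ht
    obtain ⟨l, hl1, hl2, rfl⟩ := hO.surj t (Finset.mem_range.1 ht)
    have h3 := hO.ord_lt l hl1 hl2
    rcases h.max l hl1 hl2 (pr (ord l) (z (par (ord l))))
      (hpr _ h3.le _ (hz _ (hO.par_le h3)).1) with h4 | h4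
    · exact absurd (hcons _ h3) (h4.2 _ (hz _ h3.le))
    · exact h4.2.2.2 _ (hz _ h3.le) (hcons _ h3)
  have h3 := Finset.sum_le_sum h2
  rw [Finset.sum_add_distrib] at h3
  linarith

/-- The same cancellation, now with equality at every node. -/
theorem IsDP.eq (hO : IsTreeOrder q R ord par) (h : IsDP 0 M q V pr ws ord par D best arg)
    (z : ℕ → ℕ) (hz : ∀ t ≤ q, z t < M)
    (hmax : ∀ t < q, ws (z t) - ws (pr (par t) (z t)) + D t (z t) = best t (pr t (z (par t)))) :
    ∑ t ∈ Finset.range q, (ws (z t) - ws (pr (par t) (z t))) = D q (z q) := by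
  have h1 := h.sum_eq hO z hz
  have h2 := Finset.sum_congr rfl fun t ht => hmax t (Finset.mem_range.1 ht)
  rw [Finset.sum_add_distrib] at h2
  linarith

/-- A connected set of nodes contains exactly one node whose parent it does not contain. -/
theorem IsTreeOrder.existsUnique_top (hO : IsTreeOrder q R ord par) {B : ℕ → Prop}
    (hB : ∀ t, B t → t < q) (hne : ∃ t, B t)
    (hconn : ∀ Z : ℕ → Prop, (∃ t, B t ∧ Z t) →
      (∀ u v, B u → B v → u = par v ∨ v = par u → Z u → Z v) → ∀ t, B t → Z t) :
    ∃! t, B t ∧ ¬ B (par t) := by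
  -- Climbing from any node of `B` must leave `B`, at the latest at the dummy node.
  have hex : ∃ t, B t ∧ ¬ B (par t) := by
    obtain ⟨t, ht⟩ := hne
    obtain ⟨l, h1, h2, rfl⟩ := hO.surj t (hB t ht)
    induction l using Nat.strong_induction_on with
    | _ l ih =>
      by_cases hp : B (par (ord l))
      · obtain ⟨l', h3, h4⟩ := hO.par_eq h1 h2
        rw [h4] at hp
        rcases Nat.eq_zero_or_pos l' with rfl | h5
        · have := hB _ hp
          rw [hO.ord_zero] at this
          omega
        · exact ih l' h3 h5 (by omega) hp
      · exact ⟨_, ht, hp⟩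
  obtain ⟨t₁, ht₁, hp₁⟩ := hex
  refine ⟨t₁, ⟨ht₁, hp₁⟩, fun t₂ ⟨ht₂, hp₂⟩ => ?_⟩
  -- The property that spreads over `B`: the chain of parents leads to `t₁` within `B`. A step to a
  -- child lengthens the chain; a step to the parent drops its first link, which exists because the
  -- parent of `t₁` is outside `B`. A second top has no first link, so it is `t₁`.
  have hZ := hconn (Relation.ReflTransGen (fun a c => B c ∧ c = par a) · t₁) ⟨t₁, ht₁, .refl⟩
    (fun u v hu hv huv hZ => ?_) t₂ ht₂
  · rcases Relation.ReflTransGen.cases_head hZ with h | ⟨c, ⟨h1, rfl⟩, -⟩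
    exacts [h, absurd h1 hp₂]
  · rcases huv with h | rfl
    · exact .head ⟨hu, h⟩ hZ
    · rcases Relation.ReflTransGen.cases_head hZ with rfl | ⟨c, ⟨h1, rfl⟩, h2⟩
      exacts [absurd hv hp₁, h2]

/-- The weight of a set that is covered by connected sets of nodes, summed up by tops. -/
theorem sum_wsum_sub {b : ℕ} {A : ℕ → ℕ → Bool} {w : ℕ → ℚ} (hb : 1 < b)
    (hA : ∀ t, A t 0 = false) (I : Finset ℕ) (z : ℕ → ℕ)
    (hnd : ∀ t < q, (Nat.digits b (z t)).Nodup)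
    (hz : ∀ t < q, ∀ d, d ∈ Nat.digits b (z t) ↔ d ∈ I ∧ A t d)
    (htop : ∀ d ∈ I, ∃! t, t < q ∧ A t d ∧ ¬ A (par t) d) :
    ∑ t ∈ Finset.range q, (wsum b w (z t) - wsum b w (proj b (A (par t)) (z t))) =
      ∑ d ∈ I, w d := by
  have h1 : ∀ t ∈ Finset.range q, wsum b w (z t) - wsum b w (proj b (A (par t)) (z t)) =
      ∑ d ∈ I, if A t d ∧ ¬ A (par t) d then w d else 0 := by
    intro t ht
    have ht' := Finset.mem_range.1 ht
    rw [wsum_sub_wsum_proj hb (hA _), ← List.sum_toFinset _ (hnd t ht'),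
      show (Nat.digits b (z t)).toFinset = I.filter fun d => A t d by
        ext d; simp [hz t ht' d], Finset.sum_filter]
    refine Finset.sum_congr rfl fun d _ => ?_
    cases A t d <;> cases A (par t) d <;> simp
  -- Counted by elements, `d` contributes only at its unique top.
  rw [Finset.sum_congr rfl h1, Finset.sum_comm]
  refine Finset.sum_congr rfl fun d hd => ?_
  obtain ⟨t, ⟨h2, h3⟩, h4⟩ := htop d hd
  rw [Finset.sum_eq_single_of_mem t (Finset.mem_range.2 h2), if_pos h3]
  intro t' ht' hne
  rw [if_neg]
  exact fun h => hne (h4 t' ⟨Finset.mem_range.1 ht', h⟩)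

end duality

/-- In a tree, all edges join a node to its parent. -/
theorem IsTreeOrder.eq_par {q : ℕ} {T : SimpleGraph (Fin q)} (hT : T.IsTree) {R : ℕ → ℕ → Prop}
    {ord par : ℕ → ℕ} (hO : IsTreeOrder q R ord par) (hR : ∀ u v : Fin q, R u v → T.Adj u v)
    {u v : Fin q} (h : T.Adj u v) : (u : ℕ) = par v ∨ (v : ℕ) = par u := by
  classical
  choose pos hpos1 hpos2 hpos3 using fun v : Fin q => hO.surj v v.2
  have hpar : ∀ v : Fin q, (v : ℕ) ≠ 0 → ∃ p : Fin q, par v = p ∧ pos p < pos v ∧ T.Adj p v := by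
    intro v hv
    have h2 : 2 ≤ pos v := by
      have h1 := hpos1 v
      by_contra h2
      obtain h3 : pos v = 1 := by omega
      have := hpos3 v
      rw [h3, hO.ord_one] at this
      exact hv this.symm
    obtain ⟨i, h3, h4, h5, h6⟩ := hO.par_spec _ h2 (hpos2 v)
    rw [hpos3] at h5 h6
    have h7 := hO.ord_lt i h3 (by have := hpos2 v; omega)
    refine ⟨⟨ord i, h7⟩, h5, ?_, hR ⟨ord i, h7⟩ v h6⟩
    have h8 := hpos3 ⟨ord i, h7⟩
    have h9 := hO.inj _ i (hpos1 _) (hpos2 _) h3 (by have := hpos2 v; omega) h8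
    rwa [h9]
  choose! pv hpv1 hpv2 hpv3 using hpar
  have hq : 0 < q := u.pos
  let root : Fin q := ⟨0, hq⟩
  have hroot : ∀ v ∈ Finset.univ.erase root, (v : ℕ) ≠ 0 := by
    intro v hv h
    exact (Finset.mem_erase.1 hv).1 (Fin.ext h)
  -- The edges from nonroot nodes to their parents are distinct, since two nodes cannot precede each
  -- other. There are `q - 1` of them, as many as the tree has edges, so no other edges exist.
  have himg : (Finset.univ.erase root).image (fun v => s(pv v, v)) = T.edgeFinset := by
    refine Finset.eq_of_subset_of_card_le ?_ ?_
    · intro e he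
      obtain ⟨v, hv, rfl⟩ := Finset.mem_image.1 he
      simpa using hpv3 v (hroot v hv)
    · rw [Finset.card_image_of_injOn, Finset.card_erase_of_mem (Finset.mem_univ _),
        Finset.card_univ, ← hT.card_edgeFinset]
      · simp
      · intro v hv v' hv' hvv
        have h1 := hpv2 v (hroot v hv)
        have h2 := hpv2 v' (hroot v' hv')
        simp only [Sym2.eq_iff] at hvv
        rcases hvv with ⟨-, h⟩ | ⟨h3, h4⟩
        · exact h
        · rw [h3] at h1
          rw [← h4] at h2
          omega
  have hmem : s(u, v) ∈ T.edgeFinset := by simpa using h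
  rw [← himg] at hmem
  obtain ⟨x, hx, hxe⟩ := Finset.mem_image.1 hmem
  have h1 := hpv1 x (hroot x hx)
  rcases Sym2.eq_iff.1 hxe with ⟨h2, h3⟩ | ⟨h2, h3⟩
  · left; rw [← h2, ← h3, h1]
  · right; rw [← h2, ← h3, h1]

/-! ### Subgraphs and the bags they meet -/

variable {n m q : ℕ} {G : SimpleGraph (Fin n)} {H : Fin m → G.Subgraph} {T : SimpleGraph (Fin q)}
  {X : Fin q → Set (Fin n)}

/-- A connected subgraph meets the bags of a connected set of nodes. -/
theorem _root_.IsTreeDecomposition.meets_connected (hX : IsTreeDecomposition G T X)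
    {K : G.Subgraph} (hK : K.Connected) (Z : Fin q → Prop)
    (hZ : ∃ t, (∃ v ∈ K.verts, v ∈ X t) ∧ Z t)
    (hclosed : ∀ s t, (∃ v ∈ K.verts, v ∈ X s) → (∃ v ∈ K.verts, v ∈ X t) → T.Adj s t → Z s → Z t)
    (t : Fin q) (ht : ∃ v ∈ K.verts, v ∈ X t) : Z t := by
  have hclosure : ∀ {β : Type} {Γ : SimpleGraph β} (P : β → Prop), (∀ a c, Γ.Adj a c → P a → P c) →
      ∀ a c, Γ.Reachable a c → P a → P c := by
    rintro β Γ P h a c ⟨p⟩ ha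
    induction p with
    | nil => exact ha
    | cons hadj _ ih => exact ih (h _ _ hadj ha)
  -- For a single vertex, `Z` spreads over all its bags because they are connected in the tree.
  have h1 : ∀ v ∈ K.verts, (∃ t, v ∈ X t ∧ Z t) → ∀ t, v ∈ X t → Z t := by
    rintro v hv ⟨s, hs, hsZ⟩ t ht
    exact hclosure (Γ := T.induce {t | v ∈ X t}) (fun t => Z t.1)
      (fun a c hac ha => hclosed _ _ ⟨v, hv, a.2⟩ ⟨v, hv, c.2⟩ hac ha) ⟨s, hs⟩ ⟨t, ht⟩
      ((hX.connected v).preconnected _ _) hsZ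
  obtain ⟨s, ⟨u, hu, hus⟩, hsZ⟩ := hZ
  obtain ⟨v, hv, hvt⟩ := ht
  -- Adjacent vertices of `K` share a bag, which hands `Z` on along walks of `K`.
  refine hclosure (Γ := K.coe) (fun v => ∀ t, v.1 ∈ X t → Z t) ?_ ⟨u, hu⟩ ⟨v, hv⟩
    (hK.coe.preconnected _ _) (h1 u hu ⟨s, hus, hsZ⟩) t hvt
  intro a c hac ha
  obtain ⟨r, hr1, hr2⟩ := hX.exists_edge _ _ (K.adj_sub hac)
  exact h1 c c.2 ⟨r, hr2, ha r hr1⟩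

/-- Two subgraphs that cannot both be in a packing. -/
def Conflict (H : Fin m → G.Subgraph) (i j : Fin m) : Prop :=
  ∃ u ∈ (H i).verts, ∃ v ∈ (H j).verts, v = u ∨ G.Adj u v

theorem isIndepPacking_iff {I : Finset (Fin m)} : IsIndepPacking G H I ↔
    ∀ i ∈ I, ∀ j ∈ I, i ≠ j → ¬ Conflict H i j := by
  refine forall₂_congr fun i _ => forall₃_congr fun j _ _ => ?_
  rw [Conflict, Set.disjoint_left]
  constructor
  · rintro ⟨h1, h2⟩ ⟨u, hu, v, hv, rfl | h⟩
    exacts [h1 hu hv, h2 u hu v hv h]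
  · exact fun h => ⟨fun u hu hv => h ⟨u, hu, u, hv, .inl rfl⟩,
      fun u hu v hv huv => h ⟨u, hu, v, hv, .inr huv⟩⟩

theorem Conflict.symm {i j : Fin m} (h : Conflict H i j) : Conflict H j i := by
  obtain ⟨u, hu, v, hv, h⟩ := h
  exact ⟨v, hv, u, hu, h.imp Eq.symm SimpleGraph.Adj.symm⟩

/-- At most `k` members of a packing meet a bag. -/
theorem card_le_of_bag {k : ℕ} (hk : bagsIndepNum G X ≤ k) {I : Finset (Fin m)}
    (hI : IsIndepPacking G H I) (t : Fin q) (ht : ∀ j ∈ I, ∃ v ∈ (H j).verts, v ∈ X t) :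
    I.card ≤ k := by
  classical
  rw [isIndepPacking_iff] at hI
  choose f hf1 hf2 using ht
  -- Vertices chosen from different members are distinct and nonadjacent, or these members would
  -- conflict.
  let g : I → X t := fun j => ⟨f j j.2, hf2 j j.2⟩
  have hg : Function.Injective g := fun i j hij => Subtype.ext <| by
    by_contra hne
    exact hI i i.2 j j.2 hne ⟨f i i.2, hf1 i i.2, f j j.2, hf1 j j.2,
      .inl (congrArg Subtype.val hij).symm⟩
  have hind : (G.induce (X t)).IsIndepSet (Finset.univ.map ⟨g, hg⟩ : Finset (X t)) := by
    intro a ha c hc hac hadj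
    simp only [Finset.coe_map, Function.Embedding.coeFn_mk, Finset.coe_univ, Set.image_univ,
      Set.mem_range] at ha hc
    obtain ⟨i, rfl⟩ := ha
    obtain ⟨j, rfl⟩ := hc
    exact hI i i.2 j j.2 (fun h => hac (by rw [Subtype.ext h]))
      ⟨f i i.2, hf1 i i.2, f j j.2, hf1 j j.2, .inr hadj⟩
  have := hind.card_le_indepNum
  rw [Finset.card_map, Finset.card_univ, Fintype.card_coe] at this
  exact this.trans ((Finset.le_sup (f := fun t => (G.induce (X t)).indepNum)
    (Finset.mem_univ t)).trans hk)

end RAM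

/-! ### Packings as consistent families of codes -/

namespace RAM

/-- Validity is a pairwise condition in list order; a symmetrized relation makes it applicable to
any two digits. -/
theorem IsCode.not_conflict {b x : ℕ} {cf : ℕ → ℕ → Prop} (h : IsCode b cf x) {d e : ℕ}
    (hd : d ∈ Nat.digits b x) (he : e ∈ Nat.digits b x) (hed : e < d) : ¬ cf e d := by
  have : Std.Symm fun d e => (e < d → ¬ cf e d) ∧ (d < e → ¬ cf d e) :=
    ⟨fun _ _ h => ⟨h.2, h.1⟩⟩
  have h1 : (Nat.digits b x).Pairwise fun d e => (e < d → ¬ cf e d) ∧ (d < e → ¬ cf d e) :=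
    h.imp fun h => ⟨fun _ => h.2, fun h' => absurd h' h.1.not_gt⟩
  exact (h1.forall hd he hed.ne').1 hed

variable {n m q : ℕ} {G : SimpleGraph (Fin n)} {H : Fin m → G.Subgraph} {T : SimpleGraph (Fin q)}
  {X : Fin q → Set (Fin n)}

open Classical in
/-- Whether the subgraph number `d - 1` meets the bag number `t`. -/
noncomputable def meets (H : Fin m → G.Subgraph) (X : Fin q → Set (Fin n)) (t d : ℕ) : Bool :=
  decide (∃ (s : Fin q) (j : Fin m), t = s ∧ d = j + 1 ∧ ∃ v ∈ (H j).verts, v ∈ X s)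

theorem meets_iff {t d : ℕ} : meets H X t d ↔
    ∃ (s : Fin q) (j : Fin m), t = s ∧ d = j + 1 ∧ ∃ v ∈ (H j).verts, v ∈ X s := by
  simp [meets]

theorem meets_succ_iff {s : Fin q} {j : Fin m} :
    meets H X s (j + 1) ↔ ∃ v ∈ (H j).verts, v ∈ X s := by
  rw [meets_iff]
  constructor
  · rintro ⟨s', j', h1, h2, h3⟩
    obtain rfl := Fin.ext h1
    obtain rfl : j = j' := Fin.ext (by omega)
    exact h3
  · exact fun h => ⟨s, j, rfl, rfl, h⟩

theorem meets_lt {t d : ℕ} (h : meets H X t d) : t < q := by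
  obtain ⟨s, j, rfl, -⟩ := meets_iff.1 h
  exact s.2

theorem meets_zero (t : ℕ) : meets H X t 0 = false := by
  by_contra h
  obtain ⟨s, j, -, h1, -⟩ := meets_iff.1 (Bool.eq_true_of_not_eq_false h)
  omega

theorem meets_self (d : ℕ) : meets H X q d = false := by
  by_contra h
  exact (meets_lt (Bool.eq_true_of_not_eq_false h)).false

/-- No subgraph meets the dummy node, so 0 is its only allowed code and the root pays for its whole
trace. -/
theorem proj_meets_self {b x : ℕ} : proj b (meets H X q) x = 0 := by
  rw [proj, show meets H X q = fun _ => false from funext meets_self]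
  simp

variable {ord par : ℕ → ℕ} {R : ℕ → ℕ → Prop} {k : ℕ}

theorem meets_connected (hX : IsTreeDecomposition G T X) (hO : IsTreeOrder q R ord par)
    (hR : ∀ u v : Fin q, R u v → T.Adj u v) {j : Fin m} (hj : (H j).Connected) (Z : ℕ → Prop)
    (hZ : ∃ t, meets H X t (j + 1) ∧ Z t)
    (hc : ∀ u v, meets H X u (j + 1) → meets H X v (j + 1) → u = par v ∨ v = par u → Z u → Z v)
    (t : ℕ) (ht : meets H X t (j + 1)) : Z t := by
  obtain ⟨s, hs, hsZ⟩ := hZ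
  exact hX.meets_connected hj (fun t => Z t)
    ⟨⟨s, meets_lt hs⟩, meets_succ_iff.1 hs, hsZ⟩
    (fun u v hu hv huv => hc u v (meets_succ_iff.2 hu) (meets_succ_iff.2 hv)
      (hO.eq_par hX.isTree hR huv)) ⟨t, meets_lt ht⟩ (meets_succ_iff.1 ht)

theorem existsUnique_top (hX : IsTreeDecomposition G T X) (hO : IsTreeOrder q R ord par)
    (hR : ∀ u v : Fin q, R u v → T.Adj u v) {j : Fin m} (hj : (H j).Connected) :
    ∃! t, t < q ∧ meets H X t (j + 1) ∧ ¬ meets H X (par t) (j + 1) := by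
  obtain ⟨t, ⟨h1, h2⟩, h3⟩ := hO.existsUnique_top (B := fun t => meets H X t (j + 1))
    (fun t => meets_lt) (by
      obtain ⟨v, hv⟩ := hj.nonempty
      obtain ⟨t, ht⟩ := hX.exists_mem v
      exact ⟨t, meets_succ_iff.2 ⟨v, hv, ht⟩⟩)
    (meets_connected hX hO hR hj)
  exact ⟨t, ⟨meets_lt h1, h1, h2⟩, fun t' h => h3 t' h.2⟩

/-- A common vertex lies in some bag, and so do both ends of a joining edge. -/
theorem conflict_meets (hX : IsTreeDecomposition G T X) {i j : Fin m} (h : Conflict H i j) :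
    ∃ t : Fin q, meets H X t (i + 1) ∧ meets H X t (j + 1) := by
  obtain ⟨u, hu, v, hv, rfl | h⟩ := h
  · obtain ⟨t, ht⟩ := hX.exists_mem v
    exact ⟨t, meets_succ_iff.2 ⟨v, hu, ht⟩, meets_succ_iff.2 ⟨v, hv, ht⟩⟩
  · obtain ⟨t, hut, hvt⟩ := hX.exists_edge u v h
    exact ⟨t, meets_succ_iff.2 ⟨u, hu, hut⟩, meets_succ_iff.2 ⟨v, hv, hvt⟩⟩

theorem exists_meets_eq (t : ℕ) {d : ℕ} (h : meets H X t d) : ∃ j : Fin m, d = j + 1 := by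
  obtain ⟨-, j, -, h, -⟩ := meets_iff.1 h
  exact ⟨j, h⟩

/-- The consistent family of codes given by a packing. -/
theorem exists_codes {cf : ℕ → ℕ → Prop} (hm : 1 < m + 1) (hk : bagsIndepNum G X ≤ k)
    (hcf : ∀ i j : Fin m, cf (i + 1) (j + 1) ↔ Conflict H i j) {I : Finset (Fin m)}
    (hI : IsIndepPacking G H I) :
    ∃ z : ℕ → ℕ, z q = 0 ∧
      (∀ t ≤ q, Allowed ((m + 1) ^ k) (IsCode (m + 1) cf) (fun t => proj (m + 1) (meets H X t)) t
        (z t)) ∧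
      (∀ t t', proj (m + 1) (meets H X t') (z t) = proj (m + 1) (meets H X t) (z t')) ∧
      ∀ t d, d ∈ Nat.digits (m + 1) (z t) ↔
        d ∈ I.image (fun j : Fin m => (j : ℕ) + 1) ∧ meets H X t d := by
  classical
  -- The code `c` of the entire packing may exceed `(m + 1) ^ k`. Its projections to the nodes do
  -- not, and they are consistent because projections commute.
  obtain ⟨c, hc1, hc2⟩ := exists_isCode (cf := cf) hm (I.image fun j : Fin m => (j : ℕ) + 1)
    (fun d hd => by
      obtain ⟨j, -, rfl⟩ := Finset.mem_image.1 hd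
      omega)
    (fun e he d hd hed => by
      obtain ⟨i, hi, rfl⟩ := Finset.mem_image.1 he
      obtain ⟨j, hj, rfl⟩ := Finset.mem_image.1 hd
      rw [hcf]
      exact isIndepPacking_iff.1 hI i hi j hj (by rintro rfl; omega))
  have hmem : ∀ t d, d ∈ Nat.digits (m + 1) (proj (m + 1) (meets H X t) c) ↔
      d ∈ I.image (fun j : Fin m => (j : ℕ) + 1) ∧ meets H X t d := fun t d => by
    rw [mem_digits_proj hm (meets_zero t), hc2]
  refine ⟨fun t => proj (m + 1) (meets H X t) c, proj_meets_self, fun t ht => ?_,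
    fun t t' => proj_comm hm (meets_zero _) (meets_zero _), hmem⟩
  have hcode := hc1.proj hm (meets_zero (H := H) (X := X) t)
  refine ⟨?_, hcode, proj_proj_self hm (meets_zero t)⟩
  rcases ht.lt_or_eq with ht | rfl
  · rw [← Nat.digits_length_le_iff hm, ← List.toFinset_card_of_nodup hcode.nodup]
    have h1 : (Nat.digits (m + 1) (proj (m + 1) (meets H X t) c)).toFinset =
        (I.filter fun j : Fin m => meets H X t (j + 1)).image fun j : Fin m => (j : ℕ) + 1 := by
      ext d
      rw [List.mem_toFinset, hmem]
      simp only [Finset.mem_image, Finset.mem_filter]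
      constructor
      · rintro ⟨⟨j, hj, rfl⟩, h⟩
        exact ⟨j, ⟨hj, h⟩, rfl⟩
      · rintro ⟨j, ⟨hj, h⟩, rfl⟩
        exact ⟨⟨j, hj, rfl⟩, h⟩
    rw [h1]
    refine Finset.card_image_le.trans (card_le_of_bag hk (t := ⟨t, ht⟩) (H := H) ?_ ?_)
    · exact fun i hi j hj => hI i (Finset.mem_filter.1 hi).1 j (Finset.mem_filter.1 hj).1
    · intro j hj
      exact meets_succ_iff.1 (Finset.mem_filter.1 hj).2
  · simp only [proj_meets_self]
    positivity

/-- The dynamic program solves the problem. -/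
theorem isMaxWeightIndepPacking_of_isDP {cf : ℕ → ℕ → Prop} {w : Fin m → NNRat} {wd : ℕ → ℚ}
    {D best : ℕ → ℕ → ℚ} {arg : ℕ → ℕ → ℕ} {ch : ℕ → ℕ} {I : Finset (Fin m)}
    (hH : ∀ j, (H j).Connected) (hX : IsTreeDecomposition G T X) (hk : bagsIndepNum G X ≤ k)
    (hm : 1 < m + 1) (hcf : ∀ i j : Fin m, cf (i + 1) (j + 1) ↔ Conflict H i j)
    (hwd : ∀ j : Fin m, wd (j + 1) = w j)
    (hO : IsTreeOrder q R ord par) (hR : ∀ u v : Fin q, R u v → T.Adj u v)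
    (hpr : ∀ t ≤ q, ∀ x < (m + 1) ^ k, proj (m + 1) (meets H X t) x < (m + 1) ^ k)
    (hdp : IsDP 0 ((m + 1) ^ k) q (IsCode (m + 1) cf) (fun t => proj (m + 1) (meets H X t))
      (wsum (m + 1) wd) ord par D best arg)
    (hchq : ch q = 0)
    (hch : ∀ t < q, Allowed ((m + 1) ^ k) (IsCode (m + 1) cf)
        (fun t => proj (m + 1) (meets H X t)) t (ch t) ∧
      proj (m + 1) (meets H X (par t)) (ch t) = proj (m + 1) (meets H X t) (ch (par t)) ∧
      wsum (m + 1) wd (ch t) - wsum (m + 1) wd (proj (m + 1) (meets H X (par t)) (ch t)) +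
        D t (ch t) = best t (proj (m + 1) (meets H X t) (ch (par t))))
    (hI : ∀ j : Fin m, j ∈ I ↔ ∃ t < q, (j : ℕ) + 1 ∈ Nat.digits (m + 1) (ch t)) :
    IsMaxWeightIndepPacking G H w I := by
  have hmeets : ∀ t < q, ∀ d ∈ Nat.digits (m + 1) (ch t), meets H X t d := fun t ht =>
    (proj_eq_self_iff hm (meets_zero t)).1 (hch t ht).1.2.2
  have hmem : ∀ t < q, ∀ d, d ∈ Nat.digits (m + 1) (ch t) ↔
      d ∈ I.image (fun j : Fin m => (j : ℕ) + 1) ∧ meets H X t d := by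
    intro t ht d
    constructor
    · intro hd
      have h := hmeets t ht d hd
      obtain ⟨j, rfl⟩ := exists_meets_eq t h
      exact ⟨Finset.mem_image.2 ⟨j, (hI j).2 ⟨t, ht, hd⟩, rfl⟩, h⟩
    · rintro ⟨hd, h⟩
      obtain ⟨j, hj, rfl⟩ := Finset.mem_image.1 hd
      obtain ⟨s, hs, hsd⟩ := (hI j).1 hj
      -- Consistency carries the digit of `H j` across every tree edge both of whose bags meet `H
      -- j`, hence from `s` to `t`.
      refine meets_connected hX hO hR (hH j) (fun t => (j : ℕ) + 1 ∈ Nat.digits (m + 1) (ch t))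
        ⟨s, hmeets s hs _ hsd, hsd⟩ (fun u v hu hv huv hdu => ?_) t h
      rcases huv with rfl | rfl
      · have h1 := (mem_digits_proj hm (meets_zero (H := H) (X := X) v)).2 ⟨hdu, hv⟩
        rw [← (hch v (meets_lt hv)).2.1, mem_digits_proj hm (meets_zero _)] at h1
        exact h1.1
      · have h1 := (mem_digits_proj hm (meets_zero (H := H) (X := X) (par u))).2 ⟨hdu, hv⟩
        rw [(hch u (meets_lt hu)).2.1, mem_digits_proj hm (meets_zero _)] at h1
        exact h1.1
  have hinj : ∀ J : Finset (Fin m), ∑ d ∈ J.image (fun j : Fin m => (j : ℕ) + 1), wd d =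
      ((∑ j ∈ J, w j : NNRat) : ℚ) := by
    intro J
    rw [Finset.sum_image fun i _ j _ h => Fin.ext (by simpa using h)]
    push_cast
    exact Finset.sum_congr rfl fun j _ => hwd j
  have htop : ∀ J : Finset (Fin m), ∀ d ∈ J.image (fun j : Fin m => (j : ℕ) + 1),
      ∃! t, t < q ∧ meets H X t d ∧ ¬ meets H X (par t) d := by
    intro J d hd
    obtain ⟨j, -, rfl⟩ := Finset.mem_image.1 hd
    exact existsUnique_top hX hO hR (hH j)
  refine ⟨isIndepPacking_iff.2 fun i hi j hj hij hc => ?_, fun I' hI' => ?_⟩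
  -- Conflicting members would meet a common bag and occur together in one valid code.
  · have key : ∀ i ∈ I, ∀ j ∈ I, (i : ℕ) < j → ¬ Conflict H i j := by
      intro i hi j hj hij hc
      obtain ⟨t, h1, h2⟩ := conflict_meets hX hc
      refine (hch t t.2).1.2.1.not_conflict ((hmem t t.2 _).2 ⟨Finset.mem_image_of_mem _ hj, h2⟩)
        ((hmem t t.2 _).2 ⟨Finset.mem_image_of_mem _ hi, h1⟩) (by omega) ((hcf i j).2 hc)
    rcases lt_trichotomy (i : ℕ) j with h | h | h
    · exact key i hi j hj h hc
    · exact hij (Fin.ext h)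
    · exact key j hj i hi h hc.symm
  · obtain ⟨z, hz1, hz2, hz3, hz4⟩ := exists_codes hm hk hcf hI'
    -- Both families have code 0 at the dummy node, so the bound for the competitor's family is the
    -- value attained by the computed one.
    have h1 := hdp.le hO hpr z hz2 fun t _ => hz3 t (par t)
    have h2 := hdp.eq hO ch (fun t ht => ?_) fun t ht => (hch t ht).2.2
    · rw [hz1, ← hchq, ← h2, sum_wsum_sub hm meets_zero _ z (fun t ht => (hz2 t ht.le).2.1.nodup)
        (fun t _ => hz4 t) (htop I'), sum_wsum_sub hm meets_zero _ ch
        (fun t ht => (hch t ht).1.2.1.nodup) hmem (htop I), hinj, hinj] at h1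
      exact_mod_cast h1
    · rcases ht.lt_or_eq with ht | rfl
      · exact (hch t ht).1.1
      · rw [hchq]
        positivity

end RAM

/-! ## The encoding -/

theorem listStart_cons_succ (a : List ℕ) (L : List (List ℕ)) (i : ℕ) :
    listStart (a :: L) (i + 1) = a.length + listStart L i := by
  simp [listStart]

theorem listStart_succ (L : List (List ℕ)) (i : ℕ) (hi : i < L.length) :
    listStart L (i + 1) = listStart L i + L[i].length := by
  induction L generalizing i with
  | nil => simp at hi
  | cons a L ih =>
    cases i with
    | zero => simp [listStart]
    | succ i =>
      rw [listStart_cons_succ, listStart_cons_succ, ih i (by simpa using hi), List.getElem_cons_succ,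
        add_assoc]

theorem listData_listStart_add (L : List (List ℕ)) (i j : ℕ) (hi : i < L.length)
    (hj : j < L[i].length) : listData L (listStart L i + j) = L[i][j] := by
  induction L generalizing i with
  | nil => simp at hi
  | cons a L ih =>
    cases i with
    | zero =>
      simp only [List.getElem_cons_zero] at hj ⊢
      simp [listData, listStart, List.getElem?_append_left hj, List.getElem?_eq_getElem hj]
    | succ i =>
      have := ih i (by simpa using hi) (by simpa using hj)
      simp only [List.getElem_cons_succ]
      rw [listStart_cons_succ, ← this]
      rw [listData, listData, List.flatten_cons, List.getD_append_right _ _ _ _ (by omega)]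
      congr 1
      omega

theorem listStart_le (L : List (List ℕ)) (i : ℕ) : listStart L i ≤ (L.map List.length).sum := by
  conv_rhs => rw [← List.take_append_drop i L, List.map_append, List.sum_append]
  exact Nat.le_add_right _ _

theorem listData_lt (L : List (List ℕ)) (N p : ℕ) (hN : 0 < N) (h : ∀ l ∈ L, ∀ v ∈ l, v < N) :
    listData L p < N := by
  rw [listData, List.getD_eq_getElem?_getD]
  rcases lt_or_ge p L.flatten.length with hp | hp
  · rw [List.getElem?_eq_getElem hp, Option.getD_some]
    obtain ⟨l, hl, hv⟩ := List.mem_flatten.1 (List.getElem_mem hp)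
    exact h l hl _ hv
  · rwa [List.getElem?_eq_none hp]

theorem Enumerates.length_eq {α : Type*} {l : List α} {S : Set α} (h : Enumerates l S) :
    l.length = S.ncard := by
  classical
  rw [← List.toFinset_card_of_nodup h.1, ← Set.ncard_coe_finset]
  congr 1
  ext x
  simp [h.2 x]

theorem sum_ncard_neighborSet {n : ℕ} (G : SimpleGraph (Fin n)) :
    ∑ u, (G.neighborSet u).ncard = 2 * G.edgeSet.ncard := by
  classical
  have h := G.sum_degrees_eq_twice_card_edges
  rw [Set.ncard_eq_toFinset_card', ← SimpleGraph.edgeFinset, ← h]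
  refine Finset.sum_congr rfl fun u _ => ?_
  rw [Set.ncard_eq_toFinset_card', ← SimpleGraph.neighborFinset, SimpleGraph.card_neighborFinset_eq_degree]

namespace RAM

variable {W : ℕ} {s : State}

theorem listed_iff {sa da R : ℕ} {f : Fin R → List ℕ} (hsa : s.arr sa = listStart (List.ofFn f))
    (hda : s.arr da = listData (List.ofFn f)) (i : Fin R) (v : ℕ) :
    Listed s sa da i v ↔ v ∈ f i := by
  have hi : (i : ℕ) < (List.ofFn f).length := by simp
  have hget : (List.ofFn f)[(i : ℕ)] = f i := by simp
  rw [Listed, hsa, hda, listStart_succ _ _ hi, hget]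
  constructor
  · rintro ⟨p, h1, h2, rfl⟩
    obtain ⟨j, rfl⟩ := Nat.exists_eq_add_of_le h1
    have hj : j < ((List.ofFn f)[(i : ℕ)]).length := by rw [hget]; omega
    rw [listData_listStart_add _ _ _ hi hj]
    simp only [hget]
    exact List.getElem_mem _
  · intro hv
    obtain ⟨j, hj, rfl⟩ := List.mem_iff_getElem.1 hv
    have hj' : j < ((List.ofFn f)[(i : ℕ)]).length := by rw [hget]; omega
    refine ⟨listStart (List.ofFn f) i + j, by omega, by omega, ?_⟩
    rw [listData_listStart_add _ _ _ hi hj']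
    simp only [hget]

theorem isListStore {sa da R N : ℕ} {f : Fin R → List ℕ}
    (hsa : s.arr sa = listStart (List.ofFn f)) (hda : s.arr da = listData (List.ofFn f))
    (hN : ∀ i, ∀ v ∈ f i, v < N) : IsListStore s sa da R N := by
  refine ⟨fun i hi => ?_, fun i hi v hv => ?_⟩
  · rw [hsa, listStart_succ _ _ (by simpa using hi)]
    exact Nat.le_add_right _ _
  · exact hN ⟨i, hi⟩ v ((listed_iff hsa hda ⟨i, hi⟩ v).1 hv)

theorem listStart_ofFn_le {R : ℕ} (f : Fin R → List ℕ) (i : ℕ) :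
    listStart (List.ofFn f) i ≤ ∑ j, (f j).length := by
  refine (listStart_le _ i).trans ?_
  rw [List.map_ofFn, List.sum_ofFn]
  rfl

theorem listData_ofFn_lt {R N : ℕ} (f : Fin R → List ℕ) (p : ℕ) (hN : 0 < N)
    (h : ∀ i, ∀ v ∈ f i, v < N) : listData (List.ofFn f) p < N := by
  refine listData_lt _ _ _ hN fun l hl v hv => ?_
  obtain ⟨i, rfl⟩ := (List.mem_ofFn' _ _).1 hl
  exact h i v hv

section

variable {n m q : ℕ} {G : SimpleGraph (Fin n)} {H : Fin m → G.Subgraph}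
  {T : SimpleGraph (Fin q)} {X : Fin q → Set (Fin n)} (E : PackingEncoding G H T X)

theorem adjG_start_le (i : ℕ) : listStart (List.ofFn fun u => (E.adjG u).map Fin.val) i ≤
    2 * G.edgeSet.ncard := by
  refine (listStart_ofFn_le _ i).trans ?_
  rw [← sum_ncard_neighborSet]
  exact (Finset.sum_congr rfl fun u _ => by rw [List.length_map, (E.adjG_spec u).length_eq]).le

theorem adjT_start_le (i : ℕ) : listStart (List.ofFn fun u => (E.adjT u).map Fin.val) i ≤
    2 * T.edgeSet.ncard := by
  refine (listStart_ofFn_le _ i).trans ?_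
  rw [← sum_ncard_neighborSet]
  exact (Finset.sum_congr rfl fun u _ => by rw [List.length_map, (E.adjT_spec u).length_eq]).le

theorem vertsH_start_le (i : ℕ) : listStart (List.ofFn fun j => (E.vertsH j).map Fin.val) i ≤
    m * n := by
  refine (listStart_ofFn_le _ i).trans ((Finset.sum_le_card_nsmul _ _ n fun j _ => ?_).trans
    (by simp))
  rw [List.length_map, (E.vertsH_spec j).length_eq]
  exact (Set.ncard_le_card _).trans (by simp)

theorem bag_start_le (i : ℕ) : listStart (List.ofFn fun t => (E.bag t).map Fin.val) i ≤
    q * n := by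
  refine (listStart_ofFn_le _ i).trans ((Finset.sum_le_card_nsmul _ _ n fun j _ => ?_).trans
    (by simp))
  rw [List.length_map, (E.bag_spec j).length_eq]
  exact (Set.ncard_le_card _).trans (by simp)

theorem edgesH_start_le (i : ℕ) :
    listStart (List.ofFn fun j => (E.edgesH j).flatMap fun p => [p.1.val, p.2.val]) i ≤
      m * (2 * G.edgeSet.ncard) := by
  refine (listStart_ofFn_le _ i).trans ((Finset.sum_le_card_nsmul _ _ (2 * G.edgeSet.ncard) fun j _ => ?_).trans
    (by simp))
  have h1 := (E.edgesH_spec j).length_eq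
  have h2 : (H j).edgeSet.ncard ≤ G.edgeSet.ncard :=
    Set.ncard_le_ncard (H j).edgeSet_subset (Set.toFinite _)
  rw [List.length_map] at h1
  simp only [List.length_flatMap, List.length_cons, List.length_nil]
  simp
  omega

/-- Starting positions are partial sums of list lengths, which accounts for the products; an edge
list stores two numbers per edge. -/
theorem bounded_init {N : ℕ} (w : Fin m → NNRat) (hn : n < N) (hm : m < N) (hq : q < N)
    (h1 : 2 * G.edgeSet.ncard < N) (h2 : 2 * T.edgeSet.ncard < N) (h3 : m * n < N)
    (h4 : q * n < N) (h5 : m * (2 * G.edgeSet.ncard) < N) : Bounded N (E.init w) := by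
  have hN : 0 < N := by omega
  have hfin : ∀ {R K : ℕ} (f : Fin R → List (Fin K)), K < N → ∀ i, ∀ v ∈ (f i).map Fin.val, v < N := by
    intro R K f hK i v hv
    obtain ⟨x, -, rfl⟩ := List.mem_map.1 hv
    exact x.2.trans hK
  constructor
  · intro x
    match x with
    | 0 => exact hn
    | 1 => exact hm
    | 2 => exact hq
    | x + 3 => exact hN
  · intro a i
    match a with
    | 0 => exact (adjG_start_le E i).trans_lt h1
    | 1 => exact listData_ofFn_lt _ i hN (hfin _ hn)
    | 2 => exact (vertsH_start_le E i).trans_lt h3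
    | 3 => exact listData_ofFn_lt _ i hN (hfin _ hn)
    | 4 => exact (edgesH_start_le E i).trans_lt h5
    | 5 =>
      refine listData_ofFn_lt _ i hN fun j v hv => ?_
      obtain ⟨p, -, hp⟩ := List.mem_flatMap.1 hv
      have := p.1.2
      have := p.2.2
      simp only [List.mem_cons, List.not_mem_nil, or_false] at hp
      omega
    | 6 => exact (adjT_start_le E i).trans_lt h2
    | 7 => exact listData_ofFn_lt _ i hN (hfin _ hq)
    | 8 => exact (bag_start_le E i).trans_lt h4
    | 9 => exact listData_ofFn_lt _ i hN (hfin _ hn)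
    | a + 10 => exact hN

end

/-! ## The algorithm -/

/-- The number of codes, `var 3 ^ k`. -/
def powExp : ℕ → Exp
  | 0 => .lit 1
  | k + 1 => powExp k * .var 3

theorem eval_powExp (k : ℕ) : (powExp k).eval s = s.var 3 ^ k := by
  induction k with
  | zero => rfl
  | succ k ih => rw [powExp, Exp.eval_mul, ih, pow_succ, Exp.eval_var]

theorem ok_powExp (k : ℕ) (h0 : 0 < s.var 3) (hk : s.var 3 ^ k < W) : (powExp k).Ok W s := by
  induction k with
  | zero => simpa [powExp] using hk
  | succ k ih =>
    refine ⟨ih ((Nat.pow_le_pow_right h0 (Nat.le_succ k)).trans_lt hk), trivial, ?_⟩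
    rwa [eval_powExp, Exp.eval_var, ← pow_succ]

theorem cost_powExp (k : ℕ) : (powExp k).cost = 2 * k + 1 := by
  induction k with
  | zero => rfl
  | succ k ih => rw [powExp, Exp.cost_mul, ih, Exp.cost_var]; ring

/-- Compute the tables for the dynamic program from the lists. -/
def tables : Prog :=
  .seq (listTable 1 2 3 11) <| .seq (listTable 2 8 9 12) <| .seq nbhdTable <|
  .seq (meetTable 1 13 14) <| .seq (meetTable 2 12 15) <| .seq codeTable <|
  .seq weightTable projTable

/-- Solve the dynamic program. -/
def search : Prog := .seq bfs <| .seq dp collect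

/-- Max Weight Independent Packing on inputs with at least one subgraph. -/
def solveNonempty (k : ℕ) : Prog :=
  .seq (.setVar 3 (.var 1 + .lit 1)) <| .seq (.setVar 4 (powExp k)) <| .seq tables search

/-- The algorithm for Max Weight Independent Packing. -/
def solve (k : ℕ) : Prog := .cond (.eq (.var 1) (.lit 0)) .skip (solveNonempty k)

end RAM

namespace RAM

variable {W : ℕ} {s : State}

/-! ## Correctness of the algorithm -/

section

variable {n m q M : ℕ} {G : SimpleGraph (Fin n)} {H : Fin m → G.Subgraph} {w : Fin m → NNRat}
  {T : SimpleGraph (Fin q)} {X : Fin q → Set (Fin n)} (E : PackingEncoding G H T X)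

/-- The relation `cf` is the content of the conflict table. Only its values at shifted indices of
subgraphs are described, since no other digits occur in the codes that matter. -/
theorem run_tables (hv0 : s.var 0 = n) (hv1 : s.var 1 = m) (hv2 : s.var 2 = q)
    (hv3 : s.var 3 = m + 1) (hv4 : s.var 4 = M) (harr : s.arr = (E.init w).arr)
    (hwt : s.wt = (E.init w).wt) (hm : 1 ≤ m) (hM : 1 ≤ M)
    (hnW : n < W) (hmnW : m * n < W) (hqnW : q * n < W) (hbW : (m + 1) * (m + 1) < W)
    (hqbW : (q + 1) * (m + 1) < W) (hqMW : (q + 1) * M < W) :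
    Run W tables s ((20 * (m * n) + 29 * m + 7) + ((20 * (q * n) + 29 * q + 7) +
      ((m * (20 * (2 * G.edgeSet.ncard) + 60 * n + 20) + 10) +
      ((m * (m * (60 * n + 20) + 20) + 10) + ((q * (m * (60 * n + 20) + 20) + 10) +
      ((80 * M + 10) + ((30 * M + 10) + ((q + 1) * (60 * M + 30) + 10))))))))
      fun s' => ∃ cf : ℕ → ℕ → Prop, (∀ i j : Fin m, cf (i + 1) (j + 1) ↔ Conflict H i j) ∧
        IsTables s' M q (IsCode (m + 1) cf) (fun t => proj (m + 1) (meets H X t))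
          (wsum (m + 1) fun d => (E.init w).wt 0 (d - 1)) := by
  have hmW : m < W := by nlinarith
  have hqW : q + 1 < W := by nlinarith
  have hMW : M < W := by nlinarith
  have hverts : ∀ j : Fin m, ∀ v : Fin n, (v : ℕ) ∈ (E.vertsH j).map Fin.val ↔ v ∈ (H j).verts :=
    fun j v => by simp [← (E.vertsH_spec j).2, Fin.val_inj]
  have hbag : ∀ t : Fin q, ∀ v : Fin n, (v : ℕ) ∈ (E.bag t).map Fin.val ↔ v ∈ X t :=
    fun j v => by simp [← (E.bag_spec j).2, Fin.val_inj]
  have hadj : ∀ u : Fin n, ∀ v : Fin n, (v : ℕ) ∈ (E.adjG u).map Fin.val ↔ G.Adj u v :=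
    fun j v => by rw [← G.mem_neighborSet, ← (E.adjG_spec j).2]; simp [Fin.val_inj]
  have hlt : ∀ {R K : ℕ} (f : Fin R → List (Fin K)), ∀ i, ∀ v ∈ (f i).map Fin.val, v < K := by
    intro R K f i v hv
    obtain ⟨x, -, rfl⟩ := List.mem_map.1 hv
    exact x.2
  have z : ∀ a, 10 ≤ a → ∀ i, s.arr a i = 0 := by
    rintro a ha i
    obtain ⟨a, rfl⟩ := Nat.exists_eq_add_of_le' ha
    rw [harr]
    rfl
  have a0 := congrFun harr 0
  have a1 := congrFun harr 1
  have a2 := congrFun harr 2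
  have a3 := congrFun harr 3
  have a8 := congrFun harr 8
  have a9 := congrFun harr 9
  refine Run.seq ((run_listTable (by decide) (by decide) (by decide) (by decide) hv0 hv1
    (isListStore a2 a3 (hlt _)) (z 11 (by decide)) hmnW.le hmW).le ?_) fun s₂ f₂ h₂ => ?_
  · have := vertsH_start_le E m
    rw [a2]
    exact Nat.add_le_add_right (Nat.add_le_add_right (Nat.mul_le_mul_left _ this) _) _
  refine Run.seq ((run_listTable (n := n) (R := q) (by decide) (by decide) (by decide) (by decide) ?_ ?_
    (isListStore (f := fun t => (E.bag t).map Fin.val) ?_ ?_ (hlt _)) ?_ hqnW.le (by omega)).le ?_)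
    fun s₃ f₃ h₃ => ?_
  · rwa [f₂.var 0 (by decide)]
  · rwa [f₂.var 2 (by decide)]
  · rwa [f₂.arr 8 (by decide)]
  · rwa [f₂.arr 9 (by decide)]
  · rw [f₂.arr 12 (by decide)]; exact z 12 (by decide)
  · have := bag_start_le E q
    rw [f₂.arr 8 (by decide), a8]
    exact Nat.add_le_add_right (Nat.add_le_add_right (Nat.mul_le_mul_left _ this) _) _
  have b0 := (f₃.arr 0 (by decide)).trans ((f₂.arr 0 (by decide)).trans a0)
  have b1 := (f₃.arr 1 (by decide)).trans ((f₂.arr 1 (by decide)).trans a1)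
  refine Run.seq ((run_nbhdTable (n := n) (m := m) ?_ ?_ (isListStore b0 b1 (hlt _)) ?_ hmnW.le
    hnW hmW).le ?_) fun s₄ f₄ h₄ => ?_
  · rwa [f₃.var 0 (by decide), f₂.var 0 (by decide)]
  · rwa [f₃.var 1 (by decide), f₂.var 1 (by decide)]
  · rw [f₃.arr 13 (by decide), f₂.arr 13 (by decide)]; exact z 13 (by decide)
  · have := adjG_start_le E n
    rw [b0]
    exact Nat.add_le_add_right (Nat.mul_le_mul_left _ (Nat.add_le_add_right
      (Nat.add_le_add_right (Nat.mul_le_mul_left _ this) _) _)) _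
  have t11 : ∀ i : Fin m, ∀ v : Fin n, s₂.arr 11 (i * n + v) ≠ 0 ↔ v ∈ (H i).verts := by
    intro i v
    rw [h₂ i i.2 v v.2, listed_iff a2 a3 i v, hverts]
  have t12 : ∀ i : Fin q, ∀ v : Fin n, s₃.arr 12 (i * n + v) ≠ 0 ↔ v ∈ X i := by
    intro i v
    rw [h₃ i i.2 v v.2, listed_iff (f := fun t => (E.bag t).map Fin.val)
      ((f₂.arr 8 (by decide)).trans a8) ((f₂.arr 9 (by decide)).trans a9) i v, hbag]
  have t13 : ∀ i : Fin m, ∀ v : Fin n, s₄.arr 13 (i * n + v) ≠ 0 ↔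
      ∃ u ∈ (H i).verts, v = u ∨ G.Adj u v := by
    intro i v
    rw [h₄ i i.2 v v.2, f₃.arr 11 (by decide)]
    constructor
    · rintro ⟨u, hu, h1, h2⟩
      refine ⟨⟨u, hu⟩, (t11 i ⟨u, hu⟩).1 h1, h2.imp Fin.ext fun h => ?_⟩
      exact (hadj ⟨u, hu⟩ v).1 ((listed_iff b0 b1 ⟨u, hu⟩ v).1 h)
    · rintro ⟨u, h1, h2⟩
      refine ⟨u, u.2, (t11 i u).2 h1, h2.imp (congrArg _) fun h => ?_⟩
      exact (listed_iff b0 b1 u v).2 ((hadj u v).2 h)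
  refine Run.seq (run_meetTable (n := n) (m := m) (R := m) (by decide) (by decide) (by decide)
    ?_ ?_ ?_ ?_ ?_ hmnW.le hmnW.le (by nlinarith) (by omega)) fun s₅ f₅ h₅ => ?_
  · rwa [f₄.var 1 (by decide), f₃.var 1 (by decide), f₂.var 1 (by decide)]
  · rwa [f₄.var 0 (by decide), f₃.var 0 (by decide), f₂.var 0 (by decide)]
  · rwa [f₄.var 1 (by decide), f₃.var 1 (by decide), f₂.var 1 (by decide)]
  · rwa [f₄.var 3 (by decide), f₃.var 3 (by decide), f₂.var 3 (by decide)]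
  · rw [f₄.arr 14 (by decide), f₃.arr 14 (by decide), f₂.arr 14 (by decide)]; exact z 14 (by decide)
  have v₅ : ∀ x < 5, s₅.var x = s.var x := by
    intro x hx
    have hx2 : x ∉ (listTable 1 2 3 11).vars ∧ x ∉ (listTable 2 8 9 12).vars ∧ x ∉ nbhdTable.vars ∧
        x ∉ (meetTable 1 13 14).vars := by
      interval_cases x <;> decide
    rw [f₅.var x hx2.2.2.2, f₄.var x hx2.2.2.1, f₃.var x hx2.2.1, f₂.var x hx2.1]
  refine Run.seq (run_meetTable (n := n) (m := m) (R := q) (by decide) (by decide) (by decide)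
    ?_ ?_ ?_ ?_ ?_ hqnW.le hmnW.le (by nlinarith) (by omega)) fun s₆ f₆ h₆ => ?_
  · rwa [v₅ 2 (by decide)]
  · rwa [v₅ 0 (by decide)]
  · rwa [v₅ 1 (by decide)]
  · rwa [v₅ 3 (by decide)]
  · rw [f₅.arr 15 (by decide), f₄.arr 15 (by decide), f₃.arr 15 (by decide), f₂.arr 15 (by decide)]
    exact z 15 (by decide)
  rw [f₄.arr 11 (by decide), f₃.arr 11 (by decide)] at h₅
  rw [f₅.arr 11 (by decide), f₄.arr 11 (by decide), f₃.arr 11 (by decide), f₅.arr 12 (by decide),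
    f₄.arr 12 (by decide)] at h₆
  -- Rows are numbered from 0 and columns by digits from 1, hence `- 1` for the row alone.
  have t14 : ∀ i j : Fin m, s₆.arr 14 (((i + 1 : ℕ) - 1) * (m + 1) + (j + 1)) ≠ 0 ↔
      Conflict H i j := by
    intro i j
    rw [f₆.arr 14 (by decide), Nat.add_sub_cancel, h₅ _ _ (by omega)]
    constructor
    · rintro ⟨-, j', hj', h, v, hv, h1, h2⟩
      obtain rfl : (j : ℕ) = j' := by omega
      obtain ⟨u, hu, h3⟩ := (t13 i ⟨v, hv⟩).1 h1
      exact ⟨u, hu, ⟨v, hv⟩, (t11 j ⟨v, hv⟩).1 h2, h3⟩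
    · rintro ⟨u, hu, v, hv, h⟩
      exact ⟨i.2, j, j.2, rfl, v, v.2, (t13 i v).2 ⟨u, hu, h⟩, (t11 j v).2 hv⟩
  -- The case `t = q` is included: both sides are false for the dummy node.
  have t15 : ∀ t ≤ q, ∀ d < m + 1, s₆.arr 15 (t * (m + 1) + d) ≠ 0 ↔ meets H X t d := by
    intro t ht d hd
    rw [h₆ t d (by omega), meets_iff]
    constructor
    · rintro ⟨htq, j, hj, rfl, v, hv, h1, h2⟩
      exact ⟨⟨t, htq⟩, ⟨j, hj⟩, rfl, rfl, ⟨v, hv⟩, (t11 ⟨j, hj⟩ ⟨v, hv⟩).1 h2,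
        (t12 ⟨t, htq⟩ ⟨v, hv⟩).1 h1⟩
    · rintro ⟨t, j, rfl, rfl, v, h1, h2⟩
      exact ⟨t.2, j, j.2, rfl, v, v.2, (t12 t v).2 h2, (t11 j v).2 h1⟩
  have v₆ : ∀ x < 5, s₆.var x = s.var x := by
    intro x hx
    rw [f₆.var x (by interval_cases x <;> decide), v₅ x hx]
  have z₆ : ∀ a, 16 ≤ a → s₆.arr a = s.arr a := by
    intro a ha
    rw [f₆.arr a (by simp [meetTable]; omega), f₅.arr a (by simp [meetTable]; omega),
      f₄.arr a (by simp [nbhdTable, markList]; omega),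
      f₃.arr a (by simp [listTable, markList]; omega),
      f₂.arr a (by simp [listTable, markList]; omega)]
  have w₆ : s₆.wt = (E.init w).wt := by
    funext a
    rw [f₆.wt a (by simp [meetTable]), f₅.wt a (by simp [meetTable]),
      f₄.wt a (by simp [nbhdTable, markList]),
      f₃.wt a (by simp [listTable, markList]),
      f₂.wt a (by simp [listTable, markList]), hwt]
  refine Run.seq (run_codeTable (b := m + 1) (M := M) (by omega) ?_ ?_ ?_ hbW.le hMW)
    fun s₇ f₇ h₇ => ?_
  · rwa [v₆ 3 (by decide)]
  · rwa [v₆ 4 (by decide)]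
  · rw [z₆ 16 le_rfl]; exact z 16 (by decide)
  refine Run.seq (run_weightTable (b := m + 1) (M := M) (by omega) ?_ ?_ hM ?_ (by omega))
    fun s₈ f₈ h₈ => ?_
  · rwa [f₇.var 3 (by decide), v₆ 3 (by decide)]
  · rwa [f₇.var 4 (by decide), v₆ 4 (by decide)]
  · rw [f₇.wt 1 (by decide), w₆]; exact fun _ => rfl
  refine (run_projTable (fun t => meets H X t) (b := m + 1) (M := M) (q := q) (by omega) ?_ ?_ ?_ ?_
    meets_zero ?_ hqbW.le hqMW hqW hM).mono le_rfl fun s₉ f₉ h₉ => ?_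
  · rwa [f₈.var 3 (by decide), f₇.var 3 (by decide), v₆ 3 (by decide)]
  · rwa [f₈.var 4 (by decide), f₇.var 4 (by decide), v₆ 4 (by decide)]
  · rwa [f₈.var 2 (by decide), f₇.var 2 (by decide), v₆ 2 (by decide)]
  · rw [f₈.arr 17 (by decide), f₇.arr 17 (by decide), z₆ 17 (by decide)]; exact z 17 (by decide)
  · rwa [f₈.arr 15 (by decide), f₇.arr 15 (by decide)]
  refine ⟨fun e d => s₆.arr 14 ((e - 1) * (m + 1) + d) ≠ 0, t14, ?_, ?_, fun x hx => ?_, h₉, fun x hx => ?_,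
    fun t _ x hx => (proj_le (by omega) (meets_zero t)).trans_lt hx⟩
  · rwa [f₉.var 2 (by decide), f₈.var 2 (by decide), f₇.var 2 (by decide), v₆ 2 (by decide)]
  · rwa [f₉.var 4 (by decide), f₈.var 4 (by decide), f₇.var 4 (by decide), v₆ 4 (by decide)]
  · rw [f₉.arr 16 (by decide), f₈.arr 16 (by decide), h₇, and_iff_right hx]
  · rw [f₉.wt 1 (by decide), h₈ x hx, f₇.wt 0 (by decide), w₆]

end

end RAM

/-! ### Correctness of the search and of the whole program -/

namespace RAM

variable {W : ℕ} {s : State}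

section

variable {n m q k : ℕ} {G : SimpleGraph (Fin n)} {H : Fin m → G.Subgraph} {w : Fin m → NNRat}
  {T : SimpleGraph (Fin q)} {X : Fin q → Set (Fin n)} (E : PackingEncoding G H T X)

theorem run_search (hH : ∀ j, (H j).Connected) (hX : IsTreeDecomposition G T X)
    (hk : bagsIndepNum G X ≤ k) (hm : 1 ≤ m) (hq : 1 ≤ q)
    {cf : ℕ → ℕ → Prop} (hcf : ∀ i j : Fin m, cf (i + 1) (j + 1) ↔ Conflict H i j)
    (hT : IsTables s ((m + 1) ^ k) q (IsCode (m + 1) cf) (fun t => proj (m + 1) (meets H X t))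
      (wsum (m + 1) fun d => (E.init w).wt 0 (d - 1)))
    (hv3 : s.var 3 = m + 1) (h6 : s.arr 6 = (E.init w).arr 6) (h7 : s.arr 7 = (E.init w).arr 7)
    (h10 : s.arr 10 = fun _ => 0) (hz : ∀ a, 18 ≤ a → s.arr a = fun _ => 0)
    (hz2 : s.wt 2 = fun _ => 0) (hz3 : s.wt 3 = fun _ => 0)
    (hqMW : (q + 1) * (m + 1) ^ k < W) (hqW : q + 2 < W) :
    Run W search s ((40 * (2 * T.edgeSet.ncard) + 40 * q + 40) +
      ((q * (150 * (m + 1) ^ k + 50) + 10) + (q * (20 * k + 60) + 20)))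
      fun s' => IsMaxWeightIndepPacking G H w (packingOutput m s') := by
  have hm1 : 1 < m + 1 := by omega
  have hadj : ∀ u v : Fin q, (v : ℕ) ∈ (E.adjT u).map Fin.val ↔ T.Adj u v :=
    fun j v => by rw [← T.mem_neighborSet, ← (E.adjT_spec j).2]; simp [Fin.val_inj]
  have hlt : ∀ i, ∀ v ∈ (E.adjT i).map Fin.val, v < q := by
    intro i v hv
    obtain ⟨x, -, rfl⟩ := List.mem_map.1 hv
    exact x.2
  have hR : ∀ u v : Fin q, Listed s 6 7 u v ↔ T.Adj u v := fun u v =>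
    (listed_iff h6 h7 u v).trans (hadj u v)
  have hconn : ∀ Z : ℕ → Prop, Z 0 → (∀ u < q, Z u → ∀ v, Listed s 6 7 u v → Z v) →
      ∀ v < q, Z v := by
    intro Z h0 hstep v hv
    obtain ⟨p⟩ := hX.isTree.connected.preconnected ⟨0, hq⟩ ⟨v, hv⟩
    have : ∀ a c : Fin q, T.Walk a c → Z a → Z c := by
      intro a c p ha
      induction p with
      | nil => exact ha
      | cons hadj _ ih => exact ih (hstep _ (Fin.is_lt _) ha _ ((hR _ _).2 hadj))
    exact this _ _ p h0
  refine Run.seq ((run_bfs hT.var_two hq (isListStore h6 h7 hlt) (by simp [hz]) (by simp [hz]) hqW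
    hconn).le ?_) fun s₁ f₁ hO => ?_
  · have := adjT_start_le E q
    rw [h6]
    exact Nat.add_le_add_right (Nat.add_le_add_right (Nat.mul_le_mul_left _ this) _) _
  have hT₁ := hT.congr (f₁.var 2 (by decide)) (f₁.var 4 (by decide)) (f₁.arr 16 (by decide))
    (f₁.arr 17 (by decide)) (f₁.wt 1 (by decide))
  refine Run.seq (run_dp hT₁ hO hqMW (fun t _ x _ => wsum_proj_le hm1 (meets_zero t) fun d => ?_)
    ?_ ?_) fun s₂ f₂ hdp => ?_
  · change 0 ≤ dite _ _ _
    split_ifs <;> positivity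
  · rw [f₁.wt 2 (by decide), hz2]; exact fun _ => rfl
  · rw [f₁.wt 3 (by decide), hz3]; exact fun _ => rfl
  have hT₂ := hT₁.congr (f₂.var 2 (by decide)) (f₂.var 4 (by decide)) (f₂.arr 16 (by decide))
    (f₂.arr 17 (by decide)) (f₂.wt 1 (by decide))
  rw [← f₂.arr 18 (by decide), ← f₂.arr 19 (by decide)] at hO hdp
  refine (run_collect (b := m + 1) (k := k)
    (f := fun t x => wsum (m + 1) (fun d => (E.init w).wt 0 (d - 1)) x -
      wsum (m + 1) (fun d => (E.init w).wt 0 (d - 1)) (proj (m + 1) (meets H X (s₂.arr 19 t)) x) +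
        s₂.wt 2 (t * (m + 1) ^ k + x))
    (best := fun t x => s₂.wt 3 (t * (m + 1) ^ k + x)) hT₂ hm1 ?_ le_rfl hO hqMW (by omega)
    (fun l h1 h2 => hdp.max l h1 h2) ?_ ?_ ?_).mono le_rfl ?_
  · rw [f₂.var 3 (by decide), f₁.var 3 (by decide), hv3]
  -- The projection of `y` to `t` is a state of `t` consistent with `y`: projections commute, and
  -- `y` is its own projection to `p`.
  · rintro t ht p hp y ⟨h1, h2, h3⟩
    refine ⟨proj (m + 1) (meets H X t) y, ⟨(proj_le hm1 (meets_zero t)).trans_lt h1,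
      h2.proj hm1 (meets_zero t), proj_proj_self hm1 (meets_zero t)⟩, ?_⟩
    rw [proj_comm hm1 (meets_zero p) (meets_zero t)]
    exact congrArg _ h3
  · exact ⟨by positivity, isCode_zero, proj_zero⟩
  · rw [f₂.arr 22 (by decide), f₁.arr 22 (by decide), hz 22 (by decide)]; exact fun _ => rfl
  rintro s₃ - ⟨ch, hchq, hch, hmarks⟩
  refine isMaxWeightIndepPacking_of_isDP hH hX hk hm1 hcf ?_ hO (fun u v => (hR u v).1)
    (fun t _ x hx => (proj_le hm1 (meets_zero t)).trans_lt hx) hdp hchq hch fun j => ?_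
  · intro j
    exact dif_pos j.2
  rw [packingOutput, Finset.mem_filter, hmarks, f₂.arr 10 (by decide), f₁.arr 10 (by decide), h10]
  -- Marks sit at the digit minus one. The digits are positive because they are shifted indices, so
  -- the truncated subtraction loses nothing.
  simp only [Finset.mem_univ, true_and, ne_eq, not_true_eq_false, false_or]
  refine exists_congr fun t => and_congr_right fun ht => ⟨?_, fun h => ⟨_, h, rfl⟩⟩
  rintro ⟨d, hd, hj⟩
  obtain ⟨i, rfl⟩ := exists_meets_eq t ((proj_eq_self_iff hm1 (meets_zero t)).1 (hch t ht).1.2.2 d hd)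
  rwa [hj, Nat.add_sub_cancel]

theorem run_solveNonempty (hH : ∀ j, (H j).Connected) (hX : IsTreeDecomposition G T X)
    (hk : bagsIndepNum G X ≤ k) (hm : 1 ≤ m) (hq : 1 ≤ q) (hnW : n < W) (hmnW : m * n < W)
    (hqnW : q * n < W) (hbW : (m + 1) * (m + 1) < W) (hqbW : (q + 1) * (m + 1) < W)
    (hqMW : (q + 1) * (m + 1) ^ k < W) (hqW : q + 2 < W) :
    Run W (solveNonempty k) (E.init w) (4 + ((2 * k + 2) + (((20 * (m * n) + 29 * m + 7) +
      ((20 * (q * n) + 29 * q + 7) + ((m * (20 * (2 * G.edgeSet.ncard) + 60 * n + 20) + 10) +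
      ((m * (m * (60 * n + 20) + 20) + 10) + ((q * (m * (60 * n + 20) + 20) + 10) +
      ((80 * (m + 1) ^ k + 10) + ((30 * (m + 1) ^ k + 10) +
      ((q + 1) * (60 * (m + 1) ^ k + 30) + 10)))))))) +
      ((40 * (2 * T.edgeSet.ncard) + 40 * q + 40) +
      ((q * (150 * (m + 1) ^ k + 50) + 10) + (q * (20 * k + 60) + 20))))))
      fun s' => IsMaxWeightIndepPacking G H w (packingOutput m s') := by
  have hMW : (m + 1) ^ k < W := by nlinarith
  have hmW : m + 1 < W := by nlinarith
  refine Run.step (Run.setVar (by simp [PackingEncoding.init]; omega) (Run.step ((Run.setVar ?_ ?_).le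
    (by rw [cost_powExp]))))
  · refine ok_powExp k ?_ ?_
    · simp
    · simpa [PackingEncoding.init] using hMW
  refine Run.seq (run_tables E (M := (m + 1) ^ k) ?_ ?_ ?_ ?_ ?_ rfl rfl hm (by exact Nat.one_le_pow _ _ (by omega))
    hnW hmnW hqnW hbW hqbW hqMW) ?_
  · simp [PackingEncoding.init]
  · simp [PackingEncoding.init]
  · simp [PackingEncoding.init]
  · simp [PackingEncoding.init]
  · simp [PackingEncoding.init, eval_powExp]
  rintro s₂ f₂ ⟨cf, hcf, hT⟩
  refine run_search E hH hX hk hm hq hcf hT ?_ ?_ ?_ ?_ ?_ ?_ ?_ hqMW hqW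
  · rw [f₂.var 3 (by decide)]
    simp [PackingEncoding.init]
  · exact f₂.arr 6 (by decide)
  · exact f₂.arr 7 (by decide)
  · exact f₂.arr 10 (by decide)
  · intro a ha
    obtain ⟨a, rfl⟩ := Nat.exists_eq_add_of_le' ha
    exact f₂.arr _ (by simp [tables, listTable, markList, nbhdTable, meetTable, codeTable,
      weightTable, projTable])
  · exact f₂.wt 2 (by decide)
  · exact f₂.wt 3 (by decide)

end

end RAM

/-- Here `L` stands for `m ^ k`, and `hM` for `(m + 1) ^ k ≤ (2 * m) ^ k`. As `n`, `m` and `q` are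
positive, each term is dominated by one of the main products; once these comparisons are listed, the
inequality is linear in the monomials. -/
theorem solve_cost_le {n m q e T k M L : ℕ} (hn : 1 ≤ n) (hm : 1 ≤ m) (hq : 1 ≤ q) (hT : T + 1 = q)
    (hM : M ≤ 2 ^ k * L) :
    3 + 1 + (4 + ((2 * k + 2) + (((20 * (m * n) + 29 * m + 7) +
      ((20 * (q * n) + 29 * q + 7) + ((m * (20 * (2 * e) + 60 * n + 20) + 10) +
      ((m * (m * (60 * n + 20) + 20) + 10) + ((q * (m * (60 * n + 20) + 20) + 10) +
      ((80 * M + 10) + ((30 * M + 10) + ((q + 1) * (60 * M + 30) + 10)))))))) +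
      ((40 * (2 * T) + 40 * q + 40) +
      ((q * (150 * M + 50) + 10) + (q * (20 * k + 60) + 20)))))) ≤
      1000 * (2 ^ k + k + 1) * (m * ((m + q) * n + e + L * q) + 1) := by
  have h1 : m * n ≤ m * m * n := Nat.mul_le_mul_right _ (Nat.le_mul_of_pos_left _ hm)
  have h2 : m * m ≤ m * m * n := Nat.le_mul_of_pos_right _ hn
  have h3 : m ≤ m * m := Nat.le_mul_of_pos_left _ hm
  have h4 : q * m ≤ m * q * n := by rw [mul_comm q]; exact Nat.le_mul_of_pos_right _ hn
  have h5 : q ≤ q * m := Nat.le_mul_of_pos_right _ hm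
  have h6 : q * n ≤ m * q * n := Nat.mul_le_mul_right _ (Nat.le_mul_of_pos_left _ hm)
  have h7 : q * M ≤ 2 ^ k * (m * (L * q)) := calc
    q * M ≤ q * (2 ^ k * L) := Nat.mul_le_mul_left _ hM
    _ = 1 * (2 ^ k * (L * q)) := by ring
    _ ≤ m * (2 ^ k * (L * q)) := Nat.mul_le_mul_right _ hm
    _ = _ := by ring
  have h8 : M ≤ q * M := Nat.le_mul_of_pos_left _ hq
  have h9 : k * q ≤ k * (m * q * n) := Nat.mul_le_mul_left _ (h5.trans h4)
  have h10 : 0 ≤ 2 ^ k * (m * m * n + m * q * n + m * e + 1) := Nat.zero_le _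
  have h11 : 0 ≤ k * (m * m * n + m * e + m * (L * q)) + m * (L * q) := Nat.zero_le _
  have h12 : 0 ≤ k * q := Nat.zero_le _
  have h13 : 0 ≤ m * e := Nat.zero_le _
  have h14 : T ≤ q := by omega
  linarith

theorem isMaxWeightIndepPacking_of_isEmpty {V J : Type*} [IsEmpty J] {G : SimpleGraph V}
    {H : J → G.Subgraph} {w : J → NNRat} (I : Finset J) : IsMaxWeightIndepPacking G H w I :=
  ⟨fun i => isEmptyElim i, fun I' => by simp [Finset.eq_empty_of_isEmpty]⟩

/-- For every `k ≥ 1`, Max Weight Independent Packing is solved by a RAM program with words of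
`O(log N)` bits, `N = |V(G)| + |E(G)| + |J| + |V(T)| + 2`, in time
`O(|J| ((|J| + |V(T)|) |V(G)| + |E(G)| + |J|^k |V(T)|))` on inputs that come with a tree
decomposition of independence number at most `k`. (The `+ 1` only matters when `J` is empty.) -/
theorem mainTheorem1 (k : ℕ) (hk : 1 ≤ k) :
    ∃ (P : RAM.Prog) (C c : ℕ),
      ∀ (n m q : ℕ) (G : SimpleGraph (Fin n)) (H : Fin m → G.Subgraph) (w : Fin m → NNRat)
        (T : SimpleGraph (Fin q)) (X : Fin q → Set (Fin n)),
        (∀ j, (H j).Connected) →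
        IsTreeDecomposition G T X →
        bagsIndepNum G X ≤ k →
        ∀ E : PackingEncoding G H T X,
          ∃ (s : RAM.State) (t : ℕ),
            RAM.Exec ((n + G.edgeSet.ncard + m + q + 2) ^ c) P (E.init w) s t ∧
            t ≤ C * (m * ((m + q) * n + G.edgeSet.ncard + m ^ k * q) + 1) ∧
            IsMaxWeightIndepPacking G H w (packingOutput m s) := by
  -- Words below `N ^ (k + 3)` suffice: addresses indexed by a node and a code stay below `N ^ (k +
  -- 1)` up to a strict inequality, and the starting positions of the edge lists below `N ^ 3`.
  refine ⟨RAM.solve k, 1000 * (2 ^ k + k + 1), k + 3, fun n m q G H w T X hH hX hb E => ?_⟩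
  set e := G.edgeSet.ncard with he
  set N := n + e + m + q + 2 with hN
  have hW : N ^ 3 ≤ N ^ (k + 3) := Nat.pow_le_pow_right (by omega) (by omega)
  have hN3 : N * N < N ^ 3 := by
    rw [pow_succ, pow_two]
    exact lt_mul_of_one_lt_right (by positivity) (by omega)
  have hmul : ∀ x y, x ≤ N → y ≤ N → x * y < N ^ (k + 3) := fun x y hx hy =>
    ((Nat.mul_le_mul hx hy).trans_lt hN3).trans_le hW
  have hle : ∀ x, x ≤ N → x < N ^ (k + 3) := fun x hx => by simpa using hmul x 1 hx (by omega)
  rcases Nat.eq_zero_or_pos m with rfl | hm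
  -- Without subgraphs only constant time is available, so the program stops at once; the untouched
  -- output array denotes the empty set.
  · refine ⟨_, _, .cond_true _ _ _ _ _ _ ?_ rfl (.skip _), ?_, isMaxWeightIndepPacking_of_isEmpty _⟩
    · exact ⟨hle _ (Nat.zero_le _), hle _ (Nat.zero_le _)⟩
    · simp only [RAM.Cond.cost, RAM.Exp.cost, Nat.zero_mul]
      rw [Nat.zero_add, Nat.mul_one]
      have := Nat.zero_le (2 ^ k)
      omega
  -- A member of the family provides a vertex, and the vertex lies in a bag, so `n` and `q` are
  -- positive.
  obtain ⟨v, -⟩ := (hH ⟨0, hm⟩).nonempty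
  obtain ⟨r, -⟩ := hX.exists_mem v
  have hn : 1 ≤ n := v.pos
  have hq : 1 ≤ q := r.pos
  have hT : T.edgeSet.ncard + 1 = q := by
    classical
    have := hX.isTree.card_edgeFinset
    rwa [Fintype.card_fin, SimpleGraph.edgeFinset, ← Set.ncard_eq_toFinset_card'] at this
  have hM : (q + 1) * (m + 1) ^ k < N ^ (k + 3) := calc
    _ ≤ N * N ^ k := Nat.mul_le_mul (by omega) (Nat.pow_le_pow_left (by omega) k)
    _ = N ^ (k + 1) := by ring
    _ < N ^ (k + 3) := Nat.pow_lt_pow_right (by omega) (by omega)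
  have hbd : RAM.Bounded (N ^ (k + 3)) (E.init w) := by
    refine RAM.bounded_init E w (hle _ (by omega)) (hle _ (by omega)) (hle _ (by omega))
      (hmul _ _ (by omega) (by omega)) (hmul _ _ (by omega) (by omega))
      (hmul _ _ (by omega) (by omega)) (hmul _ _ (by omega) (by omega)) ?_
    refine lt_of_lt_of_le ?_ hW
    calc m * (2 * e) < N * (2 * N) := Nat.mul_lt_mul'' (by omega) (by omega)
      _ ≤ N * (N * N) := Nat.mul_le_mul_left _ (Nat.mul_le_mul_right _ (by omega))
      _ = N ^ 3 := by ring
  obtain ⟨s, t, hs, ht, hI⟩ := RAM.run_solveNonempty E (w := w) hH hX hb hm hq (hle _ (by omega))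
    (hmul _ _ (by omega) (by omega)) (hmul _ _ (by omega) (by omega))
    (hmul _ _ (by omega) (by omega)) (hmul _ _ (by omega) (by omega)) hM (hle _ (by omega)) hbd
  refine ⟨s, _, .cond_false _ _ _ _ _ _ ?_ hm.ne' hs, ?_, hI⟩
  · exact ⟨hle _ (by change m ≤ N; omega), hle _ (Nat.zero_le _)⟩
  · refine (Nat.add_le_add_left ht _).trans (solve_cost_le hn hm hq hT ?_)
    rw [← mul_pow]
    exact Nat.pow_le_pow_left (by omega) k
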